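/- Let $\mathsf{L}_\omega$ be the language of classical higher-order arithmetic: the finite types are $0$ (natural numbers) and, with $\sigma,\tau$, also $\sigma\to\tau$; write $1=0\to0$, $2=1\to0$. There are variables of every finite type, the constants $0,1,+_0,\times_0$, the combinators $\Pi,\Sigma$, recursors $\mathbf R_\sigma$, and the prime formulas $s=_0t$, $s<_0t$; equality at higher types is defined extensionally from $=_0$. The system $\mathsf{RCA}_0^\omega$ consists of the basic axioms for $0,1,<,+,\times$ (discrete ordered semi-ring), the defining axioms of $\Pi$, $\Sigma$ and of $\mathbf R_0$ ($\mathbf R_0(f,m,0)=m$, $\mathbf R_0(f,m,n+1)=f(n,\mathbf R_0(f,m,n))$), the axiom of extensionality ($x=_\rho y\to\varphi(x)=_\tau\varphi(y)$, all types $\rho,\tau$), induction for quantifier-free formulas, and $\mathsf{QF\text{-}AC}^{1,0}$: $(\forall x^1)(\exists y^0)A(x,y)\to(\exists Y^{2})(\forall x^1)A(x,Y(x))$ for quantifier-free $A$. Real numbers are coded by type $1$ objects representing sequences of rationals with $|q_n-q_{n+i}|<2^{-n}$; $I=[0,1]$; functions $I\to\mathbb R$ are type $1\to1$ objects that map codes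 of elements of $I$ to codes of reals and respect $=_{\mathbb R}$. Subsets of $\mathbb N^{\mathbb N}$ and binary relations on them are given by characteristic functions of type $2$ and $1\to(1\to0)$. Consider the following sentences. * $\mathsf{WWKL}$: if a tree $T\subseteq 2^{<\mathbb N}$ has no infinite path, then $\lim_{n\to\infty}|\{s\in T:|s|=n\}|/2^n=0$. * $\mathsf{MCT}_{\mathsf{net}}$: let $D\subseteq\mathbb N^{\mathbb N}$ be non-empty and directed by a reflexive and transitive relation $\preceq$, and let $(f_d)_{d\in D}$ be continuous functions $I\to\mathbb R$ such that $a\preceq b$ implies $f_a(x)\le f_b(x)$ for all $x\in I$. If the pointwise limit $f=\lim_df_d$ exists and is bounded and continuous on $I$, then $\lim_d\int_0^1|f(x)-f_d(x)|\,dx=0$, where the integral is the Riemann integral; that is, for every $\varepsilon>0$ there is $d_0\in D$ such that for all $e\in D$ with $d_0\preceq e$, if $A\in\mathbb R$ is the Riemann integral $\int_0^1|f(x)-f_e(x)|\,dx$, then $|A|<\varepsilon$. * $\mathsf{WHBU}_0$: for every $\Psi:I\to\mathbb R^+$ and every real $\varepsilon>0$ there are $y_0,\dots,y_n\in I$ such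 that $\sum_{i=0}^n|J_i'|\ge1-\varepsilon$, where $J_i=(y_i-\Psi(y_i),y_i+\Psi(y_i))$, $J_i'=J_i\setminus\bigcup_{j<i}J_j$, and $|J_i'|$ is the total length of the finite union of intervals $J_i'\cap I$. Then $\mathsf{RCA}_0^\omega+\mathsf{WWKL}+\mathsf{MCT}_{\mathsf{net}}$ proves $\mathsf{WHBU}_0$. -/

import Mathlib

/-! # Higher-order arithmetic: syntax, derivations, the base theory, and the principles -/

namespace HigherOrderArith

/-! ## Finite types, terms and formulas of the language of finite-type arithmetic -/

/-- Finite types: `zero` is the type of natural numbers, `arrow σ τ` the type of functionals from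
objects of type `σ` to objects of type `τ`. -/
inductive FinType : Type
  | zero : FinType
  | arrow (σ τ : FinType) : FinType
  deriving DecidableEq

/-- The constants: `0`, `1`, `+`, `×`, the combinators `Π` and `Σ`, and the recursors `R_σ`. -/
inductive Cst : FinType → Type
  | zero : Cst .zero
  | one : Cst .zero
  | add : Cst (.arrow .zero (.arrow .zero .zero))
  | mul : Cst (.arrow .zero (.arrow .zero .zero))
  | K (σ τ : FinType) : Cst (.arrow σ (.arrow τ σ))
  | S (ρ σ τ : FinType) :
      Cst (.arrow (.arrow ρ (.arrow σ τ)) (.arrow (.arrow ρ σ) (.arrow ρ τ)))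
  | recursor (σ : FinType) :
      Cst (.arrow (.arrow .zero (.arrow σ σ)) (.arrow σ (.arrow .zero σ)))

/-- Terms. Variables are de Bruijn indices, counted separately for each type: `var σ n` refers to
the `n`-th enclosing quantifier over type `σ`. -/
inductive Tm : FinType → Type
  | var (σ : FinType) (n : ℕ) : Tm σ
  | cst {σ : FinType} (c : Cst σ) : Tm σ
  | app {σ τ : FinType} (t : Tm (.arrow σ τ)) (u : Tm σ) : Tm τ

/-- Formulas. The prime formulas are `t =₀ u` and `t <₀ u` at type zero; the logical symbols are
falsum, implication and the universal quantifiers over all finite types. -/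
inductive Fm : Type
  | eq (t u : Tm .zero) : Fm
  | lt (t u : Tm .zero) : Fm
  | bot : Fm
  | imp (φ ψ : Fm) : Fm
  | all (σ : FinType) (φ : Fm) : Fm

namespace Tm

def zero : Tm .zero := .cst .zero
def one : Tm .zero := .cst .one
def add (t u : Tm .zero) : Tm .zero := .app (.app (.cst .add) t) u
def mul (t u : Tm .zero) : Tm .zero := .app (.app (.cst .mul) t) u

/-- Make room for a new quantifier over type `σ`. -/
def shift (σ : FinType) : {τ : FinType} → Tm τ → Tm τ
  | _, .var τ n => .var τ (if τ = σ then n + 1 else n)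
  | _, .cst c => .cst c
  | _, .app t u => .app (shift σ t) (shift σ u)

/-- Simultaneous substitution. -/
def subst (s : (τ : FinType) → ℕ → Tm τ) : {τ : FinType} → Tm τ → Tm τ
  | _, .var τ n => s τ n
  | _, .cst c => .cst c
  | _, .app t u => .app (subst s t) (subst s u)

/-- The substitution `s` carried under a quantifier over type `σ`. -/
def up (σ : FinType) (s : (τ : FinType) → ℕ → Tm τ) (τ : FinType) (n : ℕ) : Tm τ :=
  if τ = σ then
    match n with
    | 0 => .var τ 0
    | n + 1 => (s τ n).shift σ
  else (s τ n).shift σ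

/-- The substitution of `t` for the variable of type `σ` with index `0`, removing that variable. -/
def instVar (σ : FinType) (t : Tm σ) (τ : FinType) (n : ℕ) : Tm τ :=
  if h : σ = τ then
    match n with
    | 0 => h ▸ t
    | n + 1 => .var τ n
  else .var τ n

/-- The substitution of `n + 1` for the variable `n` of type zero with index `0`. -/
def succVar : (τ : FinType) → ℕ → Tm τ
  | .zero, 0 => add (.var .zero 0) one
  | τ, n => .var τ n

end Tm

namespace Fm

def neg (φ : Fm) : Fm := .imp φ .bot
def and (φ ψ : Fm) : Fm := neg (.imp φ (neg ψ))
def or (φ ψ : Fm) : Fm := .imp (neg φ) ψ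
def iff (φ ψ : Fm) : Fm := and (.imp φ ψ) (.imp ψ φ)
def ex (σ : FinType) (φ : Fm) : Fm := neg (.all σ (neg φ))

/-- Simultaneous (capture-avoiding) substitution. -/
def subst (s : (τ : FinType) → ℕ → Tm τ) : Fm → Fm
  | .eq t u => .eq (t.subst s) (u.subst s)
  | .lt t u => .lt (t.subst s) (u.subst s)
  | .bot => .bot
  | .imp φ ψ => .imp (φ.subst s) (ψ.subst s)
  | .all σ φ => .all σ (φ.subst (Tm.up σ s))

/-- Make room for a new quantifier over type `σ`. -/
def shift (σ : FinType) (φ : Fm) : Fm := φ.subst fun τ n => (Tm.var τ n).shift σ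

/-- `φ(t)`, where `t` is put for the variable of type `σ` with index `0`. -/
def inst (σ : FinType) (t : Tm σ) (φ : Fm) : Fm := φ.subst (Tm.instVar σ t)

/-- Quantifier-free formulas (with variables of any finite type). -/
def QF : Fm → Prop
  | .eq _ _ => True
  | .lt _ _ => True
  | .bot => True
  | .imp φ ψ => φ.QF ∧ ψ.QF
  | .all _ _ => False

/-- Equality at an arbitrary type: `x =_τ y` is `∀ z₁ … z_k, x z₁ … z_k =₀ y z₁ … z_k`. -/
def eqT : (τ : FinType) → Tm τ → Tm τ → Fm
  | .zero, t, u => .eq t u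
  | .arrow σ τ, t, u =>
      .all σ (eqT τ (.app (t.shift σ) (.var σ 0)) (.app (u.shift σ) (.var σ 0)))

end Fm

/-! ## Derivations -/

/-- Natural deduction for classical many-sorted predicate logic with equality `=₀`.
`Derives T Γ φ`: there is a derivation of `φ` from the axioms `T` and the open assumptions `Γ`.
Free variables of an axiom are read universally (they may be generalised), those of an open
assumption are not. -/
inductive Derives (T : Set Fm) : List Fm → Fm → Prop
  | ax {Γ : List Fm} {φ : Fm} (h : φ ∈ T) : Derives T Γ φ
  | hyp {Γ : List Fm} {φ : Fm} (h : φ ∈ Γ) : Derives T Γ φ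
  | impI {Γ : List Fm} {φ ψ : Fm} (h : Derives T (φ :: Γ) ψ) : Derives T Γ (.imp φ ψ)
  | impE {Γ : List Fm} {φ ψ : Fm} (h : Derives T Γ (.imp φ ψ)) (h' : Derives T Γ φ) :
      Derives T Γ ψ
  | raa {Γ : List Fm} {φ : Fm} (h : Derives T (φ.neg :: Γ) .bot) : Derives T Γ φ
  | allI {Γ : List Fm} {σ : FinType} {φ : Fm} (h : Derives T (Γ.map (Fm.shift σ)) φ) :
      Derives T Γ (.all σ φ)
  | allE {Γ : List Fm} {σ : FinType} {φ : Fm} (h : Derives T Γ (.all σ φ)) (t : Tm σ) :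
      Derives T Γ (φ.inst σ t)
  | eqRefl {Γ : List Fm} (t : Tm .zero) : Derives T Γ (.eq t t)
  | eqSubst {Γ : List Fm} {t u : Tm .zero} {φ : Fm} (h : Derives T Γ (.eq t u))
      (h' : Derives T Γ (φ.inst .zero t)) : Derives T Γ (φ.inst .zero u)

/-- The theory `T` proves `φ`. -/
def Proves (T : Set Fm) (φ : Fm) : Prop := Derives T [] φ

/-! ## The base theory -/

/-- Type `1`: functions from numbers to numbers. -/
abbrev t1 : FinType := .arrow .zero .zero
/-- Type `2`: functionals from type `1` to numbers. -/
abbrev t2 : FinType := .arrow t1 .zero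

/-- The axioms of `RCA₀^ω`. Axioms about arbitrary objects are listed for arbitrary terms. -/
inductive RCA0omega : Set Fm
  -- basic axioms for `0, 1, <, +, ×`
  | succ_ne_zero (t : Tm .zero) : RCA0omega (.neg (.eq (t.add .one) .zero))
  | succ_inj (t u : Tm .zero) : RCA0omega (.imp (.eq (t.add .one) (u.add .one)) (.eq t u))
  | add_zero (t : Tm .zero) : RCA0omega (.eq (t.add .zero) t)
  | add_succ (t u : Tm .zero) :
      RCA0omega (.eq (t.add (u.add .one)) ((t.add u).add .one))
  | mul_zero (t : Tm .zero) : RCA0omega (.eq (t.mul .zero) .zero)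
  | mul_succ (t u : Tm .zero) : RCA0omega (.eq (t.mul (u.add .one)) ((t.mul u).add t))
  | not_lt_zero (t : Tm .zero) : RCA0omega (.neg (.lt t .zero))
  | lt_succ (t u : Tm .zero) :
      RCA0omega (.iff (.lt t (u.add .one)) (.or (.lt t u) (.eq t u)))
  -- the combinators
  | K {σ τ : FinType} (t : Tm σ) (u : Tm τ) :
      RCA0omega (.eqT σ (.app (.app (.cst (.K σ τ)) t) u) t)
  | S {ρ σ τ : FinType} (t : Tm (.arrow ρ (.arrow σ τ))) (u : Tm (.arrow ρ σ)) (v : Tm ρ) :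
      RCA0omega (.eqT τ (.app (.app (.app (.cst (.S ρ σ τ)) t) u) v)
        (.app (.app t v) (.app u v)))
  -- the recursor `R₀` for numbers
  | rec_zero (f : Tm (.arrow .zero t1)) (m : Tm .zero) :
      RCA0omega (.eq (.app (.app (.app (.cst (.recursor .zero)) f) m) .zero) m)
  | rec_succ (f : Tm (.arrow .zero t1)) (m n : Tm .zero) :
      RCA0omega (.eq (.app (.app (.app (.cst (.recursor .zero)) f) m) (n.add .one))
        (.app (.app f n) (.app (.app (.app (.cst (.recursor .zero)) f) m) n)))
  -- extensionality
  | ext {ρ τ : FinType} (t u : Tm ρ) (f : Tm (.arrow ρ τ)) :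
      RCA0omega (.imp (.eqT ρ t u) (.eqT τ (.app f t) (.app f u)))
  -- quantifier-free induction
  | ind (φ : Fm) (h : φ.QF) :
      RCA0omega (.imp (φ.inst .zero .zero)
        (.imp (.all .zero (.imp φ (φ.subst Tm.succVar))) (.all .zero φ)))
  -- quantifier-free choice `QF-AC^{1,0}`: from `∀ x¹ ∃ y⁰ φ(x, y)` to `∃ Y² ∀ x¹ φ(x, Y x)`
  | qfac (φ : Fm) (h : φ.QF) :
      RCA0omega (.imp (.all t1 (.ex .zero φ))
        (.ex t2 (.all t1 ((φ.shift t2).inst .zero (.app (.var t2 0) (.var t1 0))))))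

/-! ## Writing formulas with bound variables as Lean variables

`Trm σ` and `Fml` are terms and formulas that still depend on the number of enclosing quantifiers
over each type; `all σ fun x => …` and `ex σ fun x => …` bind the variable `x` of type `σ`. -/

/-- The number of enclosing quantifiers over each type. -/
abbrev Depth := FinType → ℕ

def Trm (σ : FinType) : Type := Depth → Tm σ
def Fml : Type := Depth → Fm

def bump (σ : FinType) (d : Depth) : Depth := fun τ => if τ = σ then d τ + 1 else d τ

/-- The variable of type `σ` bound by a quantifier which itself stands at depth `d`. -/
def boundVar (σ : FinType) (d : Depth) : Trm σ := fun e => .var σ (e σ - (d σ + 1))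

def app {σ τ : FinType} (t : Trm (.arrow σ τ)) (u : Trm σ) : Trm τ := fun d => .app (t d) (u d)
infixl:90 " ⬝ₒ " => HigherOrderArith.app

instance : Zero (Trm .zero) := ⟨fun _ => .zero⟩
instance : One (Trm .zero) := ⟨fun _ => .one⟩
instance : Add (Trm .zero) := ⟨fun t u d => (t d).add (u d)⟩
instance : Mul (Trm .zero) := ⟨fun t u d => (t d).mul (u d)⟩

def eq (t u : Trm .zero) : Fml := fun d => .eq (t d) (u d)
def lt (t u : Trm .zero) : Fml := fun d => .lt (t d) (u d)
def neg (φ : Fml) : Fml := fun d => (φ d).neg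
def imp (φ ψ : Fml) : Fml := fun d => .imp (φ d) (ψ d)
def and (φ ψ : Fml) : Fml := fun d => (φ d).and (ψ d)
def or (φ ψ : Fml) : Fml := fun d => (φ d).or (ψ d)
def iff (φ ψ : Fml) : Fml := fun d => (φ d).iff (ψ d)
def all (σ : FinType) (f : Trm σ → Fml) : Fml := fun d => .all σ (f (boundVar σ d) (bump σ d))
def ex (σ : FinType) (f : Trm σ → Fml) : Fml := fun d => .ex σ (f (boundVar σ d) (bump σ d))

/-- The formula written by `φ`, outside all quantifiers. -/
def close (φ : Fml) : Fm := φ fun _ => 0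

infix:50 " =ₒ " => HigherOrderArith.eq
infix:50 " <ₒ " => HigherOrderArith.lt
infixr:35 " ∧ₒ " => HigherOrderArith.and
infixr:30 " ∨ₒ " => HigherOrderArith.or
infixr:25 " →ₒ " => HigherOrderArith.imp
infix:20 " ↔ₒ " => HigherOrderArith.iff
prefix:max "¬ₒ" => HigherOrderArith.neg

/-- `t ≤ u` for numbers. -/
def le (t u : Trm .zero) : Fml := ¬ₒ(u <ₒ t)
infix:50 " ≤ₒ " => HigherOrderArith.le

abbrev allNat := all .zero
abbrev exNat := ex .zero

/-- `2 ^ n`, by primitive recursion: `R₀ (λ a b, b + b) 1 n`. -/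
def pow2 (n : Trm .zero) : Trm .zero := fun d =>
  .app (.app (.app (.cst (.recursor .zero))
    (.app (.cst (.K t1 .zero))
      (.app (.app (.cst (.S .zero .zero .zero)) (.cst .add))
        (.app (.app (.cst (.S .zero t1 .zero)) (.cst (.K .zero t1))) (.cst (.K .zero .zero))))))
    .one) (n d)

/-! ## Rational numbers -/

/-- The rational number `(pos - neg) / den`, with `den > 0`, for number terms `pos, neg, den`. -/
structure RatExp where
  pos : Trm .zero
  neg : Trm .zero
  den : Trm .zero

namespace RatExp

def ofNat (t : Trm .zero) : RatExp := ⟨t, 0, 1⟩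
/-- `2 ^ (-n)`. -/
def invPow2 (n : Trm .zero) : RatExp := ⟨1, 0, pow2 n⟩

instance : Add RatExp :=
  ⟨fun q r => ⟨q.pos * r.den + r.pos * q.den, q.neg * r.den + r.neg * q.den, q.den * r.den⟩⟩
instance : Neg RatExp := ⟨fun q => ⟨q.neg, q.pos, q.den⟩⟩
instance : Sub RatExp := ⟨fun q r => q + -r⟩
instance : Mul RatExp :=
  ⟨fun q r => ⟨q.pos * r.pos + q.neg * r.neg, q.pos * r.neg + q.neg * r.pos, q.den * r.den⟩⟩

def lt (q r : RatExp) : Fml :=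
  q.pos * r.den + r.neg * q.den <ₒ r.pos * q.den + q.neg * r.den
def le (q r : RatExp) : Fml :=
  q.pos * r.den + r.neg * q.den ≤ₒ r.pos * q.den + q.neg * r.den

end RatExp

/-- The number `c` codes the rational number `(u - v) / (b + 1)`: here `c = j(a, b)` for Cantor's
pairing function `j`, and `a = 2 u`, `v = 0` (non-negative) or `a = 2 v - 1`, `u = 0` (negative). -/
def ratCode (c u v b : Trm .zero) : Fml :=
  exNat fun a => c + c =ₒ (a + b) * (a + b) + (a + a + a) + b ∧ₒ
    ((a =ₒ u + u ∧ₒ v =ₒ 0) ∨ₒ (a + 1 =ₒ v + v ∧ₒ u =ₒ 0))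

/-! ## Real numbers -/

/-- An expression for a sequence of rational numbers: `e n k` says that `k` holds of the `n`-th
rational number of the sequence `e`. The expressions below converge to real numbers. -/
def RealExp : Type := Trm .zero → (RatExp → Fml) → Fml

namespace RealExp

/-- The sequence of rational numbers coded by a term of type `1`. -/
def ofSeq (x : Trm t1) : RealExp := fun n k =>
  allNat fun u => allNat fun v => allNat fun b => ratCode (x ⬝ₒ n) u v b →ₒ k ⟨u, v, b + 1⟩

/-- A natural number, as a real number. -/
def ofNat (t : Trm .zero) : RealExp := fun _ k => k (.ofNat t)

instance : Zero RealExp := ⟨ofNat 0⟩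
instance : One RealExp := ⟨ofNat 1⟩
instance : Add RealExp := ⟨fun e f n k => e n fun q => f n fun r => k (q + r)⟩
instance : Sub RealExp := ⟨fun e f n k => e n fun q => f n fun r => k (q - r)⟩
instance : Mul RealExp := ⟨fun e f n k => e n fun q => f n fun r => k (q * r)⟩

def abs (e : RealExp) : RealExp := fun n k => e n fun q =>
  ((RatExp.ofNat 0).le q →ₒ k q) ∧ₒ (q.lt (.ofNat 0) →ₒ k (-q))

/-- `e <_ℝ f`: the limits are apart by some `2 ^ (-m)` in the right direction. -/
def lt (e f : RealExp) : Fml :=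
  exNat fun m => exNat fun N => allNat fun n => N ≤ₒ n →ₒ
    e n fun q => f n fun r => (q + .invPow2 m).le r
def le (e f : RealExp) : Fml := ¬ₒ(f.lt e)
def eq (e f : RealExp) : Fml := e.le f ∧ₒ f.le e

end RealExp

infix:50 " <ᵣ " => HigherOrderArith.RealExp.lt
infix:50 " ≤ᵣ " => HigherOrderArith.RealExp.le
infix:50 " =ᵣ " => HigherOrderArith.RealExp.eq
prefix:max "ℜ" => HigherOrderArith.RealExp.ofSeq

/-- `x ∈ ℝ`: `x` codes a sequence of rational numbers with `|x_n - x_{n+i}| < 2 ^ (-n)`. -/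
def isReal (x : Trm t1) : Fml :=
  allNat fun n => allNat fun i => (ℜ x) n fun q => (ℜ x) (n + i) fun r =>
    q.lt (r + .invPow2 n) ∧ₒ r.lt (q + .invPow2 n)

/-- `x =_ℝ y` for codes of real numbers: `|x_n - y_n| ≤ 2 ^ (-n+1)` for all `n`. -/
def eqReal (x y : Trm t1) : Fml :=
  allNat fun n => (ℜ x) n fun q => (ℜ y) n fun r =>
    q.le (r + .invPow2 n + .invPow2 n) ∧ₒ r.le (q + .invPow2 n + .invPow2 n)

/-- Quantification over real numbers, over positive real numbers, and over `I = [0, 1]`. -/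
def allReal (f : Trm t1 → Fml) : Fml := all t1 fun x => isReal x →ₒ f x
def allPos (f : Trm t1 → Fml) : Fml := allReal fun x => 0 <ᵣ ℜ x →ₒ f x
def exPos (f : Trm t1 → Fml) : Fml := ex t1 fun x => isReal x ∧ₒ 0 <ᵣ ℜ x ∧ₒ f x
def inI (x : Trm t1) : Fml := isReal x ∧ₒ 0 ≤ᵣ ℜ x ∧ₒ ℜ x ≤ᵣ 1
def allI (f : Trm t1 → Fml) : Fml := all t1 fun x => inI x →ₒ f x

/-- The type of sequences of objects of type `1`. -/
abbrev tseq : FinType := .arrow .zero t1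
/-- The type of functions between real numbers. -/
abbrev tfun : FinType := .arrow t1 t1

/-- The sum `e 0 + ⋯ + e (n - 1)`, computed by a sequence `S` of partial sums, satisfies `φ`. -/
def sumSat (n : Trm .zero) (e : Trm .zero → RealExp) (φ : RealExp → Fml) : Fml :=
  ex tseq fun S => (allNat fun i => i ≤ₒ n →ₒ isReal (S ⬝ₒ i)) ∧ₒ ℜ(S ⬝ₒ 0) =ᵣ 0 ∧ₒ
    (allNat fun i => i <ₒ n →ₒ ℜ(S ⬝ₒ (i + 1)) =ᵣ ℜ(S ⬝ₒ i) + e i) ∧ₒ φ (ℜ(S ⬝ₒ n))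

/-- `f : I → ℝ`, that is, `f` maps codes of elements of `I` to codes of reals, respecting `=_ℝ`. -/
def isFun (f : Trm tfun) : Fml :=
  (allI fun x => isReal (f ⬝ₒ x)) ∧ₒ
    allI fun x => allI fun y => eqReal x y →ₒ eqReal (f ⬝ₒ x) (f ⬝ₒ y)

/-- `f` is continuous on `I`. -/
def continuous (f : Trm tfun) : Fml :=
  allI fun x => allPos fun ε => exPos fun δ => allI fun y =>
    (ℜ x - ℜ y).abs <ᵣ ℜ δ →ₒ (ℜ(f ⬝ₒ x) - ℜ(f ⬝ₒ y)).abs <ᵣ ℜ ε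

/-- `f` is bounded on `I`. -/
def bounded (f : Trm tfun) : Fml :=
  exNat fun N => allI fun x => (ℜ(f ⬝ₒ x)).abs ≤ᵣ .ofNat N

/-- The points `0 = a_0 ≤ ⋯ ≤ a_n = 1` with the tags `t_i ∈ [a_i, a_{i+1}]`, `i < n`, form a tagged
partition of `I`. -/
def taggedPartition (n : Trm .zero) (a t : Trm tseq) : Fml :=
  (allNat fun i => i ≤ₒ n →ₒ isReal (a ⬝ₒ i)) ∧ₒ ℜ(a ⬝ₒ 0) =ᵣ 0 ∧ₒ ℜ(a ⬝ₒ n) =ᵣ 1 ∧ₒ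
    allNat fun i => i <ₒ n →ₒ
      isReal (t ⬝ₒ i) ∧ₒ ℜ(a ⬝ₒ i) ≤ᵣ ℜ(t ⬝ₒ i) ∧ₒ ℜ(t ⬝ₒ i) ≤ᵣ ℜ(a ⬝ₒ (i + 1))

/-- The real number `A` is the Riemann integral over `I` of the function `x ↦ g x`. -/
def isRiemannIntegral (g : Trm t1 → RealExp) (A : Trm t1) : Fml :=
  allPos fun ε => exPos fun δ =>
    allNat fun n => all tseq fun a => all tseq fun t =>
      taggedPartition n a t →ₒ
      (allNat fun i => i <ₒ n →ₒ ℜ(a ⬝ₒ (i + 1)) - ℜ(a ⬝ₒ i) ≤ᵣ ℜ δ) →ₒ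
      sumSat n (fun i => g (t ⬝ₒ i) * (ℜ(a ⬝ₒ (i + 1)) - ℜ(a ⬝ₒ i)))
        fun s => (s - ℜ A).abs <ᵣ ℜ ε

/-! ## Weak weak König's lemma

A finite binary sequence `s` is coded by the positive number whose binary digits are `1` followed by
`s`: the empty sequence is `1`, and `s * ⟨i⟩` is `2 s + i`. The sequences of length `n` are the
numbers `m` with `2 ^ n ≤ m < 2 ^ (n + 1)`. A set `T` of numbers is given by a function of type `1`
that is zero exactly on `T`. -/

/-- `T` is closed under initial segments. -/
def isTree (T : Trm t1) : Fml :=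
  allNat fun s => 0 <ₒ s →ₒ (T ⬝ₒ (s + s) =ₒ 0 ∨ₒ T ⬝ₒ (s + s + 1) =ₒ 0) →ₒ T ⬝ₒ s =ₒ 0

/-- `T` has an infinite path `f`; here `p n` is the code of `⟨f 0, …, f (n - 1)⟩`. -/
def hasPath (T : Trm t1) : Fml :=
  ex t1 fun f => ex t1 fun p => (allNat fun n => f ⬝ₒ n ≤ₒ 1) ∧ₒ p ⬝ₒ 0 =ₒ 1 ∧ₒ
    (allNat fun n => p ⬝ₒ (n + 1) =ₒ p ⬝ₒ n + p ⬝ₒ n + f ⬝ₒ n) ∧ₒ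
    allNat fun n => T ⬝ₒ (p ⬝ₒ n) =ₒ 0

/-- The number of sequences of length `n` in `T` satisfies `φ`; `c j` is the number of such
sequences among the first `j` sequences of length `n`. -/
def levelCardSat (T : Trm t1) (n : Trm .zero) (φ : Trm .zero → Fml) : Fml :=
  ex t1 fun c => c ⬝ₒ 0 =ₒ 0 ∧ₒ
    (allNat fun j => (T ⬝ₒ (pow2 n + j) =ₒ 0 →ₒ c ⬝ₒ (j + 1) =ₒ c ⬝ₒ j + 1) ∧ₒ
      (¬ₒ(T ⬝ₒ (pow2 n + j) =ₒ 0) →ₒ c ⬝ₒ (j + 1) =ₒ c ⬝ₒ j)) ∧ₒ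
    φ (c ⬝ₒ pow2 n)

/-- Weak weak König's lemma: if a binary tree `T` has no infinite path, then
`|{s ∈ T : |s| = n}| / 2 ^ n` tends to `0`. -/
def WWKL : Fm := close <|
  all t1 fun T => isTree T →ₒ ¬ₒ(hasPath T) →ₒ
    allNat fun k => exNat fun N => allNat fun n => N ≤ₒ n →ₒ
      levelCardSat T n fun m => m * pow2 k ≤ₒ pow2 n

/-! ## The monotone convergence theorem for nets -/

/-- The type of (characteristic functions of) binary relations on Baire space. -/
abbrev trel : FinType := .arrow t1 (.arrow t1 .zero)
/-- The type of nets of functions between real numbers, indexed by a subset of Baire space. -/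
abbrev tnet : FinType := .arrow t1 tfun

/-- `d ∈ D`, for the characteristic function `D` of a subset of Baire space. -/
def mem (d : Trm t1) (D : Trm t2) : Fml := D ⬝ₒ d =ₒ 1
def allIn (D : Trm t2) (f : Trm t1 → Fml) : Fml := all t1 fun d => mem d D →ₒ f d
def exIn (D : Trm t2) (f : Trm t1 → Fml) : Fml := ex t1 fun d => mem d D ∧ₒ f d
/-- `a ⪯ b`, for the characteristic function `R` of the relation `⪯`. -/
def rel (R : Trm trel) (a b : Trm t1) : Fml := R ⬝ₒ a ⬝ₒ b =ₒ 1

/-- `D` and `R` are characteristic functions, and `(D, R)` is a (non-empty) directed set. -/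
def directed (D : Trm t2) (R : Trm trel) : Fml :=
  (all t1 fun a => D ⬝ₒ a ≤ₒ 1) ∧ₒ (all t1 fun a => all t1 fun b => R ⬝ₒ a ⬝ₒ b ≤ₒ 1) ∧ₒ
  (ex t1 fun a => mem a D) ∧ₒ
  (allIn D fun a => allIn D fun b => allIn D fun c => rel R a b ∧ₒ rel R b c →ₒ rel R a c) ∧ₒ
  (allIn D fun a => rel R a a) ∧ₒ
  allIn D fun a => allIn D fun b => exIn D fun c => rel R a c ∧ₒ rel R b c

/-- `MCT_net`: if `(f_d)` is an increasing net of continuous functions on `I`, indexed by a directed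
subset of Baire space, with a bounded and continuous pointwise limit `g`, then the Riemann integrals
`∫₀¹ |g x - f_d x| dx` tend to `0` along the net. -/
def MCTnet : Fm := close <|
  all t2 fun D => all trel fun R => all tnet fun f => all tfun fun g =>
    directed D R →ₒ
    (allIn D fun d => isFun (f ⬝ₒ d) ∧ₒ continuous (f ⬝ₒ d)) →ₒ
    (allIn D fun a => allIn D fun b => rel R a b →ₒ
      allI fun x => ℜ(f ⬝ₒ a ⬝ₒ x) ≤ᵣ ℜ(f ⬝ₒ b ⬝ₒ x)) →ₒ
    isFun g →ₒ
    (allI fun x => allPos fun ε => exIn D fun d => allIn D fun e => rel R d e →ₒ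
      (ℜ(f ⬝ₒ e ⬝ₒ x) - ℜ(g ⬝ₒ x)).abs <ᵣ ℜ ε) →ₒ
    bounded g →ₒ continuous g →ₒ
    allPos fun ε => exIn D fun d => allIn D fun e => rel R d e →ₒ
      allReal fun A =>
        isRiemannIntegral (fun x => (ℜ(g ⬝ₒ x) - ℜ(f ⬝ₒ e ⬝ₒ x)).abs) A →ₒ
        (ℜ A).abs <ᵣ ℜ ε

/-! ## Weak compactness -/

/-- For the open intervals `J_i = (y_i - Ψ(y_i), y_i + Ψ(y_i))`: the open interval `(a, b)` is
contained in `J_i' = J_i \ ⋃_{j < i} J_j`, that is, `(a, b) ⊆ J_i`, and `(a, b)` lies to the left or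
to the right of every `J_j` with `j < i`. -/
def subJ (Ψ : Trm tfun) (y : Trm tseq) (i : Trm .zero) (a b : Trm t1) : Fml :=
  (ℜ(y ⬝ₒ i) - ℜ(Ψ ⬝ₒ (y ⬝ₒ i)) ≤ᵣ ℜ a ∧ₒ ℜ b ≤ᵣ ℜ(y ⬝ₒ i) + ℜ(Ψ ⬝ₒ (y ⬝ₒ i))) ∧ₒ
  allNat fun j => j <ₒ i →ₒ
    ℜ b ≤ᵣ ℜ(y ⬝ₒ j) - ℜ(Ψ ⬝ₒ (y ⬝ₒ j)) ∨ₒ ℜ(y ⬝ₒ j) + ℜ(Ψ ⬝ₒ (y ⬝ₒ j)) ≤ᵣ ℜ a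

/-- `|J_0'| + ⋯ + |J_n'| ≥ r`, where lengths are taken inside `I`. The `J_i'` are disjoint finite
unions of intervals; the sum of their lengths is at least `r` if and only if they contain finitely
many open intervals `(a_k, b_k)` with `0 ≤ a_0 ≤ b_0 ≤ a_1 ≤ b_1 ≤ ⋯ ≤ 1` of total length at
least `r`. -/
def totalLengthGe (Ψ : Trm tfun) (y : Trm tseq) (n : Trm .zero) (r : RealExp) : Fml :=
  exNat fun m => ex tseq fun a => ex tseq fun b =>
    (allNat fun k => k <ₒ m →ₒ inI (a ⬝ₒ k) ∧ₒ inI (b ⬝ₒ k) ∧ₒ ℜ(a ⬝ₒ k) ≤ᵣ ℜ(b ⬝ₒ k) ∧ₒ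
      exNat fun i => i ≤ₒ n ∧ₒ subJ Ψ y i (a ⬝ₒ k) (b ⬝ₒ k)) ∧ₒ
    (allNat fun k => k + 1 <ₒ m →ₒ ℜ(b ⬝ₒ k) ≤ᵣ ℜ(a ⬝ₒ (k + 1))) ∧ₒ
    sumSat m (fun k => ℜ(b ⬝ₒ k) - ℜ(a ⬝ₒ k)) fun s => r ≤ᵣ s

/-- `WHBU₀`: for `Ψ : I → ℝ⁺` and `ε > 0` there are `y_0, …, y_n ∈ I` such that
`|J_0'| + ⋯ + |J_n'| ≥ 1 - ε`. -/
def WHBU0 : Fm := close <|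
  all tfun fun Ψ => isFun Ψ →ₒ (allI fun x => 0 <ᵣ ℜ(Ψ ⬝ₒ x)) →ₒ
    allPos fun ε => exNat fun n => ex tseq fun y =>
      (allNat fun i => i ≤ₒ n →ₒ inI (y ⬝ₒ i)) ∧ₒ totalLengthGe Ψ y n (1 - ℜ ε)

end HigherOrderArith

namespace HigherOrderArith

/-! ## Substitution -/

/-- Substitutions. -/
abbrev Substitution : Type := (τ : FinType) → ℕ → Tm τ

namespace Tm

/-- The substitution of `t` for the variable of type `σ` with index `0`, and of `s` for the others. -/
def cons (σ : FinType) (t : Tm σ) (s : Substitution) : Substitution := fun τ n =>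
  if h : σ = τ then
    match n with
    | 0 => h ▸ t
    | n + 1 => s τ n
  else s τ n

@[simp] theorem cons_zero (σ : FinType) (t : Tm σ) (s : Substitution) : cons σ t s σ 0 = t := by
  simp [cons]

@[simp] theorem cons_succ (σ : FinType) (t : Tm σ) (s : Substitution) (n : ℕ) :
    cons σ t s σ (n + 1) = s σ n := by
  simp [cons]

theorem cons_ne {σ τ : FinType} (h : σ ≠ τ) (t : Tm σ) (s : Substitution) (n : ℕ) :
    cons σ t s τ n = s τ n := by
  simp [cons, h]

theorem instVar_eq_cons (σ : FinType) (t : Tm σ) : instVar σ t = cons σ t var := by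
  funext τ n
  by_cases h : σ = τ
  · subst h
    cases n <;> simp [instVar]
  · simp [instVar, cons, h]

@[simp] theorem up_zero (σ : FinType) (s : Substitution) : up σ s σ 0 = var σ 0 := by simp [up]

@[simp] theorem up_succ (σ : FinType) (s : Substitution) (n : ℕ) :
    up σ s σ (n + 1) = (s σ n).shift σ := by simp [up]

theorem up_ne {σ τ : FinType} (h : σ ≠ τ) (s : Substitution) (n : ℕ) :
    up σ s τ n = (s τ n).shift σ := by simp [up, Ne.symm h]

theorem subst_subst (s s' : Substitution) {τ : FinType} (t : Tm τ) :
    (t.subst s).subst s' = t.subst fun τ n => (s τ n).subst s' := by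
  induction t with
  | var => rfl
  | cst => rfl
  | app t u iht ihu => simp [subst, iht, ihu]

theorem shift_eq_subst (σ : FinType) {τ : FinType} (t : Tm τ) :
    t.shift σ = t.subst fun τ n => (var τ n).shift σ := by
  induction t with
  | var => rfl
  | cst => rfl
  | app t u iht ihu => simp [subst, shift, iht, ihu]

@[simp] theorem subst_var {τ : FinType} (t : Tm τ) : t.subst var = t := by
  induction t with
  | var => rfl
  | cst => rfl
  | app t u iht ihu => simp [subst, iht, ihu]

@[simp] theorem shift_subst_up (σ : FinType) (s : Substitution) {τ : FinType} (t : Tm τ) :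
    (t.shift σ).subst (up σ s) = (t.subst s).shift σ := by
  induction t with
  | var τ n =>
    by_cases h : σ = τ
    · subst h; simp [shift, subst]
    · simp [shift, subst, Ne.symm h, up_ne h]
  | cst => rfl
  | app t u iht ihu => simp [subst, shift, iht, ihu]

@[simp] theorem shift_subst_cons (σ : FinType) (v : Tm σ) (s : Substitution) {τ : FinType} (t : Tm τ) :
    (t.shift σ).subst (cons σ v s) = t.subst s := by
  induction t with
  | var τ n =>
    by_cases h : σ = τ
    · subst h; simp [shift, subst]
    · simp [shift, subst, Ne.symm h, cons_ne h]
  | cst => rfl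
  | app t u iht ihu => simp [subst, shift, iht, ihu]

@[simp] theorem up_var (σ : FinType) : up σ var = var := by
  funext τ n
  by_cases h : σ = τ
  · subst h; cases n <;> simp [shift]
  · simp [up_ne h, shift, Ne.symm h]

theorem up_subst_up (σ : FinType) (s s' : Substitution) :
    (fun τ n => (up σ s τ n).subst (up σ s')) = up σ fun τ n => (s τ n).subst s' := by
  funext τ n
  by_cases h : σ = τ
  · subst h; cases n <;> simp [subst]
  · simp [up_ne h]

theorem shift_shift (σ σ' : FinType) {τ : FinType} (t : Tm τ) :
    (t.shift σ).shift σ' = (t.shift σ').shift σ := by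
  induction t with
  | var τ n =>
    simp only [shift]
    congr 1
    by_cases h : τ = σ <;> by_cases h' : τ = σ' <;> simp only [h, h', if_true, if_false] <;>
      split_ifs <;> rfl
  | cst => rfl
  | app t u iht ihu => simp [shift, iht, ihu]

theorem up_comm {σ σ' : FinType} (hσ : σ ≠ σ') (s : Substitution) :
    up σ (up σ' s) = up σ' (up σ s) := by
  funext τ n
  by_cases h : σ = τ
  · subst h
    cases n with
    | zero => simp [up_ne hσ.symm, shift, hσ]
    | succ n => simp [up_ne hσ.symm, shift_shift]
  · by_cases h' : σ' = τ
    · subst h'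
      cases n with
      | zero => simp [up_ne hσ, shift, hσ.symm]
      | succ n => simp [up_ne hσ, shift_shift σ]
    · simp [up_ne h, up_ne h', shift_shift σ]

theorem up_subst_cons (σ : FinType) (s s' : Substitution) (t : Tm σ) :
    (fun τ n => (up σ s τ n).subst (cons σ t s')) = cons σ t fun τ n => (s τ n).subst s' := by
  funext τ n
  by_cases h : σ = τ
  · subst h; cases n <;> simp [subst]
  · simp [up_ne h, cons_ne h]

theorem cons_subst (σ : FinType) (s s' : Substitution) (t : Tm σ) :
    (fun τ n => (cons σ t s τ n).subst s') = cons σ (t.subst s') fun τ n => (s τ n).subst s' := by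
  funext τ n
  by_cases h : σ = τ
  · subst h; cases n <;> simp
  · simp [cons_ne h]

end Tm

namespace Fm

theorem subst_subst (s s' : Substitution) (φ : Fm) :
    (φ.subst s).subst s' = φ.subst fun τ n => (s τ n).subst s' := by
  induction φ generalizing s s' with
  | eq t u => simp [subst, Tm.subst_subst]
  | lt t u => simp [subst, Tm.subst_subst]
  | bot => rfl
  | imp φ ψ ihφ ihψ => simp [subst, ihφ, ihψ]
  | all σ φ ih => simp [subst, ih, Tm.up_subst_up]

@[simp] theorem subst_var (φ : Fm) : φ.subst Tm.var = φ := by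
  induction φ with
  | eq t u => simp [subst]
  | lt t u => simp [subst]
  | bot => rfl
  | imp φ ψ ihφ ihψ => simp [subst, ihφ, ihψ]
  | all σ φ ih => simp [subst, ih]

theorem inst_subst (σ : FinType) (t : Tm σ) (φ : Fm) (s : Substitution) :
    (φ.inst σ t).subst s = (φ.subst (Tm.up σ s)).inst σ (t.subst s) := by
  simp only [inst, subst_subst, Tm.instVar_eq_cons, Tm.cons_subst, Tm.up_subst_cons]
  simp [Tm.subst]

theorem subst_up_inst (σ : FinType) (t : Tm σ) (φ : Fm) (s : Substitution) :
    (φ.subst (Tm.up σ s)).inst σ t = φ.subst (Tm.cons σ t s) := by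
  simp only [inst, subst_subst, Tm.instVar_eq_cons, Tm.up_subst_cons]
  simp

theorem shift_subst_up (σ : FinType) (φ : Fm) (s : Substitution) :
    (φ.shift σ).subst (Tm.up σ s) = (φ.subst s).shift σ := by
  simp only [shift, subst_subst, Tm.shift_subst_up, Tm.subst]
  congr 1
  funext τ n
  rw [← Tm.shift_eq_subst]

theorem QF.subst {φ : Fm} (h : φ.QF) (s : Substitution) : (φ.subst s).QF := by
  induction φ generalizing s with
  | eq t u => trivial
  | lt t u => trivial
  | bot => trivial
  | imp φ ψ ihφ ihψ => exact ⟨ihφ h.1 s, ihψ h.2 s⟩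
  | all σ φ ih => exact h.elim

theorem eqT_subst {τ : FinType} (t u : Tm τ) (s : Substitution) :
    (eqT τ t u).subst s = eqT τ (t.subst s) (u.subst s) := by
  induction τ generalizing s with
  | zero => rfl
  | arrow σ τ _ ih => simp [eqT, subst, ih, Tm.subst]

/-- A formula has only finitely many free variables. -/
theorem exists_support (φ : Fm) : ∃ N : ℕ, ∀ s s' : Substitution,
    (∀ τ, ∀ n < N, s τ n = s' τ n) → φ.subst s = φ.subst s' := by
  have tm : ∀ {τ : FinType} (t : Tm τ), ∃ N : ℕ, ∀ s s' : Substitution,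
      (∀ τ, ∀ n < N, s τ n = s' τ n) → t.subst s = t.subst s' := by
    intro τ t
    induction t with
    | var τ n => exact ⟨n + 1, fun s s' h => h τ n (Nat.lt_succ_self n)⟩
    | cst c => exact ⟨0, fun s s' h => rfl⟩
    | app t u iht ihu =>
      obtain ⟨N, hN⟩ := iht
      obtain ⟨N', hN'⟩ := ihu
      refine ⟨max N N', fun s s' h => ?_⟩
      simp only [Tm.subst]
      rw [hN s s' fun τ n hn => h τ n (lt_max_of_lt_left hn),
        hN' s s' fun τ n hn => h τ n (lt_max_of_lt_right hn)]
  induction φ with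
  | eq t u | lt t u =>
    obtain ⟨N, hN⟩ := tm t
    obtain ⟨N', hN'⟩ := tm u
    refine ⟨max N N', fun s s' h => ?_⟩
    simp only [subst]
    rw [hN s s' fun τ n hn => h τ n (lt_max_of_lt_left hn),
      hN' s s' fun τ n hn => h τ n (lt_max_of_lt_right hn)]
  | bot => exact ⟨0, fun _ _ _ => rfl⟩
  | imp φ ψ ihφ ihψ =>
    obtain ⟨N, hN⟩ := ihφ
    obtain ⟨N', hN'⟩ := ihψ
    refine ⟨max N N', fun s s' h => ?_⟩
    simp only [subst]
    rw [hN s s' fun τ n hn => h τ n (lt_max_of_lt_left hn),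
      hN' s s' fun τ n hn => h τ n (lt_max_of_lt_right hn)]
  | all σ φ ih =>
    obtain ⟨N, hN⟩ := ih
    refine ⟨N, fun s s' h => ?_⟩
    simp only [subst]
    rw [hN (Tm.up σ s) (Tm.up σ s')]
    intro τ n hn
    by_cases hσ : σ = τ
    · subst hσ
      cases n with
      | zero => simp
      | succ n => simp [h σ n (by omega)]
    · simp [Tm.up_ne hσ, h τ n hn]

theorem exists_support_list (Γ : List Fm) : ∃ N : ℕ, ∀ s s' : Substitution,
    (∀ τ, ∀ n < N, s τ n = s' τ n) → ∀ φ ∈ Γ, φ.subst s = φ.subst s' := by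
  induction Γ with
  | nil => exact ⟨0, by simp⟩
  | cons φ Γ ih =>
    obtain ⟨N, hN⟩ := ih
    obtain ⟨N', hN'⟩ := exists_support φ
    refine ⟨max N N', fun s s' h => ?_⟩
    rintro ψ hψ
    rcases List.mem_cons.1 hψ with rfl | hψ
    · exact hN' s s' fun τ n hn => h τ n (lt_max_of_lt_right hn)
    · exact hN s s' (fun τ n hn => h τ n (lt_max_of_lt_left hn)) ψ hψ

end Fm

/-! ## Derivations -/

namespace Derives

variable {T : Set Fm} {Γ Δ : List Fm} {φ ψ : Fm}

theorem weaken (h : Derives T Γ φ) (hΓ : Γ ⊆ Δ) : Derives T Δ φ := by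
  induction h generalizing Δ with
  | ax h => exact .ax h
  | hyp h => exact .hyp (hΓ h)
  | impI _ ih => exact .impI (ih (List.cons_subset_cons _ hΓ))
  | impE _ _ ih ih' => exact .impE (ih hΓ) (ih' hΓ)
  | raa _ ih => exact .raa (ih (List.cons_subset_cons _ hΓ))
  | allI _ ih => exact .allI (ih (List.map_subset _ hΓ))
  | allE _ t ih => exact .allE (ih hΓ) t
  | eqRefl t => exact .eqRefl t
  | eqSubst _ _ ih ih' => exact .eqSubst (ih hΓ) (ih' hΓ)

theorem mono {T' : Set Fm} (h : Derives T Γ φ) (hT : T ⊆ T') : Derives T' Γ φ := by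
  induction h with
  | ax h => exact .ax (hT h)
  | hyp h => exact .hyp h
  | impI _ ih => exact .impI ih
  | impE _ _ ih ih' => exact .impE ih ih'
  | raa _ ih => exact .raa ih
  | allI _ ih => exact .allI ih
  | allE _ t ih => exact .allE ih t
  | eqRefl t => exact .eqRefl t
  | eqSubst _ _ ih ih' => exact .eqSubst ih ih'

theorem exfalso (h : Derives T Γ .bot) (φ : Fm) : Derives T Γ φ :=
  .raa (h.weaken (List.subset_cons_self _ _))

theorem subst (hT : ∀ φ ∈ T, ∀ s, φ.subst s ∈ T) (h : Derives T Γ φ) (s : Substitution) :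
    Derives T (Γ.map (Fm.subst s)) (φ.subst s) := by
  induction h generalizing s with
  | ax h => exact .ax (hT _ h s)
  | hyp h => exact .hyp (List.mem_map_of_mem h)
  | impI _ ih => exact .impI (ih s)
  | impE _ _ ih ih' => exact .impE (ih s) (ih' s)
  | raa _ ih => exact .raa (ih s)
  | @allI Γ σ φ _ ih =>
    refine .allI ?_
    have := ih (Tm.up σ s)
    simp only [List.map_map] at this ⊢
    convert this using 2
    funext φ
    exact (Fm.shift_subst_up σ φ s).symm
  | allE _ t ih =>
    rw [Fm.inst_subst]
    exact .allE (ih s) _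
  | eqRefl t => exact .eqRefl _
  | eqSubst _ _ ih ih' =>
    rw [Fm.inst_subst]
    refine .eqSubst (ih s) ?_
    rw [← Fm.inst_subst]
    exact ih' s

/-- Generalisation over a fresh variable. -/
theorem allI_fresh (hT : ∀ φ ∈ T, ∀ s, φ.subst s ∈ T) {σ : FinType} {N : ℕ}
    (hN : ∀ s s' : Substitution, (∀ τ, ∀ n < N, s τ n = s' τ n) → ∀ ψ ∈ φ :: Γ, ψ.subst s = ψ.subst s')
    (h : Derives T Γ (φ.inst σ (.var σ N))) : Derives T Γ (.all σ φ) := by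
  classical
  refine .allI ?_
  let ρ : Substitution := fun τ n => if τ = σ ∧ n = N then .var τ 0 else (Tm.var τ n).shift σ
  let ρ' : Substitution := fun τ n => if τ = σ ∧ n = N then .var τ 0 else
    .var τ (if τ = σ then n + 1 else n)
  have := h.subst hT ρ
  convert this using 1
  · refine List.map_congr_left fun ψ hψ => ?_
    refine hN _ _ (fun τ n hn => ?_) ψ (by simp [hψ])
    simp [ρ, hn.ne]
  · simp only [Fm.inst, Fm.subst_subst, Tm.instVar_eq_cons, Tm.cons_subst]
    conv_lhs => rw [← Fm.subst_var φ]
    refine hN _ _ (fun τ n hn => ?_) φ (by simp)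
    by_cases hσ : σ = τ
    · subst hσ
      cases n with
      | zero => simp [Tm.subst, ρ]
      | succ n =>
        have : n ≠ N := by omega
        simp [Tm.subst, ρ, this, Tm.shift]
    · simp [Tm.cons_ne hσ, Tm.subst, ρ, Ne.symm hσ, Tm.shift]

end Derives

theorem RCA0omega.subst {φ : Fm} (h : φ ∈ RCA0omega) (s : Substitution) : φ.subst s ∈ RCA0omega := by
  change RCA0omega φ at h
  change RCA0omega (φ.subst s)
  cases h with
  | succ_ne_zero t => exact .succ_ne_zero _
  | succ_inj t u => exact .succ_inj _ _
  | add_zero t => exact .add_zero _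
  | add_succ t u => exact .add_succ _ _
  | mul_zero t => exact .mul_zero _
  | mul_succ t u => exact .mul_succ _ _
  | not_lt_zero t => exact .not_lt_zero _
  | lt_succ t u => exact .lt_succ _ _
  | K t u => rw [Fm.eqT_subst]; exact .K _ _
  | S t u v => rw [Fm.eqT_subst]; exact .S _ _ _
  | rec_zero f m => exact .rec_zero _ _
  | rec_succ f m n => exact .rec_succ _ _ _
  | ext t u f =>
    simp only [Fm.subst, Fm.eqT_subst]
    exact .ext _ _ _
  | ind φ hφ =>
    have := RCA0omega.ind (φ.subst (Tm.up .zero s)) (Fm.QF.subst hφ _)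
    simp only [Fm.subst, Fm.inst_subst]
    convert this using 3
    congr 1
    simp only [Fm.subst_subst]
    congr 3
    funext τ n
    by_cases hτ : τ = .zero
    · subst hτ
      cases n with
      | zero => simp [Tm.succVar, Tm.subst, Tm.add, Tm.one]
      | succ n =>
        have : (Tm.shift .zero (s .zero n)).subst Tm.succVar = Tm.shift .zero (s .zero n) := by
          rw [Tm.shift_eq_subst, Tm.subst_subst]
          congr 1
          funext τ n
          by_cases hτ : τ = .zero
          · subst hτ; simp [Tm.shift, Tm.subst, Tm.succVar]
          · cases τ with
            | zero => exact (hτ rfl).elim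
            | arrow => simp [Tm.shift, Tm.subst, Tm.succVar]
        simp [Tm.succVar, Tm.subst, this]
    · cases τ with
      | zero => exact (hτ rfl).elim
      | arrow α β =>
        simp only [Tm.succVar, Tm.subst]
        rw [Tm.up_ne (Ne.symm hτ), Tm.shift_eq_subst, Tm.subst_subst]
        congr 1
        funext τ n
        by_cases hτ : τ = .zero
        · subst hτ; simp [Tm.shift, Tm.subst, Tm.succVar]
        · cases τ with
          | zero => exact (hτ rfl).elim
          | arrow => simp [Tm.shift, Tm.subst, Tm.succVar]
  | qfac φ hφ =>
    have := RCA0omega.qfac (φ.subst (Tm.up .zero (Tm.up t1 s))) (Fm.QF.subst hφ _)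
    convert this using 1
    simp only [Fm.subst, Fm.ex, Fm.neg, Fm.inst_subst]
    congr 6
    rw [Tm.up_comm (by decide : t1 ≠ t2), Tm.up_comm (by decide : FinType.zero ≠ t2),
      Fm.shift_subst_up]
    

end HigherOrderArith

namespace HigherOrderArith

/-! ## Structures and models -/

/-- Structures for the language of finite-type arithmetic. -/
structure Struc where
  C : FinType → Type
  app {σ τ : FinType} : C (.arrow σ τ) → C σ → C τ
  cst {σ : FinType} : Cst σ → C σ
  lt : C .zero → C .zero → Prop

namespace Struc

variable (M : Struc)

/-- Valuations. -/
abbrev Val : Type := (τ : FinType) → ℕ → M.C τ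

variable {M}

def vcons (σ : FinType) (x : M.C σ) (v : M.Val) : M.Val := fun τ n =>
  if h : σ = τ then
    match n with
    | 0 => h ▸ x
    | n + 1 => v τ n
  else v τ n

@[simp] theorem vcons_zero (σ : FinType) (x : M.C σ) (v : M.Val) : vcons σ x v σ 0 = x := by
  simp [vcons]

@[simp] theorem vcons_succ (σ : FinType) (x : M.C σ) (v : M.Val) (n : ℕ) :
    vcons σ x v σ (n + 1) = v σ n := by
  simp [vcons]

theorem vcons_ne {σ τ : FinType} (h : σ ≠ τ) (x : M.C σ) (v : M.Val) (n : ℕ) :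
    vcons σ x v τ n = v τ n := by
  simp [vcons, h]

def eval (v : M.Val) : {τ : FinType} → Tm τ → M.C τ
  | _, .var τ n => v τ n
  | _, .cst c => M.cst c
  | _, .app t u => M.app (eval v t) (eval v u)

def sat : M.Val → Fm → Prop
  | v, .eq t u => eval v t = eval v u
  | v, .lt t u => M.lt (eval v t) (eval v u)
  | _, .bot => False
  | v, .imp φ ψ => sat v φ → sat v ψ
  | v, .all σ φ => ∀ x : M.C σ, sat (vcons σ x v) φ

@[simp] theorem eval_shift (σ : FinType) (x : M.C σ) (v : M.Val) {τ : FinType} (t : Tm τ) :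
    eval (vcons σ x v) (t.shift σ) = eval v t := by
  induction t with
  | var τ n =>
    by_cases h : σ = τ
    · subst h; simp [Tm.shift, eval]
    · simp [Tm.shift, eval, Ne.symm h, vcons_ne h]
  | cst => rfl
  | app t u iht ihu => simp [eval, Tm.shift, iht, ihu]

theorem eval_subst (v : M.Val) (s : Substitution) {τ : FinType} (t : Tm τ) :
    eval v (t.subst s) = eval (fun τ n => eval v (s τ n)) t := by
  induction t with
  | var => rfl
  | cst => rfl
  | app t u iht ihu => simp [eval, Tm.subst, iht, ihu]

theorem eval_up (σ : FinType) (x : M.C σ) (v : M.Val) (s : Substitution) :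
    (fun τ n => eval (vcons σ x v) (Tm.up σ s τ n)) =
      vcons σ x fun τ n => eval v (s τ n) := by
  funext τ n
  by_cases h : σ = τ
  · subst h; cases n <;> simp [eval]
  · simp [Tm.up_ne h, vcons_ne h]

theorem eval_cons (σ : FinType) (t : Tm σ) (v : M.Val) (s : Substitution) :
    (fun τ n => eval v (Tm.cons σ t s τ n)) = vcons σ (eval v t) fun τ n => eval v (s τ n) := by
  funext τ n
  by_cases h : σ = τ
  · subst h; cases n <;> simp
  · simp [Tm.cons_ne h, vcons_ne h]

theorem sat_subst (v : M.Val) (s : Substitution) (φ : Fm) :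
    sat v (φ.subst s) ↔ sat (fun τ n => eval v (s τ n)) φ := by
  induction φ generalizing v s with
  | eq t u => simp [sat, Fm.subst, eval_subst]
  | lt t u => simp [sat, Fm.subst, eval_subst]
  | bot => rfl
  | imp φ ψ ihφ ihψ => simp [sat, Fm.subst, ihφ, ihψ]
  | all σ φ ih => simp [sat, Fm.subst, ih, eval_up]

theorem sat_inst (v : M.Val) (σ : FinType) (t : Tm σ) (φ : Fm) :
    sat v (φ.inst σ t) ↔ sat (vcons σ (eval v t) v) φ := by
  rw [Fm.inst, sat_subst, Tm.instVar_eq_cons, eval_cons]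
  rfl

@[simp] theorem sat_neg (v : M.Val) (φ : Fm) : sat v φ.neg ↔ ¬sat v φ := Iff.rfl

@[simp] theorem sat_imp (v : M.Val) (φ ψ : Fm) : sat v (.imp φ ψ) ↔ (sat v φ → sat v ψ) := Iff.rfl

@[simp] theorem sat_and (v : M.Val) (φ ψ : Fm) : sat v (φ.and ψ) ↔ sat v φ ∧ sat v ψ := by
  simp [Fm.and, sat]

@[simp] theorem sat_or (v : M.Val) (φ ψ : Fm) : sat v (φ.or ψ) ↔ sat v φ ∨ sat v ψ := by
  simp only [Fm.or, sat_imp, sat_neg]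
  tauto

@[simp] theorem sat_iff (v : M.Val) (φ ψ : Fm) : sat v (φ.iff ψ) ↔ (sat v φ ↔ sat v ψ) := by
  simp only [Fm.iff, sat_and, sat_imp]
  tauto

@[simp] theorem sat_all (v : M.Val) (σ : FinType) (φ : Fm) :
    sat v (.all σ φ) ↔ ∀ x, sat (vcons σ x v) φ := Iff.rfl

@[simp] theorem sat_ex (v : M.Val) (σ : FinType) (φ : Fm) :
    sat v (φ.ex σ) ↔ ∃ x, sat (vcons σ x v) φ := by
  simp [Fm.ex]

end Struc

/-- Models of the base theory in which equality at higher types is equality. -/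
structure Model extends Struc where
  ext {σ τ : FinType} (f g : C (.arrow σ τ)) : (∀ x, app f x = app g x) → f = g
  sat_of_mem {φ : Fm} : φ ∈ RCA0omega → ∀ v : toStruc.Val, Struc.sat v φ

/-! ## Completeness -/

theorem exists_injective_finType : ∃ e : FinType → ℕ, Function.Injective e := by
  let e : FinType → ℕ := fun σ => FinType.rec 0 (fun _ _ a b => Nat.pair a b + 1) σ
  refine ⟨e, fun σ => ?_⟩
  induction σ with
  | zero =>
    intro τ h
    cases τ with
    | zero => rfl
    | arrow => simp [e] at h
  | arrow σ τ ihσ ihτ =>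
    intro ρ h
    cases ρ with
    | zero => simp [e] at h
    | arrow σ' τ' =>
      have h' : Nat.pair (e σ) (e τ) = Nat.pair (e σ') (e τ') := Nat.succ_injective h
      rw [Nat.pair_eq_pair] at h'
      rw [ihσ h'.1, ihτ h'.2]

theorem exists_injective_tm : ∃ enc : (σ : FinType) → Tm σ → ℕ, ∀ σ, Function.Injective (enc σ) := by
  obtain ⟨e, he⟩ := exists_injective_finType
  let c : (σ : FinType) → Cst σ → ℕ := fun σ c => match c with
    | .zero => Nat.pair 0 0
    | .one => Nat.pair 1 0
    | .add => Nat.pair 2 0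
    | .mul => Nat.pair 3 0
    | .K σ τ => Nat.pair 4 (Nat.pair (e σ) (e τ))
    | .S ρ σ τ => Nat.pair 5 (Nat.pair (e ρ) (Nat.pair (e σ) (e τ)))
    | .recursor σ => Nat.pair 6 (e σ)
  have hc : ∀ σ τ (a : Cst σ) (b : Cst τ), c σ a = c τ b → HEq a b := by
    intro σ τ a b h
    cases a <;> cases b <;> obtain ⟨h1, h2⟩ := Nat.pair_eq_pair.1 h <;>
      first
      | exact absurd h1 (by decide)
      | rfl
      | (obtain rfl := he h2; rfl)
      | (obtain ⟨h3, h4⟩ := Nat.pair_eq_pair.1 h2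
         obtain rfl := he h3
         first
         | (obtain rfl := he h4; rfl)
         | (obtain ⟨h5, h6⟩ := Nat.pair_eq_pair.1 h4
            obtain rfl := he h5
            obtain rfl := he h6
            rfl))
  let enc : (σ : FinType) → Tm σ → ℕ := fun σ t => Tm.rec (motive := fun _ _ => ℕ)
    (fun τ n => Nat.pair 0 n) (fun {σ} a => Nat.pair 1 (c σ a))
    (fun {σ τ} _ _ a b => Nat.pair 2 (Nat.pair (e σ) (Nat.pair a b))) t
  refine ⟨enc, ?_⟩
  intro σ t
  induction t with
  | var τ n =>
    intro u h
    cases u with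
    | var => simp [enc] at h; rw [h]
    | cst => simp [enc] at h
    | app => simp [enc] at h
  | @cst σ a =>
    intro u h
    cases u with
    | var => simp [enc] at h
    | cst b =>
      simp only [enc, Nat.pair_eq_pair, true_and] at h
      rw [eq_of_heq (hc _ _ a b h)]
    | app => simp [enc] at h
  | @app ρ σ t u iht ihu =>
    intro w h
    cases w with
    | var => simp [enc] at h
    | cst => simp [enc] at h
    | @app ρ' _ t' u' =>
      have h' : Nat.pair 2 (Nat.pair (e ρ) (Nat.pair (enc _ t) (enc _ u))) =
        Nat.pair 2 (Nat.pair (e ρ') (Nat.pair (enc _ t') (enc _ u'))) := h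
      simp only [Nat.pair_eq_pair, true_and] at h'
      obtain ⟨h1, h2, h3⟩ := h'
      obtain rfl := he h1
      rw [iht h2, ihu h3]

instance : Countable Fm := by
  obtain ⟨enc, henc⟩ := exists_injective_tm
  obtain ⟨e, he⟩ := exists_injective_finType
  let f : Fm → ℕ := fun φ => Fm.rec (fun t u => Nat.pair 0 (Nat.pair (enc _ t) (enc _ u)))
    (fun t u => Nat.pair 1 (Nat.pair (enc _ t) (enc _ u))) (Nat.pair 2 0)
    (fun _ _ a b => Nat.pair 3 (Nat.pair a b)) (fun σ _ a => Nat.pair 4 (Nat.pair (e σ) a)) φ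
  refine Function.Injective.countable (f := f) fun φ => ?_
  induction φ with
  | eq t u | lt t u =>
    intro ψ h
    cases ψ <;> simp_all [f, (henc _).eq_iff]
  | bot =>
    intro ψ h
    cases ψ <;> simp_all [f]
  | imp φ φ' ih ih' =>
    intro ψ h
    cases ψ with
    | imp ψ ψ' =>
      have h' : Nat.pair 3 (Nat.pair (f φ) (f φ')) = Nat.pair 3 (Nat.pair (f ψ) (f ψ')) := h
      simp only [Nat.pair_eq_pair, true_and] at h'
      rw [ih h'.1, ih' h'.2]
    | _ => simp [f] at h
  | all σ φ ih =>
    intro ψ h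
    cases ψ with
    | all τ ψ =>
      have h' : Nat.pair 4 (Nat.pair (e σ) (f φ)) = Nat.pair 4 (Nat.pair (e τ) (f ψ)) := h
      simp only [Nat.pair_eq_pair, true_and] at h'
      rw [ih h'.2, he h'.1]
    | _ => simp [f] at h

/-- Maximal consistent sets of formulas with witnesses. -/
structure Saturated (Δ : Set Fm) : Prop where
  mem_of_derives {L : List Fm} {φ : Fm} : (∀ ψ ∈ L, ψ ∈ Δ) → Derives RCA0omega L φ → φ ∈ Δ
  bot_notMem : Fm.bot ∉ Δ
  mem_or_neg_mem (φ : Fm) : φ ∈ Δ ∨ φ.neg ∈ Δ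
  exists_inst_notMem {σ : FinType} {φ : Fm} : φ.all σ ∉ Δ → ∃ t, φ.inst σ t ∉ Δ

theorem exists_consistent_extension {Γ : List Fm} (hΓ : ¬Derives RCA0omega Γ .bot) (ψ : Fm) :
    ∃ Γ' : List Fm, ¬Derives RCA0omega Γ' .bot ∧ Γ ⊆ Γ' ∧
      (ψ ∈ Γ' ∨ (ψ.neg ∈ Γ' ∧ ∀ σ χ, ψ = .all σ χ → ∃ t, (χ.inst σ t).neg ∈ Γ')) := by
  by_cases h : Derives RCA0omega (ψ :: Γ) .bot
  · have h1 : ¬Derives RCA0omega (ψ.neg :: Γ) .bot := fun h' => hΓ (.impE (.impI h) (.raa h'))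
    by_cases hψ : ∃ σ χ, ψ = .all σ χ
    · obtain ⟨σ, χ, rfl⟩ := hψ
      obtain ⟨N, hN⟩ := Fm.exists_support_list (χ :: (Fm.all σ χ).neg :: Γ)
      refine ⟨(χ.inst σ (.var σ N)).neg :: (Fm.all σ χ).neg :: Γ, fun h' => h1 ?_,
        fun φ hφ => by simp [hφ], .inr ⟨by simp, ?_⟩⟩
      · exact .impE (.hyp (by simp : (Fm.all σ χ).neg ∈ _))
          (.allI_fresh (fun φ hφ s => RCA0omega.subst hφ s) hN (.raa h'))
      · rintro σ' χ' h
        cases h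
        exact ⟨.var σ N, by simp⟩
    · exact ⟨ψ.neg :: Γ, h1, List.subset_cons_self _ _, .inr ⟨by simp, fun σ χ h =>
        (hψ ⟨σ, χ, h⟩).elim⟩⟩
  · exact ⟨ψ :: Γ, h, List.subset_cons_self _ _, .inl (by simp)⟩

theorem exists_saturated {φ : Fm} (hφ : ¬Derives RCA0omega [] φ) :
    ∃ Δ, Saturated Δ ∧ φ ∉ Δ := by
  have : Nonempty Fm := ⟨.bot⟩
  obtain ⟨f, hf⟩ := exists_surjective_nat Fm
  choose! F hF using fun (Γ : List Fm) (ψ : Fm) (hΓ : ¬Derives RCA0omega Γ .bot) =>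
    exists_consistent_extension hΓ ψ
  let G : ℕ → List Fm := fun n => Nat.rec [φ.neg] (fun n Γ => F Γ (f n)) n
  have hG : ∀ n, ¬Derives RCA0omega (G n) .bot := by
    intro n
    induction n with
    | zero => exact fun h => hφ (.raa h)
    | succ n ih => exact (hF (G n) (f n) ih).1
  have hmono : Monotone fun n => {ψ | ψ ∈ G n} :=
    monotone_nat_of_le_succ fun n => (hF (G n) (f n) (hG n)).2.1
  have hlist : ∀ L : List Fm, (∀ ψ ∈ L, ∃ n, ψ ∈ G n) → ∃ n, L ⊆ G n := by
    intro L
    induction L with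
    | nil => exact fun _ => ⟨0, by simp⟩
    | cons ψ L ih =>
      intro h
      obtain ⟨n, hn⟩ := ih fun χ hχ => h χ (by simp [hχ])
      obtain ⟨m, hm⟩ := h ψ (by simp)
      refine ⟨max n m, List.cons_subset.2 ⟨hmono (le_max_right n m) hm, fun χ hχ => ?_⟩⟩
      exact hmono (le_max_left n m) (hn hχ)
  have hmem : ∀ ψ, (∃ n, ψ ∈ G n) ∨ ∃ n, ψ.neg ∈ G n ∧
      ∀ σ χ, ψ = .all σ χ → ∃ t, (χ.inst σ t).neg ∈ G n := by
    intro ψ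
    obtain ⟨n, rfl⟩ := hf ψ
    rcases (hF (G n) (f n) (hG n)).2.2 with h | h
    · exact .inl ⟨n + 1, h⟩
    · exact .inr ⟨n + 1, h⟩
  have hcons : ∀ ψ, (∃ n, ψ ∈ G n) → (∃ n, ψ.neg ∈ G n) → False := by
    rintro ψ ⟨n, hn⟩ ⟨m, hm⟩
    exact hG (max n m) (.impE (.hyp (hmono (le_max_right n m) hm))
      (.hyp (hmono (le_max_left n m) hn)))
  refine ⟨{ψ | ∃ n, ψ ∈ G n}, ⟨fun {L ψ} hL h => ?_, ?_, fun ψ => ?_, fun {σ ψ} h => ?_⟩, ?_⟩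
  · refine (hmem ψ).resolve_right ?_
    rintro ⟨m, hm, -⟩
    obtain ⟨n, hn⟩ := hlist L hL
    refine hG (max n m) (.impE (.hyp (hmono (le_max_right n m) hm)) (h.weaken fun χ hχ => ?_))
    exact hmono (le_max_left n m) (hn hχ)
  · rintro ⟨n, hn⟩
    exact hG n (.hyp hn)
  · exact (hmem ψ).imp id fun ⟨n, hn, _⟩ => ⟨n, hn⟩
  · obtain ⟨n, -, hn⟩ := (hmem _).resolve_left h
    obtain ⟨t, ht⟩ := hn σ ψ rfl
    exact ⟨t, fun h' => hcons _ h' ⟨n, ht⟩⟩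
  · exact fun h => hcons φ h ⟨0, by simp [G]⟩

namespace Saturated

variable {Δ : Set Fm}

theorem mem_of_mem_ax (hΔ : Saturated Δ) {φ : Fm} (h : φ ∈ RCA0omega) : φ ∈ Δ :=
  hΔ.mem_of_derives (L := []) (by simp) (.ax h)

theorem imp_mem (hΔ : Saturated Δ) {φ ψ : Fm} : .imp φ ψ ∈ Δ ↔ (φ ∈ Δ → ψ ∈ Δ) := by
  constructor
  · intro h h'
    exact hΔ.mem_of_derives (L := [.imp φ ψ, φ]) (by simp [h, h'])
      (.impE (.hyp (by simp : Fm.imp φ ψ ∈ _)) (.hyp (by simp)))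
  · intro h
    rcases hΔ.mem_or_neg_mem φ with h' | h'
    · exact hΔ.mem_of_derives (L := [ψ]) (by simp [h h']) (.impI (.hyp (by simp)))
    · exact hΔ.mem_of_derives (L := [φ.neg]) (by simp [h'])
        (.impI (.exfalso (.impE (.hyp (by simp : φ.neg ∈ _)) (.hyp (by simp))) _))

theorem all_mem (hΔ : Saturated Δ) {σ : FinType} {φ : Fm} :
    .all σ φ ∈ Δ ↔ ∀ t, φ.inst σ t ∈ Δ := by
  constructor
  · intro h t
    exact hΔ.mem_of_derives (L := [.all σ φ]) (by simp [h]) (.allE (.hyp (by simp)) t)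
  · intro h
    by_contra h'
    obtain ⟨t, ht⟩ := hΔ.exists_inst_notMem h'
    exact ht (h t)

/-- Provable equality of terms. -/
def Eqv (Δ : Set Fm) {τ : FinType} (t u : Tm τ) : Prop := Fm.eqT τ t u ∈ Δ

theorem eqv_arrow (hΔ : Saturated Δ) {σ τ : FinType} {t u : Tm (.arrow σ τ)} :
    Eqv Δ t u ↔ ∀ z, Eqv Δ (.app t z) (.app u z) := by
  simp only [Eqv, Fm.eqT, hΔ.all_mem, Fm.inst, Fm.eqT_subst, Tm.instVar_eq_cons, Tm.subst,
    Tm.shift_subst_cons, Tm.subst_var, Tm.cons_zero]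

theorem eqv_refl (hΔ : Saturated Δ) {τ : FinType} (t : Tm τ) : Eqv Δ t t := by
  induction τ with
  | zero => exact hΔ.mem_of_derives (L := []) (by simp) (.eqRefl t)
  | arrow σ τ _ ih => exact hΔ.eqv_arrow.2 fun z => ih _

theorem eq_subst (hΔ : Saturated Δ) {t u : Tm .zero} (φ : Fm) (h : .eq t u ∈ Δ)
    (h' : φ.inst .zero t ∈ Δ) : φ.inst .zero u ∈ Δ :=
  hΔ.mem_of_derives (L := [.eq t u, φ.inst .zero t]) (by simp [h, h'])
    (.eqSubst (.hyp (by simp : Fm.eq t u ∈ _)) (.hyp (by simp)))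

theorem eqv_symm (hΔ : Saturated Δ) {τ : FinType} {t u : Tm τ} (h : Eqv Δ t u) : Eqv Δ u t := by
  induction τ with
  | zero =>
    have := hΔ.eq_subst (.eq (.var .zero 0) (t.shift .zero)) h
    simp only [Fm.inst, Tm.instVar_eq_cons, Fm.subst, Tm.subst, Tm.shift_subst_cons,
      Tm.subst_var, Tm.cons_zero] at this
    exact this (hΔ.eqv_refl t)
  | arrow σ τ _ ih => exact hΔ.eqv_arrow.2 fun z => ih (hΔ.eqv_arrow.1 h z)

theorem eqv_trans (hΔ : Saturated Δ) {τ : FinType} {t u v : Tm τ} (h : Eqv Δ t u)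
    (h' : Eqv Δ u v) : Eqv Δ t v := by
  induction τ with
  | zero =>
    have := hΔ.eq_subst (.eq (t.shift .zero) (.var .zero 0)) h'
    simp only [Fm.inst, Tm.instVar_eq_cons, Fm.subst, Tm.subst, Tm.shift_subst_cons,
      Tm.subst_var, Tm.cons_zero] at this
    exact this h
  | arrow σ τ _ ih => exact hΔ.eqv_arrow.2 fun z => ih (hΔ.eqv_arrow.1 h z) (hΔ.eqv_arrow.1 h' z)

theorem eqv_app (hΔ : Saturated Δ) {σ τ : FinType} {t t' : Tm (.arrow σ τ)} {u u' : Tm σ}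
    (h : Eqv Δ t t') (h' : Eqv Δ u u') : Eqv Δ (.app t u) (.app t' u') :=
  hΔ.eqv_trans (hΔ.eqv_arrow.1 h u)
    (hΔ.imp_mem.1 (hΔ.mem_of_mem_ax (.ext u u' t')) h')

theorem lt_mem_congr (hΔ : Saturated Δ) {t t' u u' : Tm .zero} (h : Eqv Δ t t')
    (h' : Eqv Δ u u') (hlt : .lt t u ∈ Δ) : .lt t' u' ∈ Δ := by
  have h1 := hΔ.eq_subst (.lt (.var .zero 0) (u.shift .zero)) h
  have h2 := hΔ.eq_subst (.lt (t'.shift .zero) (.var .zero 0)) h'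
  simp only [Fm.inst, Tm.instVar_eq_cons, Fm.subst, Tm.subst, Tm.shift_subst_cons,
    Tm.subst_var, Tm.cons_zero] at h1 h2
  exact h2 (h1 hlt)

/-- Terms up to provable equality. -/
def setoid (hΔ : Saturated Δ) (τ : FinType) : Setoid (Tm τ) :=
  ⟨Eqv Δ, hΔ.eqv_refl, hΔ.eqv_symm, hΔ.eqv_trans⟩

/-- The term structure. -/
def struc (hΔ : Saturated Δ) : Struc where
  C τ := Quotient (hΔ.setoid τ)
  app := fun {σ τ} => Quotient.map₂ (sa := hΔ.setoid (.arrow σ τ)) (sb := hΔ.setoid σ)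
    (sc := hΔ.setoid τ) .app fun _ _ h _ _ h' => hΔ.eqv_app h h'
  cst c := Quotient.mk _ (.cst c)
  lt := Quotient.lift₂ (s₁ := hΔ.setoid .zero) (s₂ := hΔ.setoid .zero)
    (fun t u => .lt t u ∈ Δ) fun _ _ _ _ h h' =>
      propext ⟨hΔ.lt_mem_congr h h', hΔ.lt_mem_congr (hΔ.eqv_symm h) (hΔ.eqv_symm h')⟩

/-- The valuation given by a substitution. -/
def val (hΔ : Saturated Δ) (s : Substitution) : hΔ.struc.Val := fun τ n => Quotient.mk (hΔ.setoid τ) (s τ n)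

theorem exists_val (hΔ : Saturated Δ) (v : hΔ.struc.Val) : ∃ s, hΔ.val s = v := by
  choose s hs using fun τ n => Quotient.exists_rep (s := hΔ.setoid τ) (v τ n)
  exact ⟨s, funext fun τ => funext fun n => hs τ n⟩

theorem eval_val (hΔ : Saturated Δ) (s : Substitution) {τ : FinType} (t : Tm τ) :
    Struc.eval (hΔ.val s) t = Quotient.mk (hΔ.setoid τ) (t.subst s) := by
  induction t with
  | var => rfl
  | cst => rfl
  | app t u iht ihu => simp only [Struc.eval, iht, ihu]; rfl

theorem vcons_val (hΔ : Saturated Δ) (s : Substitution) {σ : FinType} (t : Tm σ) :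
    Struc.vcons (M := hΔ.struc) σ (Quotient.mk (hΔ.setoid σ) t) (hΔ.val s) =
      hΔ.val (Tm.cons σ t s) := by
  funext τ n
  by_cases h : σ = τ
  · subst h
    cases n with
    | zero => exact (Struc.vcons_zero (M := hΔ.struc) _ _ _).trans (by simp only [val, Tm.cons_zero]; rfl)
    | succ n => exact (Struc.vcons_succ (M := hΔ.struc) _ _ _ _).trans (by simp only [val, Tm.cons_succ]; rfl)
  · exact (Struc.vcons_ne (M := hΔ.struc) h _ _ _).trans (by simp only [val, Tm.cons_ne h]; rfl)

theorem sat_val (hΔ : Saturated Δ) (s : Substitution) (φ : Fm) :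
    Struc.sat (hΔ.val s) φ ↔ φ.subst s ∈ Δ := by
  induction φ generalizing s with
  | eq t u =>
    rw [Struc.sat, eval_val, eval_val]
    exact Quotient.eq (r := hΔ.setoid .zero)
  | lt t u =>
    rw [Struc.sat, eval_val, eval_val]
    rfl
  | bot => exact iff_of_false id hΔ.bot_notMem
  | imp φ ψ ihφ ihψ => rw [Struc.sat, Fm.subst, hΔ.imp_mem, ihφ, ihψ]
  | all σ φ ih =>
    rw [Struc.sat, Fm.subst, hΔ.all_mem]
    constructor
    · intro h t
      have := h (Quotient.mk (hΔ.setoid σ) t)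
      rwa [vcons_val, ih, ← Fm.subst_up_inst] at this
    · intro h x
      obtain ⟨t, rfl⟩ := Quotient.exists_rep (s := hΔ.setoid σ) x
      rw [vcons_val, ih, ← Fm.subst_up_inst]
      exact h t

/-- The term model. -/
def model (hΔ : Saturated Δ) : Model where
  toStruc := hΔ.struc
  ext {σ τ} f g h := by
    obtain ⟨t, rfl⟩ := Quotient.exists_rep (s := hΔ.setoid _) f
    obtain ⟨u, rfl⟩ := Quotient.exists_rep (s := hΔ.setoid _) g
    refine Quotient.sound (s := hΔ.setoid (.arrow σ τ)) (hΔ.eqv_arrow.2 fun z => ?_)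
    exact Quotient.exact (s := hΔ.setoid τ) (h (Quotient.mk (hΔ.setoid σ) z))
  sat_of_mem {φ} h v := by
    obtain ⟨s, rfl⟩ := hΔ.exists_val v
    exact (hΔ.sat_val s φ).2 (hΔ.mem_of_mem_ax (RCA0omega.subst h s))

end Saturated

/-- Completeness: what holds in all models can be derived. -/
theorem proves_of_forall_model {φ : Fm}
    (h : ∀ (M : Model) (v : M.toStruc.Val), Struc.sat v φ) : Proves RCA0omega φ := by
  by_contra hφ
  obtain ⟨Δ, hΔ, h'⟩ := exists_saturated hφ
  have := (hΔ.sat_val Tm.var φ).1 (h hΔ.model (hΔ.val Tm.var))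
  rw [Fm.subst_var] at this
  exact h' this

end HigherOrderArith

namespace HigherOrderArith
open FinType

/-! ## Representable functions of a model -/

instance (M : Struc) (σ τ : FinType) : CoeFun (M.C (.arrow σ τ)) fun _ => M.C σ → M.C τ :=
  ⟨M.app⟩

instance (M : Struc) : Zero (M.C .zero) := ⟨M.cst .zero⟩
instance (M : Struc) : One (M.C .zero) := ⟨M.cst .one⟩
instance (M : Struc) : Add (M.C .zero) := ⟨fun a b => M.cst .add a b⟩
instance (M : Struc) : Mul (M.C .zero) := ⟨fun a b => M.cst .mul a b⟩
instance (M : Struc) : LT (M.C .zero) := ⟨M.lt⟩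

def Struc.dflt (M : Struc) : (τ : FinType) → M.C τ
  | .zero => 0
  | .arrow σ τ => M.cst (.K τ σ) (M.dflt τ)

/-- The numbers of a structure. -/
abbrev Struc.N (M : Struc) : Type := M.C .zero

/-- Tuples of objects. -/
@[reducible] def Env (M : Model) : List FinType → Type
  | [] => Unit
  | σ :: Γ => M.C σ × Env M Γ

def RepAux (M : Model) : (Γ : List FinType) → {τ : FinType} → (Env M Γ → M.C τ) → Prop
  | [], _, _ => True
  | σ :: Γ, τ, f => ∃ g : Env M Γ → M.C (.arrow σ τ), RepAux M Γ g ∧ ∀ x e, g e x = f (x, e)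

/-- `f` is given by an object of the model, as a function of the entries of its argument. -/
class Rep {M : Model} {Γ : List FinType} {τ : FinType} (f : Env M Γ → M.C τ) : Prop where
  out : RepAux M Γ f

namespace Model

variable {M : Model}

theorem sat_eqT (v : M.Val) {τ : FinType} (t u : Tm τ) :
    Struc.sat v (Fm.eqT τ t u) ↔ Struc.eval v t = Struc.eval v u := by
  induction τ generalizing v with
  | zero => rfl
  | arrow σ τ _ ih =>
    simp only [Fm.eqT, Struc.sat_all, ih, Struc.eval, Struc.eval_shift, Struc.vcons_zero]
    exact ⟨fun h => M.ext _ _ h, fun h x => by rw [h]⟩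

theorem K_app {σ τ : FinType} (x : M.C σ) (y : M.C τ) : M.cst (.K σ τ) x y = x := by
  have := M.sat_of_mem (.K (.var σ 0) (Tm.shift σ (.var τ 0)))
    (Struc.vcons σ x (Struc.vcons τ y fun τ _ => M.dflt τ))
  simpa only [sat_eqT, Struc.eval, Struc.eval_shift, Struc.vcons_zero] using this

theorem S_app {ρ σ τ : FinType} (f : M.C (.arrow ρ (.arrow σ τ))) (g : M.C (.arrow ρ σ))
    (x : M.C ρ) : M.cst (.S ρ σ τ) f g x = f x (g x) := by
  have := M.sat_of_mem (.S (.var (.arrow ρ (.arrow σ τ)) 0)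
    (Tm.shift (.arrow ρ (.arrow σ τ)) (.var (.arrow ρ σ) 0))
    (Tm.shift (.arrow ρ (.arrow σ τ)) (Tm.shift (.arrow ρ σ) (.var ρ 0))))
    (Struc.vcons _ f (Struc.vcons _ g (Struc.vcons _ x fun τ _ => M.dflt τ)))
  simpa only [sat_eqT, Struc.eval, Struc.eval_shift, Struc.vcons_zero] using this

def val₁ {σ : FinType} (x : M.C σ) : M.Val := Struc.vcons σ x fun τ _ => M.dflt τ
def val₂ (a b : M.N) : M.Val := Struc.vcons .zero a (val₁ b)

theorem succ_ne_zero (a : M.N) : a + 1 ≠ 0 :=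
  M.sat_of_mem (.succ_ne_zero (.var .zero 0)) (val₁ a)

theorem add_zero' (a : M.N) : a + 0 = a := M.sat_of_mem (.add_zero (.var .zero 0)) (val₁ a)

theorem add_succ (a b : M.N) : a + (b + 1) = a + b + 1 :=
  M.sat_of_mem (.add_succ (.var .zero 0) (.var .zero 1)) (val₂ a b)

theorem mul_zero' (a : M.N) : a * 0 = 0 := M.sat_of_mem (.mul_zero (.var .zero 0)) (val₁ a)

theorem mul_succ (a b : M.N) : a * (b + 1) = a * b + a :=
  M.sat_of_mem (.mul_succ (.var .zero 0) (.var .zero 1)) (val₂ a b)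

theorem not_lt_zero (a : M.N) : ¬a < 0 := M.sat_of_mem (.not_lt_zero (.var .zero 0)) (val₁ a)

theorem lt_succ {a b : M.N} : a < b + 1 ↔ a < b ∨ a = b := by
  have := M.sat_of_mem (.lt_succ (.var .zero 0) (.var .zero 1)) (val₂ a b)
  rw [Struc.sat_iff, Struc.sat_or] at this
  exact this

/-- Primitive recursion. -/
def recN (f : M.C (.arrow .zero t1)) (a n : M.N) : M.N := M.cst (.recursor .zero) f a n

theorem recN_zero (f : M.C (.arrow .zero t1)) (a : M.N) : recN f a 0 = a :=
  M.sat_of_mem (.rec_zero (.var _ 0) (.var .zero 0)) (Struc.vcons _ f (val₁ a))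

theorem recN_succ (f : M.C (.arrow .zero t1)) (a n : M.N) :
    recN f a (n + 1) = f n (recN f a n) :=
  M.sat_of_mem (.rec_succ (.var _ 0) (.var .zero 0) (.var .zero 1)) (Struc.vcons _ f (val₂ a n))

theorem sat_induction {φ : Fm} (hφ : φ.QF) (v : M.Val) (h0 : Struc.sat (Struc.vcons .zero 0 v) φ)
    (hs : ∀ n : M.N, Struc.sat (Struc.vcons .zero n v) φ →
      Struc.sat (Struc.vcons .zero (n + 1) v) φ) (n : M.N) :
    Struc.sat (Struc.vcons .zero n v) φ := by
  refine M.sat_of_mem (.ind φ hφ) v ?_ (fun n hn => ?_) n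
  · rw [Struc.sat_inst]
    exact h0
  · rw [Struc.sat_subst]
    convert hs n hn using 1
    funext τ k
    cases τ with
    | zero =>
      cases k with
      | zero => rfl
      | succ k => simp [Tm.succVar, Struc.eval]
    | arrow σ τ => simp [Tm.succVar, Struc.eval, Struc.vcons_ne]

/-- Predicates of numbers given by a quantifier-free formula with parameters. -/
def QFPred (P : M.N → Prop) : Prop :=
  ∃ φ : Fm, φ.QF ∧ ∃ v : M.Val, ∀ n, P n ↔ Struc.sat (Struc.vcons .zero n v) φ

theorem QFPred.induction {P : M.N → Prop} (hP : QFPred P) (h0 : P 0)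
    (hs : ∀ n, P n → P (n + 1)) (n : M.N) : P n := by
  obtain ⟨φ, hφ, v, h⟩ := hP
  rw [h] at h0 ⊢
  exact sat_induction hφ v h0 (fun n hn => (h _).1 (hs n ((h n).2 hn))) n

theorem QFPred.imp {P Q : M.N → Prop} (hP : QFPred P) (hQ : QFPred Q) :
    QFPred fun n => P n → Q n := by
  obtain ⟨φ, hφ, v, h⟩ := hP
  obtain ⟨ψ, hψ, w, h'⟩ := hQ
  let z : M.Val := fun τ n => if n % 2 = 0 then v τ (n / 2) else w τ (n / 2)
  refine ⟨.imp (φ.subst (Tm.up .zero fun τ n => .var τ (2 * n)))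
    (ψ.subst (Tm.up .zero fun τ n => .var τ (2 * n + 1))), ⟨hφ.subst _, hψ.subst _⟩, z, fun n => ?_⟩
  simp only [Struc.sat_imp, Struc.sat_subst, Struc.eval_up, Struc.eval, h, h']
  have h1 : (fun (τ : FinType) (n : ℕ) => z τ (2 * n)) = v := by
    funext τ n; simp [z]
  have h2 : (fun (τ : FinType) (n : ℕ) => z τ (2 * n + 1)) = w := by
    funext τ n
    have e1 : (2 * n + 1) % 2 = 1 := by omega
    have e2 : (2 * n + 1) / 2 = n := by omega
    simp [z, e1, e2]
  rw [h1, h2]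

theorem QFPred.not {P : M.N → Prop} (hP : QFPred P) : QFPred fun n => ¬P n :=
  hP.imp ⟨.bot, trivial, fun τ _ => M.dflt τ, fun _ => Iff.rfl⟩

theorem QFPred.or {P Q : M.N → Prop} (hP : QFPred P) (hQ : QFPred Q) :
    QFPred fun n => P n ∨ Q n := by
  simpa only [or_iff_not_imp_left] using hP.not.imp hQ

end Model

namespace Rep

variable {M : Model} {Γ : List FinType} {ρ σ τ α β γ : FinType}

instance const (c : M.C τ) : Rep (Γ := Γ) fun _ : Env M Γ => c := by
  refine ⟨?_⟩
  induction Γ generalizing τ with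
  | nil => trivial
  | cons σ Γ ih => exact ⟨fun _ => M.cst (.K τ σ) c, ih _, fun x e => Model.K_app _ _⟩

instance app (f : Env M Γ → M.C (.arrow σ τ)) (g : Env M Γ → M.C σ)
    [hf : Rep f] [hg : Rep g] : Rep fun e => f e (g e) := by
  refine ⟨?_⟩
  have hf := hf.out
  have hg := hg.out
  induction Γ generalizing σ τ with
  | nil => trivial
  | cons ρ Γ ih =>
    obtain ⟨f', hf', hf'e⟩ := hf
    obtain ⟨g', hg', hg'e⟩ := hg
    refine ⟨fun e => M.cst (.S ρ σ τ) (f' e) (g' e),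
      ih (hf := ⟨ih (hf := const _) (hg := ⟨hf'⟩) _ _ (const _).out hf'⟩) (hg := ⟨hg'⟩) _ _
        (ih (hf := const _) (hg := ⟨hf'⟩) _ _ (const _).out hf') hg', fun x e => ?_⟩
    rw [Model.S_app, hf'e, hg'e]

instance (priority := 100) weaken (f : Env M Γ → M.C τ) [hf : Rep f] :
    Rep (Γ := σ :: Γ) fun e => f e.2 :=
  ⟨fun e => M.cst (.K τ σ) (f e), (app (fun _ => M.cst (.K τ σ)) f).out,
    fun _ _ => Model.K_app _ _⟩

instance (priority := 90) weaken₂ (f : Env M Γ → M.C τ) [Rep f] :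
    Rep (Γ := σ :: ρ :: Γ) fun e => f e.2.2 :=
  weaken fun e : Env M (ρ :: Γ) => f e.2

instance (priority := 80) weaken₃ (f : Env M Γ → M.C τ) [Rep f] :
    Rep (Γ := σ :: ρ :: α :: Γ) fun e => f e.2.2.2 :=
  weaken fun e : Env M (ρ :: α :: Γ) => f e.2.2

instance v0 : Rep (Γ := σ :: Γ) fun e : Env M (σ :: Γ) => e.1 :=
  ⟨fun _ => M.cst (.S σ (.arrow σ σ) σ) (M.cst (.K σ (.arrow σ σ))) (M.cst (.K σ σ)),
    (const _).out, fun _ _ => by rw [Model.S_app, Model.K_app]⟩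

instance v1 : Rep (Γ := σ :: τ :: Γ) fun e : Env M (σ :: τ :: Γ) => e.2.1 :=
  weaken fun e : Env M (τ :: Γ) => e.1

instance v2 : Rep fun e : Env M (σ :: τ :: ρ :: Γ) => e.2.2.1 :=
  weaken fun e : Env M (τ :: ρ :: Γ) => e.2.1

instance v3 : Rep fun e : Env M (σ :: τ :: ρ :: α :: Γ) => e.2.2.2.1 :=
  weaken fun e : Env M (τ :: ρ :: α :: Γ) => e.2.2.1

instance add (f g : Env M Γ → M.N) [Rep f] [Rep g] : Rep fun e => f e + g e :=
  inferInstanceAs (Rep fun e => M.cst .add (f e) (g e))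

instance mul (f g : Env M Γ → M.N) [Rep f] [Rep g] : Rep fun e => f e * g e :=
  inferInstanceAs (Rep fun e => M.cst .mul (f e) (g e))

end Rep

namespace Rep

variable {M : Model} {Γ : List FinType} {ρ σ τ : FinType}

theorem exists_obj (f : M.C σ → M.C τ) [h : Rep (Γ := [σ]) fun e : Env M _ => f e.1] :
    ∃ F : M.C (.arrow σ τ), ∀ x, F x = f x := by
  obtain ⟨g, -, hg⟩ := h.out
  exact ⟨g (), fun x => hg x ()⟩

theorem exists_obj₂ (f : M.C ρ → M.C σ → M.C τ)
    [h : Rep (Γ := [σ, ρ]) fun e : Env M _ => f e.2.1 e.1] :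
    ∃ F : M.C (.arrow ρ (.arrow σ τ)), ∀ x y, F x y = f x y := by
  obtain ⟨g, ⟨G, -, hG⟩, hg⟩ := h.out
  exact ⟨G (), fun x y => by rw [hG x, hg]⟩

end Rep

namespace Model

variable {M : Model} {σ τ : FinType}

open Classical in
/-- The object representing `f`. -/
noncomputable def lam (f : M.C σ → M.C τ) : M.C (.arrow σ τ) :=
  if h : ∃ F : M.C (.arrow σ τ), ∀ x, F x = f x then h.choose else M.dflt _

theorem lam_eq {f : M.C σ → M.C τ} {F : M.C (.arrow σ τ)} (h : ∀ x, F x = f x) : lam f = F := by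
  have h' : ∃ F : M.C (.arrow σ τ), ∀ x, F x = f x := ⟨F, h⟩
  rw [lam, dif_pos h']
  exact M.ext _ _ fun x => by rw [h'.choose_spec, h]

theorem lam_app (f : M.C σ → M.C τ) [h : Rep (Γ := [σ]) fun e : Env M _ => f e.1] (x : M.C σ) :
    lam f x = f x := by
  obtain ⟨F, hF⟩ := Rep.exists_obj f
  rw [lam_eq hF, hF]

theorem qfPred_eq (f g : M.N → M.N) [Rep (Γ := [.zero]) fun e : Env M _ => f e.1]
    [Rep (Γ := [.zero]) fun e : Env M _ => g e.1] : QFPred fun n => f n = g n :=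
  ⟨.eq (.app (.var t1 0) (.var .zero 0)) (.app (.var t1 1) (.var .zero 0)), trivial,
    Struc.vcons t1 (lam f) (val₁ (lam g)), fun n => by
      beta_reduce; rw [← lam_app f n, ← lam_app g n]; exact Iff.rfl⟩

theorem qfPred_lt (f g : M.N → M.N) [Rep (Γ := [.zero]) fun e : Env M _ => f e.1]
    [Rep (Γ := [.zero]) fun e : Env M _ => g e.1] : QFPred fun n => f n < g n :=
  ⟨.lt (.app (.var t1 0) (.var .zero 0)) (.app (.var t1 1) (.var .zero 0)), trivial,
    Struc.vcons t1 (lam f) (val₁ (lam g)), fun n => by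
      beta_reduce; rw [← lam_app f n, ← lam_app g n]; exact Iff.rfl⟩

theorem induction_eq (f g : M.N → M.N) [Rep (Γ := [.zero]) fun e : Env M _ => f e.1]
    [Rep (Γ := [.zero]) fun e : Env M _ => g e.1] (h0 : f 0 = g 0)
    (hs : ∀ n, f n = g n → f (n + 1) = g (n + 1)) (n : M.N) : f n = g n :=
  (qfPred_eq f g).induction h0 hs n

/-! ### Arithmetic -/

theorem add_assoc' (a b c : M.N) : a + b + c = a + (b + c) :=
  induction_eq (fun c => a + b + c) (fun c => a + (b + c)) (by simp only [add_zero'])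
    (fun n h => by simp only [add_succ, h]) c

theorem zero_add' (a : M.N) : 0 + a = a :=
  induction_eq (fun a => 0 + a) (fun a => a) (add_zero' 0)
    (fun n h => by simp only [add_succ, h]) a

theorem one_add' (a : M.N) : 1 + a = a + 1 :=
  induction_eq (fun a => 1 + a) (fun a => a + 1) (by simp only [add_zero', zero_add'])
    (fun n h => by simp only [add_succ, h]) a

theorem add_comm' (a b : M.N) : a + b = b + a :=
  induction_eq (fun b => a + b) (fun b => b + a) (by simp only [add_zero', zero_add'])
    (fun n h => by
      simp only [add_succ, h]
      rw [add_assoc', add_assoc', one_add']) b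

theorem mul_add' (a b c : M.N) : a * (b + c) = a * b + a * c :=
  induction_eq (fun c => a * (b + c)) (fun c => a * b + a * c)
    (by simp only [add_zero', mul_zero'])
    (fun n h => by simp only [← add_assoc', mul_succ, h]) c

theorem mul_assoc' (a b c : M.N) : a * b * c = a * (b * c) :=
  induction_eq (fun c => a * b * c) (fun c => a * (b * c)) (by simp only [mul_zero'])
    (fun n h => by rw [mul_succ, mul_succ, mul_add', h]) c

theorem zero_mul' (a : M.N) : 0 * a = 0 :=
  induction_eq (fun a => 0 * a) (fun _ => 0) (mul_zero' 0)
    (fun n h => by simp only [mul_succ, h, add_zero']) a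

theorem one_mul' (a : M.N) : 1 * a = a :=
  induction_eq (fun a => 1 * a) (fun a => a) (mul_zero' 1)
    (fun n h => by simp only [mul_succ, h]) a

theorem succ_mul' (a b : M.N) : (a + 1) * b = a * b + b :=
  induction_eq (fun b => (a + 1) * b) (fun b => a * b + b) (by simp only [mul_zero', add_zero'])
    (fun n h => by
      simp only [mul_succ, h]
      rw [add_assoc', add_assoc']
      congr 1
      rw [← add_assoc', ← add_assoc', add_comm' n a]) b

theorem mul_comm' (a b : M.N) : a * b = b * a :=
  induction_eq (fun b => a * b) (fun b => b * a) (by simp only [mul_zero', zero_mul'])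
    (fun n h => by simp only [mul_succ, succ_mul', h]) b

instance : CommSemiring M.N where
  add_assoc := add_assoc'
  zero_add := zero_add'
  add_zero := add_zero'
  add_comm := add_comm'
  mul_assoc := mul_assoc'
  one_mul := one_mul'
  mul_one a := by rw [mul_comm', one_mul']
  mul_comm := mul_comm'
  left_distrib := mul_add'
  right_distrib a b c := by rw [mul_comm', mul_add', mul_comm' c a, mul_comm' c b]
  zero_mul := zero_mul'
  mul_zero := mul_zero'
  nsmul := nsmulRec

end Model
end HigherOrderArith

namespace HigherOrderArith

/-! ## The ordered field of fractions of an ordered semiring -/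

section Fractions

variable (N : Type*) [CommSemiring N] [LinearOrder N] [IsStrictOrderedRing N]

/-- Pairs of elements of `N`, thought of as differences. -/
def diffSetoid : Setoid (N × N) where
  r a b := a.1 + b.2 = b.1 + a.2
  iseqv := by
    refine ⟨fun a => rfl, fun h => h.symm, fun {a b c} h h' => ?_⟩
    refine add_right_cancel (b := b.2 + b.1) ?_
    calc a.1 + c.2 + (b.2 + b.1) = (a.1 + b.2) + (b.1 + c.2) := by ring
      _ = (b.1 + a.2) + (c.1 + b.2) := by rw [h, h']
      _ = _ := by ring

/-- The ring of differences of elements of `N`. -/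
def Diff : Type _ := Quotient (diffSetoid N)

namespace Diff

variable {N}

def mk (a b : N) : Diff N := Quotient.mk (diffSetoid N) (a, b)

theorem mk_eq {a b c d : N} : mk a b = mk c d ↔ a + d = c + b := Quotient.eq (r := diffSetoid N)

@[elab_as_elim]
theorem ind {P : Diff N → Prop} (h : ∀ a b, P (mk a b)) (x : Diff N) : P x :=
  Quotient.ind (fun p => h p.1 p.2) x

instance : Zero (Diff N) := ⟨mk 0 0⟩
instance : One (Diff N) := ⟨mk 1 0⟩
instance : Add (Diff N) :=
  ⟨Quotient.map₂ (fun a b => (a.1 + b.1, a.2 + b.2)) fun a a' h b b' h' => by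
    change a.1 + b.1 + (a'.2 + b'.2) = a'.1 + b'.1 + (a.2 + b.2)
    have h : a.1 + a'.2 = a'.1 + a.2 := h
    have h' : b.1 + b'.2 = b'.1 + b.2 := h'
    calc _ = (a.1 + a'.2) + (b.1 + b'.2) := by ring
      _ = _ := by rw [h, h']; ring⟩
instance : Neg (Diff N) :=
  ⟨Quotient.map (fun a => (a.2, a.1)) fun a a' h => by
    change a.2 + a'.1 = a'.2 + a.1
    have h : a.1 + a'.2 = a'.1 + a.2 := h
    rw [add_comm, ← h, add_comm]⟩
instance : Mul (Diff N) :=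
  ⟨Quotient.map₂ (fun a b => (a.1 * b.1 + a.2 * b.2, a.1 * b.2 + a.2 * b.1)) fun a a' h b b' h' => by
    change a.1 * b.1 + a.2 * b.2 + (a'.1 * b'.2 + a'.2 * b'.1) =
      a'.1 * b'.1 + a'.2 * b'.2 + (a.1 * b.2 + a.2 * b.1)
    have h : a.1 + a'.2 = a'.1 + a.2 := h
    have h' : b.1 + b'.2 = b'.1 + b.2 := h'
    refine add_right_cancel (b := (a'.1 * b.1 + a'.2 * b.2) + (a'.1 * b.2 + a'.2 * b.1)) ?_
    calc _ = (a.1 + a'.2) * b.1 + (a'.1 + a.2) * b.2 + a'.1 * (b.1 + b'.2) +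
          a'.2 * (b'.1 + b.2) := by ring
      _ = (a'.1 + a.2) * b.1 + (a.1 + a'.2) * b.2 + a'.1 * (b'.1 + b.2) +
          a'.2 * (b.1 + b'.2) := by rw [h, h']
      _ = _ := by ring⟩

theorem mk_add_mk (a b c d : N) : mk a b + mk c d = mk (a + c) (b + d) := rfl
theorem mk_mul_mk (a b c d : N) : mk a b * mk c d = mk (a * c + b * d) (a * d + b * c) := rfl
theorem neg_mk (a b : N) : -mk a b = mk b a := rfl
theorem zero_def : (0 : Diff N) = mk 0 0 := rfl
theorem one_def : (1 : Diff N) = mk 1 0 := rfl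

instance : CommRing (Diff N) where
  add_assoc := by
    refine ind fun a b => ind fun c d => ind fun e f => ?_
    simp only [mk_add_mk, add_assoc]
  zero_add := ind fun a b => by simp only [zero_def, mk_add_mk, zero_add]
  add_zero := ind fun a b => by simp only [zero_def, mk_add_mk, add_zero]
  add_comm := by
    refine ind fun a b => ind fun c d => ?_
    simp only [mk_add_mk, add_comm]
  mul_assoc := by
    refine ind fun a b => ind fun c d => ind fun e f => ?_
    simp only [mk_mul_mk]; congr 1 <;> ring
  one_mul := ind fun a b => by simp [one_def, mk_mul_mk]
  mul_one := ind fun a b => by simp [one_def, mk_mul_mk]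
  mul_comm := by
    refine ind fun a b => ind fun c d => ?_
    simp only [mk_mul_mk]; congr 1 <;> ring
  left_distrib := by
    refine ind fun a b => ind fun c d => ind fun e f => ?_
    simp only [mk_mul_mk, mk_add_mk]; congr 1 <;> ring
  right_distrib := by
    refine ind fun a b => ind fun c d => ind fun e f => ?_
    simp only [mk_mul_mk, mk_add_mk]; congr 1 <;> ring
  zero_mul := ind fun a b => by simp [zero_def, mk_mul_mk]
  mul_zero := ind fun a b => by simp [zero_def, mk_mul_mk]
  neg_add_cancel := ind fun a b => by
    rw [neg_mk, mk_add_mk, zero_def, mk_eq]; ring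
  nsmul := nsmulRec
  zsmul := zsmulRec

instance : Nontrivial (Diff N) := ⟨0, 1, by
  rw [zero_def, one_def, Ne, mk_eq]; simp⟩

variable [CanonicallyOrderedAdd N]

/-- The non-negative differences. -/
def cone : RingCone (Diff N) where
  carrier := {x | ∃ a : N, x = mk a 0}
  mul_mem' := by
    rintro _ _ ⟨a, rfl⟩ ⟨c, rfl⟩
    exact ⟨a * c, by simp [mk_mul_mk]⟩
  one_mem' := ⟨1, rfl⟩
  add_mem' := by
    rintro _ _ ⟨a, rfl⟩ ⟨c, rfl⟩
    exact ⟨a + c, by simp [mk_add_mk]⟩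
  zero_mem' := ⟨0, rfl⟩
  eq_zero_of_mem_of_neg_mem' := by
    rintro _ ⟨a, rfl⟩ ⟨c, e⟩
    rw [neg_mk, mk_eq, zero_add] at e
    have : a = 0 := by
      rcases eq_zero_or_pos a with h | h
      · exact h
      · exact absurd e (add_pos_of_nonneg_of_pos zero_le h).ne
    rw [this, zero_def]

theorem mk_mem_cone {a b : N} : mk a b ∈ cone (N := N) ↔ b ≤ a := by
  constructor
  · rintro ⟨c, h⟩
    rw [mk_eq, add_zero] at h
    exact le_of_le_of_eq le_add_self h.symm
  · intro h
    obtain ⟨c, rfl⟩ := exists_add_of_le h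
    exact ⟨c, by rw [mk_eq, add_zero, add_comm]⟩

instance : HasMemOrNegMem (cone (N := N)) where
  mem_or_neg_mem := ind fun a b => (le_total b a).imp mk_mem_cone.2 mk_mem_cone.2

open Classical in
noncomputable instance : LinearOrder (Diff N) := LinearOrder.mkOfAddGroupCone (cone (N := N))

instance : IsOrderedRing (Diff N) := IsOrderedRing.mkOfCone (cone (N := N))

theorem mk_le_mk {a b c d : N} : mk a b ≤ mk c d ↔ a + d ≤ c + b := by
  change mk c d - mk a b ∈ cone (N := N) ↔ _
  rw [sub_eq_add_neg, neg_mk, mk_add_mk, mk_mem_cone, add_comm d]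

theorem exists_eq (x : Diff N) : ∃ a : N, x = mk a 0 ∨ x = -mk a 0 := by
  rcases HasMemOrNegMem.mem_or_neg_mem (cone (N := N)) x with ⟨a, h⟩ | ⟨a, h⟩
  · exact ⟨a, .inl h⟩
  · exact ⟨a, .inr (by rw [← h, neg_neg])⟩

instance : NoZeroDivisors (Diff N) where
  eq_zero_or_eq_zero_of_mul_eq_zero := by
    intro x y h
    obtain ⟨a, ha⟩ := exists_eq x
    obtain ⟨b, hb⟩ := exists_eq y
    have h0 : mk a 0 * mk b 0 = 0 := by
      rcases ha with rfl | rfl <;> rcases hb with rfl | rfl <;> simpa using h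
    rw [mk_mul_mk, zero_def, mk_eq] at h0
    simp only [mul_zero, zero_mul, add_zero, mul_eq_zero] at h0
    rcases h0 with rfl | rfl
    · left; rcases ha with rfl | rfl <;> simp [← zero_def]
    · right; rcases hb with rfl | rfl <;> simp [← zero_def]

instance : IsDomain (Diff N) := NoZeroDivisors.to_isDomain _

instance : IsStrictOrderedRing (Diff N) := IsOrderedRing.toIsStrictOrderedRing _

end Diff

section

set_option linter.overlappingInstances false

variable (R : Type*) [CommRing R] [IsDomain R] [LinearOrder R] [IsStrictOrderedRing R]

/-- The non-negative fractions. -/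
def fractionCone : RingCone (FractionRing R) where
  carrier := {x | ∃ a b : R, 0 ≤ a ∧ 0 < b ∧
    x = algebraMap R (FractionRing R) a / algebraMap R (FractionRing R) b}
  mul_mem' := by
    rintro _ _ ⟨a, b, ha, hb, rfl⟩ ⟨c, d, hc, hd, rfl⟩
    exact ⟨a * c, b * d, by positivity, by positivity, by simp [div_mul_div_comm]⟩
  one_mem' := ⟨1, 1, by simp⟩
  add_mem' := by
    rintro _ _ ⟨a, b, ha, hb, rfl⟩ ⟨c, d, hc, hd, rfl⟩
    refine ⟨a * d + b * c, b * d, by positivity, by positivity, ?_⟩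
    rw [div_add_div _ _ (by simpa using hb.ne') (by simpa using hd.ne')]
    simp
  zero_mem' := ⟨0, 1, by simp⟩
  eq_zero_of_mem_of_neg_mem' := by
    rintro _ ⟨a, b, ha, hb, rfl⟩ ⟨c, d, hc, hd, e⟩
    rw [← neg_div, div_eq_div_iff (by simpa using hb.ne') (by simpa using hd.ne'), ← map_neg,
      ← map_mul, ← map_mul] at e
    have e := IsFractionRing.injective R (FractionRing R) e
    have h1 : 0 ≤ a * d := by positivity
    have h2 : 0 ≤ c * b := by positivity
    have h3 : a * d = 0 := by linarith
    rcases mul_eq_zero.1 h3 with rfl | h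
    · simp
    · exact absurd h hd.ne'

instance : HasMemOrNegMem (fractionCone R) where
  mem_or_neg_mem x := by
    obtain ⟨a, b, hb, rfl⟩ := IsFractionRing.div_surjective (A := R) x
    have hb : b ≠ 0 := nonZeroDivisors.ne_zero hb
    rcases lt_or_gt_of_ne hb with hb | hb <;> rcases le_total 0 a with ha | ha
    · exact .inr ⟨a, -b, ha, by linarith, by rw [map_neg, div_neg]⟩
    · exact .inl ⟨-a, -b, by linarith, by linarith, by rw [map_neg, map_neg, neg_div_neg_eq]⟩
    · exact .inl ⟨a, b, ha, hb, rfl⟩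
    · exact .inr ⟨-a, b, by linarith, hb, by rw [map_neg, neg_div]⟩

open Classical in
noncomputable instance : LinearOrder (FractionRing R) :=
  LinearOrder.mkOfAddGroupCone (fractionCone R)

instance : IsOrderedRing (FractionRing R) := IsOrderedRing.mkOfCone (fractionCone R)

instance : IsStrictOrderedRing (FractionRing R) := IsOrderedRing.toIsStrictOrderedRing _

theorem algebraMap_fraction_le {a b : R} :
    algebraMap R (FractionRing R) a ≤ algebraMap R (FractionRing R) b ↔ a ≤ b := by
  have h : ∀ {a b : R}, a ≤ b →
      algebraMap R (FractionRing R) a ≤ algebraMap R (FractionRing R) b := by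
    intro a b h
    exact ⟨b - a, 1, sub_nonneg.2 h, one_pos, by simp⟩
  refine ⟨fun h' => ?_, h⟩
  by_contra! h1
  have := le_antisymm h' (h h1.le)
  exact h1.ne' (IsFractionRing.injective R (FractionRing R) this)

end

end Fractions

end HigherOrderArith

namespace HigherOrderArith
open FinType

/-! ## The order of the numbers of a model -/

namespace Model

variable {M : Model} {Γ : List FinType}

instance rep_lam {σ τ : FinType} (f : Env M Γ → M.C σ → M.C τ)
    [h : Rep (Γ := σ :: Γ) fun e : Env M (σ :: Γ) => f e.2 e.1] : Rep fun e => lam (f e) := by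
  obtain ⟨g, hg, hge⟩ := h.out
  have : (fun e => lam (f e)) = g := by
    funext e
    exact lam_eq fun x => hge x e
  rw [this]
  exact ⟨hg⟩

instance (priority := 50) rep_comp {σ τ : FinType} (f : M.C σ → M.C τ) [Rep (Γ := [σ]) fun e : Env M _ => f e.1]
    (g : Env M Γ → M.C σ) [Rep g] : Rep fun e => f (g e) := by
  obtain ⟨F, hF⟩ := Rep.exists_obj f
  simp only [← hF]
  infer_instance

theorem rep_comp₂ {ρ σ τ : FinType} (f : M.C ρ → M.C σ → M.C τ)
    [Rep (Γ := [σ, ρ]) fun e : Env M _ => f e.2.1 e.1]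
    (g : Env M Γ → M.C ρ) [Rep g] (h : Env M Γ → M.C σ) [Rep h] : Rep fun e => f (g e) (h e) := by
  obtain ⟨F, hF⟩ := Rep.exists_obj₂ f
  simp only [← hF]
  infer_instance

/-- The function `F` with `F 0 = a` and `F (n + 1) = f n (F n)`. -/
noncomputable def prec (f : M.N → M.N → M.N) (a n : M.N) : M.N :=
  recN (lam fun n => lam fun m => f n m) a n

@[simp] theorem prec_zero (f : M.N → M.N → M.N) (a : M.N) : prec f a 0 = a := recN_zero _ _

theorem prec_succ (f : M.N → M.N → M.N)
    [Rep (Γ := [.zero, .zero]) fun e : Env M _ => f e.2.1 e.1] (a n : M.N) :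
    prec f a (n + 1) = f n (prec f a n) := by
  obtain ⟨F, hF⟩ := Rep.exists_obj₂ f
  have : (lam fun n => lam fun m => f n m) = F := lam_eq fun n => (lam_eq fun m => hF n m).symm
  rw [prec, prec, this, recN_succ, hF]

instance rep_prec (f : Env M Γ → M.N → M.N → M.N)
    [Rep (Γ := .zero :: .zero :: Γ) fun e : Env M (_ :: _ :: Γ) => f e.2.2 e.2.1 e.1]
    (a n : Env M Γ → M.N) [Rep a] [Rep n] : Rep fun e => prec (f e) (a e) (n e) := by
  have h : Rep (Γ := Γ) fun e => lam fun n => lam fun m => f e n m := by infer_instance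
  exact inferInstanceAs (Rep fun e => M.cst (.recursor .zero) _ (a e) (n e))

noncomputable def pred (n : M.N) : M.N := prec (fun k _ => k) 0 n

instance rep_pred (f : Env M Γ → M.N) [Rep f] : Rep fun e => pred (f e) :=
  inferInstanceAs (Rep fun e => prec (fun k _ => k) 0 (f e))

@[simp] theorem pred_zero : pred (0 : M.N) = 0 := prec_zero _ _
@[simp] theorem pred_succ (n : M.N) : pred (n + 1) = n := prec_succ (fun k _ => k) _ _

noncomputable instance : Sub M.N := ⟨fun a b => prec (fun _ m => pred m) a b⟩

instance rep_sub (f g : Env M Γ → M.N) [Rep f] [Rep g] : Rep fun e => f e - g e :=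
  inferInstanceAs (Rep fun e => prec (fun _ m => pred m) (f e) (g e))

theorem sub_zero' (a : M.N) : a - 0 = a := prec_zero _ _
theorem sub_succ (a b : M.N) : a - (b + 1) = pred (a - b) := prec_succ (fun _ m => pred m) _ _

theorem succ_sub_succ (a b : M.N) : a + 1 - (b + 1) = a - b :=
  induction_eq (fun b => a + 1 - (b + 1)) (fun b => a - b)
    (by simp only [sub_succ, sub_zero', pred_succ])
    (fun n h => by simp only [sub_succ a n, ← h, sub_succ _ (n + 1)]) b

theorem add_sub_cancel' (a b : M.N) : a + b - b = a :=
  induction_eq (fun b => a + b - b) (fun _ => a) (by simp only [sub_zero', add_zero])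
    (fun n h => by simp only [← add_assoc, succ_sub_succ, h]) b

theorem add_right_cancel' {a b c : M.N} (h : a + c = b + c) : a = b := by
  rw [← add_sub_cancel' a c, h, add_sub_cancel']

theorem lt_add_succ (a b : M.N) : a < a + b + 1 :=
  (qfPred_lt (fun _ => a) (fun b => a + b + 1)).induction (lt_succ.2 (.inr (add_zero a).symm))
    (fun n h => by rw [← add_assoc]; exact lt_succ.2 (.inl h)) b

theorem exists_of_lt {a b : M.N} (h : a < b) : ∃ c, b = a + c + 1 := by
  refine ⟨pred (b - a), ?_⟩
  revert h
  refine ((qfPred_lt (fun _ => a) (fun b => b)).imp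
    (qfPred_eq (fun b => b) (fun b => a + pred (b - a) + 1))).induction
      (fun h => (not_lt_zero _ h).elim) (fun n ih h => ?_) b
  rcases lt_succ.1 h with h | rfl
  · have ih := ih h
    generalize pred (n - a) = c at ih
    subst ih
    rw [show a + c + 1 + 1 = c + 1 + 1 + a by ring, add_sub_cancel', pred_succ]
    ring
  · rw [add_comm a 1, add_sub_cancel', show pred (1 : M.N) = 0 from by
      simpa using pred_succ (0 : M.N), add_zero, add_comm]

theorem lt_iff_exists {a b : M.N} : a < b ↔ ∃ c, b = a + c + 1 :=
  ⟨exists_of_lt, by rintro ⟨c, rfl⟩; exact lt_add_succ a c⟩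

theorem lt_irrefl' (a : M.N) : ¬a < a := by
  intro h
  obtain ⟨c, hc⟩ := exists_of_lt h
  have : 0 + a = (c + 1) + a := by
    rw [zero_add]
    conv_lhs => rw [hc]
    rw [add_comm (c + 1), add_assoc]
  exact succ_ne_zero c (add_right_cancel' this).symm

theorem lt_trans' {a b c : M.N} (h : a < b) (h' : b < c) : a < c := by
  rw [lt_iff_exists] at *
  obtain ⟨d, rfl⟩ := h
  obtain ⟨e, rfl⟩ := h'
  exact ⟨d + 1 + e, by ring⟩

theorem lt_trichotomy' (a b : M.N) : a < b ∨ a = b ∨ b < a := by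
  refine ((qfPred_lt (fun a => a) (fun _ => b)).or ((qfPred_eq (fun a => a) (fun _ => b)).or
    (qfPred_lt (fun _ => b) (fun a => a)))).induction ?_ (fun n ih => ?_) a
  · refine (QFPred.or (qfPred_lt (fun _ => (0 : M.N)) (fun b => b))
      (qfPred_eq (fun _ => (0 : M.N)) (fun b => b))).induction (.inr rfl) (fun n ih => .inl ?_) b
      |>.imp id .inl
    rw [lt_succ]; exact ih
  · rcases ih with h | rfl | h
    · obtain ⟨c, rfl⟩ := exists_of_lt h
      rcases (QFPred.or (qfPred_eq (fun c => c) (fun _ => (0 : M.N)))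
        (qfPred_eq (fun c => c) (fun c => pred c + 1))).induction (.inl rfl)
          (fun n _ => .inr (by rw [pred_succ])) c with h | h
      · exact .inr (.inl (by rw [h, add_zero]))
      · refine .inl ?_
        rw [h, show n + (pred c + 1) + 1 = n + 1 + pred c + 1 by ring]
        exact lt_add_succ _ _
    · exact .inr (.inr (lt_succ.2 (.inr rfl)))
    · exact .inr (.inr (lt_succ.2 (.inl h)))

instance : LE M.N := ⟨fun a b => ∃ c, b = a + c⟩

theorem zero_or_succ (a : M.N) : a = 0 ∨ ∃ b, a = b + 1 := by
  rcases lt_trichotomy' a 0 with h | h | h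
  · exact (not_lt_zero _ h).elim
  · exact .inl h
  · obtain ⟨c, rfl⟩ := exists_of_lt h
    exact .inr ⟨c, by rw [zero_add]⟩

theorem le_iff_lt_or_eq' {a b : M.N} : a ≤ b ↔ a < b ∨ a = b := by
  constructor
  · rintro ⟨c, rfl⟩
    rcases zero_or_succ c with rfl | ⟨d, rfl⟩
    · exact .inr (add_zero a).symm
    · exact .inl (by rw [← add_assoc]; exact lt_add_succ a d)
  · rintro (h | rfl)
    · obtain ⟨c, rfl⟩ := exists_of_lt h
      exact ⟨c + 1, by ring⟩
    · exact ⟨0, by rw [add_zero]⟩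

open Classical in
noncomputable instance : LinearOrder M.N where
  le_refl a := ⟨0, (add_zero a).symm⟩
  le_trans := by
    rintro a b c ⟨d, rfl⟩ ⟨e, rfl⟩
    exact ⟨d + e, by ring⟩
  lt_iff_le_not_ge a b := by
    rw [le_iff_lt_or_eq', le_iff_lt_or_eq']
    constructor
    · intro h
      refine ⟨.inl h, ?_⟩
      rintro (h' | rfl)
      · exact lt_irrefl' _ (lt_trans' h h')
      · exact lt_irrefl' _ h
    · rintro ⟨h | rfl, h'⟩
      · exact h
      · exact (h' (.inr rfl)).elim
  le_antisymm a b h h' := by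
    rw [le_iff_lt_or_eq'] at h h'
    rcases h with h | h
    · rcases h' with h' | h'
      · exact (lt_irrefl' _ (lt_trans' h h')).elim
      · exact h'.symm
    · exact h
  le_total a b := by
    rw [le_iff_lt_or_eq', le_iff_lt_or_eq']
    rcases lt_trichotomy' a b with h | h | h
    · exact .inl (.inl h)
    · exact .inl (.inr h)
    · exact .inr (.inl h)
  toDecidableLE := Classical.decRel _

instance : CanonicallyOrderedAdd M.N where
  exists_add_of_le := id
  le_self_add _ b := ⟨b, rfl⟩
  le_add_self _ b := ⟨b, add_comm _ _⟩

instance : IsOrderedCancelAddMonoid M.N where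
  add_le_add_left := by
    rintro a b ⟨c, rfl⟩ d
    exact ⟨c, by ring⟩
  le_of_add_le_add_left := by
    rintro a b c ⟨d, h⟩
    refine ⟨d, add_right_cancel' (c := a) ?_⟩
    rw [add_comm, h]; ring

instance : Nontrivial M.N := ⟨0, 0 + 1, (succ_ne_zero 0).symm⟩

theorem mul_lt_mul_left' {a b c : M.N} (hc : 0 < c) (h : a < b) : c * a < c * b := by
  rw [lt_iff_exists] at *
  obtain ⟨d, rfl⟩ := hc
  obtain ⟨e, rfl⟩ := h
  exact ⟨d * e + d + e, by ring⟩

instance : IsStrictOrderedRing M.N where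
  zero_le_one := ⟨1, (zero_add 1).symm⟩
  mul_lt_mul_of_pos_left _ hc _ _ h := mul_lt_mul_left' hc h
  mul_lt_mul_of_pos_right c hc a b h := by
    rw [mul_comm a, mul_comm b]; exact mul_lt_mul_left' hc h

instance : OrderedSub M.N where
  tsub_le_iff_right a b c := by
    rcases le_total a b with ⟨d, rfl⟩ | ⟨d, rfl⟩
    · have : a - (a + d) = 0 := by
        refine induction_eq (fun a => a - (a + d)) (fun _ => 0) ?_ (fun n h => ?_) a
        · refine induction_eq (fun d => 0 - (0 + d)) (fun _ => 0) ?_ (fun n h => ?_) d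
          · simp only [add_zero, sub_zero']
          · beta_reduce at h ⊢
            rw [← add_assoc, sub_succ, h, pred_zero]
        · beta_reduce at h ⊢
          rw [show n + 1 + d = n + d + 1 by ring, succ_sub_succ, h]
      rw [this]
      exact iff_of_true ⟨c, (zero_add c).symm⟩ ⟨d + c, by ring⟩
    · rw [add_comm b d, add_sub_cancel']
      exact (add_le_add_iff_right b).symm

theorem lt_succ_iff {a b : M.N} : a < b + 1 ↔ a ≤ b := by
  rw [lt_succ, le_iff_lt_or_eq]

theorem succ_le_iff {a b : M.N} : a + 1 ≤ b ↔ a < b := by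
  rw [← not_lt, lt_succ_iff, not_le]

end Model
end HigherOrderArith

namespace HigherOrderArith
open FinType

/-! ## Decidable predicates of a model -/

/-- `P` has a representable characteristic function. -/
class Dec {M : Model} {Γ : List FinType} (P : Env M Γ → Prop) : Prop where
  out : ∃ f : Env M Γ → M.N, Rep f ∧ ∀ e, P e ↔ f e = 0

theorem Rep.specialize {M : Model} {Γ : List FinType} {σ τ : FinType}
    (f : Env M (σ :: Γ) → M.C τ) [h : Rep f] (e : Env M Γ) :
    Rep (Γ := [σ]) fun x : Env M [σ] => f (x.1, e) := by
  obtain ⟨g, -, hg⟩ := h.out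
  simp only [← hg]
  infer_instance

namespace Dec

variable {M : Model} {Γ : List FinType}

instance eq (f g : Env M Γ → M.N) [Rep f] [Rep g] : Dec fun e => f e = g e :=
  ⟨fun e => (f e - g e) + (g e - f e), inferInstance, fun e => by
    simp only [add_eq_zero, tsub_eq_zero_iff_le]
    exact le_antisymm_iff⟩

instance le (f g : Env M Γ → M.N) [Rep f] [Rep g] : Dec fun e => f e ≤ g e :=
  ⟨fun e => f e - g e, inferInstance, fun e => by simp only [tsub_eq_zero_iff_le]⟩

instance lt (f g : Env M Γ → M.N) [Rep f] [Rep g] : Dec fun e => f e < g e :=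
  ⟨fun e => f e + 1 - g e, inferInstance, fun e => by
    simp only [tsub_eq_zero_iff_le, Model.succ_le_iff]⟩

instance const (p : Prop) : Dec fun _ : Env M Γ => p := by
  by_cases h : p
  · exact ⟨fun _ => 0, inferInstance, fun _ => by simp [h]⟩
  · exact ⟨fun _ => 1, inferInstance, fun _ => by simp [h]⟩

instance not (P : Env M Γ → Prop) [h : Dec P] : Dec fun e => ¬P e := by
  obtain ⟨f, hf, h⟩ := h.out
  refine ⟨fun e => 1 - f e, inferInstance, fun e => ?_⟩
  rw [h, tsub_eq_zero_iff_le, ← zero_add (1 : M.N), Model.succ_le_iff, pos_iff_ne_zero]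

instance and (P Q : Env M Γ → Prop) [h : Dec P] [h' : Dec Q] : Dec fun e => P e ∧ Q e := by
  obtain ⟨f, hf, h⟩ := h.out
  obtain ⟨g, hg, h'⟩ := h'.out
  exact ⟨fun e => f e + g e, inferInstance, fun e => by rw [h, h', add_eq_zero]⟩

instance or (P Q : Env M Γ → Prop) [h : Dec P] [h' : Dec Q] : Dec fun e => P e ∨ Q e := by
  obtain ⟨f, hf, h⟩ := h.out
  obtain ⟨g, hg, h'⟩ := h'.out
  exact ⟨fun e => f e * g e, inferInstance, fun e => by rw [h, h', mul_eq_zero]⟩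

instance imp (P Q : Env M Γ → Prop) [Dec P] [Dec Q] : Dec fun e => P e → Q e := by
  simp only [imp_iff_not_or]
  infer_instance

instance (priority := 100) weaken {σ : FinType} (P : Env M Γ → Prop) [h : Dec P] : Dec (Γ := σ :: Γ) fun e => P e.2 := by
  obtain ⟨f, hf, h⟩ := h.out
  exact ⟨fun e => f e.2, Rep.weaken f, fun e => h e.2⟩

instance (priority := 50) comp {σ : FinType} (P : M.C σ → Prop) [h : Dec (Γ := [σ]) fun e : Env M _ => P e.1]
    (g : Env M Γ → M.C σ) [Rep g] : Dec fun e => P (g e) := by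
  obtain ⟨f, hf, h⟩ := h.out
  exact ⟨fun e => f (g e, ()), Model.rep_comp (fun x => f (x, ())) g, fun e => h (g e, ())⟩

/-- Induction for decidable predicates. -/
theorem induction {P : M.N → Prop} [h : Dec (Γ := [.zero]) fun e : Env M _ => P e.1] (h0 : P 0)
    (hs : ∀ n, P n → P (n + 1)) (n : M.N) : P n := by
  obtain ⟨f, hf, h⟩ := h.out
  have h1 : ∀ n, P n ↔ f (n, ()) = 0 := fun n => h (n, ())
  rw [h1]
  exact Model.induction_eq (fun n => f (n, ())) (fun _ => 0) ((h1 0).1 h0)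
    (fun n hn => (h1 _).1 (hs n ((h1 n).2 hn))) n

end Dec

namespace Model

variable {M : Model} {Γ : List FinType} {τ : FinType}

instance rep_ite (P : Env M Γ → Prop) [h : Dec P] (inst : ∀ e, Decidable (P e))
    (f g : Env M Γ → M.N) [Rep f] [Rep g] : Rep fun e => @ite _ (P e) (inst e) (f e) (g e) := by
  obtain ⟨p, hp, h⟩ := h.out
  have : (fun e => @ite _ (P e) (inst e) (f e) (g e)) =
      fun e => f e * (1 - p e) + g e * (1 - (1 - p e)) := by
    funext e
    by_cases hP : P e
    · simp [hP, (h e).1 hP]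
    · have : 1 - p e = 0 := by
        rw [tsub_eq_zero_iff_le, ← zero_add (1 : M.N), succ_le_iff, pos_iff_ne_zero]
        exact fun h' => hP ((h e).2 h')
      simp [hP, this]
  rw [this]
  infer_instance

instance dec_ball (P : Env M Γ → M.N → Prop) (n : Env M Γ → M.N)
    [h : Dec (Γ := .zero :: Γ) fun e : Env M (_ :: Γ) => P e.2 e.1] [Rep n] :
    Dec fun e => ∀ i, i < n e → P e i := by
  obtain ⟨p, hp, h⟩ := h.out
  have h0 : Rep (Γ := .zero :: .zero :: Γ) fun e : Env M (_ :: _ :: Γ) => p (e.2.1, e.2.2) :=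
    Rep.weaken p
  refine ⟨fun e => prec (fun i m => m + p (i, e)) 0 (n e), inferInstance, fun e => ?_⟩
  have h1 : Rep (Γ := [.zero]) fun x : Env M [.zero] => p (x.1, e) := Rep.specialize p e
  obtain ⟨F, hF⟩ := Rep.exists_obj fun i => p (i, e)
  have h3 : ∀ i, P e i ↔ F i = 0 := fun i => by rw [hF]; exact h (i, e)
  simp only [h3, ← hF]
  generalize n e = n
  constructor
  · intro hn
    refine (Dec.induction (P := fun m => m ≤ n → prec (fun i m => m + F i) 0 m = 0)
      (fun _ => prec_zero _ _) (fun m ih hm => ?_) n) le_rfl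
    rw [prec_succ, ih (le_trans le_self_add hm), hn m (succ_le_iff.1 hm), add_zero]
  · intro hn i hi
    by_contra hne
    refine (Dec.induction (P := fun m => i < m → prec (fun i m => m + F i) 0 m ≠ 0)
      (fun h => (not_lt_zero _ h).elim) (fun m ih hm => ?_) n) hi hn
    rw [prec_succ]
    intro h0
    rw [add_eq_zero] at h0
    rcases lt_succ.1 hm with h | rfl
    · exact ih h h0.1
    · exact hne h0.2

instance dec_bex (P : Env M Γ → M.N → Prop) (n : Env M Γ → M.N)
    [h : Dec (Γ := .zero :: Γ) fun e : Env M (_ :: Γ) => P e.2 e.1] [Rep n] :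
    Dec fun e => ∃ i, i < n e ∧ P e i := by
  have : Dec fun e => ¬∀ i, i < n e → ¬P e i := inferInstance
  simpa only [not_forall, not_not, exists_prop] using this

theorem exists_least (P : M.N → Prop) [Dec (Γ := [.zero]) fun e : Env M _ => P e.1]
    (h : ∃ n, P n) : ∃ n, P n ∧ ∀ m, m < n → ¬P m := by
  by_contra! h'
  obtain ⟨n, hn⟩ := h
  have : Dec (Γ := [.zero, .zero]) fun e : Env M _ => P e.1 :=
    Dec.comp P fun e : Env M [.zero, .zero] => e.1
  have key := Dec.induction (P := fun n => ∀ m, m < n → ¬P m) (fun m hm => (not_lt_zero _ hm).elim)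
    (fun n ih m hm => by
      rcases lt_succ.1 hm with h1 | rfl
      · exact ih m h1
      · intro hP
        obtain ⟨k, hk, hkP⟩ := h' m hP
        exact ih k hk hkP) (n + 1)
  exact key n (lt_succ.2 (.inr rfl)) hn

open Classical in
/-- The least number `i < n` with `P i`, and `n` if there is none. -/
noncomputable def find (P : M.N → Prop) (n : M.N) : M.N :=
  prec (fun k m => if m < k ∨ P k then m else k + 1) 0 n

instance rep_find (P : Env M Γ → M.N → Prop) (n : Env M Γ → M.N)
    [h : Dec (Γ := .zero :: Γ) fun e : Env M (_ :: Γ) => P e.2 e.1] [Rep n] :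
    Rep fun e => find (P e) (n e) := by
  classical
  have : Dec (Γ := .zero :: .zero :: Γ) fun e : Env M (_ :: _ :: Γ) => P e.2.2 e.2.1 :=
    Dec.weaken fun e : Env M (.zero :: Γ) => P e.2 e.1
  exact inferInstanceAs (Rep fun e => prec (fun k m => if m < k ∨ P e k then m else k + 1) 0 (n e))

theorem find_spec (P : M.N → Prop) [Dec (Γ := [.zero]) fun e : Env M _ => P e.1] (n : M.N) :
    (find P n < n ∧ P (find P n)) ∨ (find P n = n ∧ ∀ i, i < n → ¬P i) := by
  classical
  have h1 : Dec (Γ := [.zero, .zero]) fun e : Env M _ => P e.1 :=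
    Dec.comp P fun e : Env M [.zero, .zero] => e.1
  have h2 : Dec (Γ := [.zero, .zero]) fun e : Env M _ => P e.2.1 :=
    Dec.comp P fun e : Env M [.zero, .zero] => e.2.1
  have h3 : Dec (Γ := [.zero]) fun e : Env M _ => P (find P e.1) :=
    Dec.comp P fun e : Env M [.zero] => find P e.1
  refine Dec.induction (P := fun n => (find P n < n ∧ P (find P n)) ∨
    (find P n = n ∧ ∀ i, i < n → ¬P i)) (.inr ⟨prec_zero _ _, fun i hi => (not_lt_zero _ hi).elim⟩)
    (fun n ih => ?_) n
  have hs : find P (n + 1) = if find P n < n ∨ P n then find P n else n + 1 := prec_succ _ _ _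
  rw [hs]
  rcases ih with ⟨h, h'⟩ | ⟨h, h'⟩
  · rw [if_pos (.inl h)]
    exact .inl ⟨lt_succ.2 (.inl h), h'⟩
  · by_cases hP : P n
    · rw [if_pos (.inr hP), h]
      exact .inl ⟨lt_succ.2 (.inr rfl), hP⟩
    · rw [if_neg (by simp [h, hP])]
      refine .inr ⟨rfl, fun i hi => ?_⟩
      rcases lt_succ.1 hi with h1 | rfl
      · exact h' i h1
      · exact hP

theorem find_of_exists (P : M.N → Prop) [Dec (Γ := [.zero]) fun e : Env M _ => P e.1] {n : M.N}
    (h : ∃ i, i < n ∧ P i) : find P n < n ∧ P (find P n) := by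
  refine (find_spec P n).resolve_right ?_
  rintro ⟨-, h'⟩
  obtain ⟨i, hi, hP⟩ := h
  exact h' i hi hP

/-! ### Pairs -/

/-- `0 + 1 + ⋯ + n`. -/
noncomputable def tri (n : M.N) : M.N := prec (fun k m => m + k + 1) 0 n

instance rep_tri (f : Env M Γ → M.N) [Rep f] : Rep fun e => tri (f e) :=
  inferInstanceAs (Rep fun e => prec (fun k m => m + k + 1) 0 (f e))

theorem tri_zero : tri (0 : M.N) = 0 := prec_zero _ _
theorem tri_succ (n : M.N) : tri (n + 1) = tri n + n + 1 := prec_succ (fun k m => m + k + 1) _ _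

theorem two_mul_tri (n : M.N) : tri n + tri n = n * n + n :=
  induction_eq (fun n => tri n + tri n) (fun n => n * n + n) (by simp [tri_zero])
    (fun n h => by
      rw [tri_succ, show tri n + n + 1 + (tri n + n + 1) = (tri n + tri n) + n + n + 1 + 1 by ring, h]
      ring) n

/-- Cantor's pairing function. -/
noncomputable def pair (a b : M.N) : M.N := tri (a + b) + a

instance rep_pair (f g : Env M Γ → M.N) [Rep f] [Rep g] : Rep fun e => pair (f e) (g e) :=
  inferInstanceAs (Rep fun e => tri (f e + g e) + f e)

theorem pair_add_pair (a b : M.N) :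
    pair a b + pair a b = (a + b) * (a + b) + (a + a + a) + b := by
  rw [pair, show tri (a + b) + a + (tri (a + b) + a) = (tri (a + b) + tri (a + b)) + a + a by ring,
    two_mul_tri]
  ring

theorem tri_mono {a b : M.N} (h : a ≤ b) : tri a ≤ tri b := by
  by_contra! h'
  have := add_lt_add h' h'
  rw [two_mul_tri, two_mul_tri] at this
  exact absurd (add_le_add (mul_le_mul' h h) h) this.not_ge

theorem pair_inj {a b c d : M.N} (h : pair a b = pair c d) : a = c ∧ b = d := by
  have key : ∀ {a b c d : M.N}, pair a b = pair c d → ¬a + b < c + d := by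
    intro a b c d h h'
    have h1 := tri_mono (succ_le_iff.2 h')
    rw [tri_succ] at h1
    have h2 : pair a b < pair c d := by
      calc pair a b ≤ tri (a + b) + (a + b) := by rw [pair]; gcongr; exact le_self_add
        _ < tri (a + b) + (a + b) + 1 := lt_succ.2 (.inr rfl)
        _ ≤ tri (c + d) := h1
        _ ≤ pair c d := le_self_add
    exact h2.ne h
  have hs : a + b = c + d := le_antisymm (not_lt.1 (key h.symm)) (not_lt.1 (key h))
  have h1 : a = c := by
    rw [pair, pair, hs] at h
    exact add_left_cancel h
  subst h1
  exact ⟨rfl, add_left_cancel hs⟩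

theorem pair_surj (c : M.N) : ∃ a, a < c + 1 ∧ ∃ b, b < c + 1 ∧ pair a b = c := by
  refine Dec.induction (P := fun c => ∃ a, a < c + 1 ∧ ∃ b, b < c + 1 ∧ pair a b = c)
    ⟨0, by simp, 0, by simp, by simp [pair, tri_zero]⟩ ?_ c
  rintro c ⟨a, ha, b, hb, h⟩
  rcases zero_or_succ b with rfl | ⟨b, rfl⟩
  · refine ⟨0, by simp, a + 1, by simpa using ha, ?_⟩
    rw [← h]
    simp [pair, tri_succ]
  · refine ⟨a + 1, by simpa using ha, b, lt_succ.2 (.inl (lt_trans (lt_succ.2 (.inr rfl)) hb)), ?_⟩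
    rw [← h, pair, pair, show a + 1 + b = a + (b + 1) by ring]
    ring

noncomputable def fst (c : M.N) : M.N := find (fun a => ∃ b, b < c + 1 ∧ pair a b = c) (c + 1)
noncomputable def snd (c : M.N) : M.N := find (fun b => pair (fst c) b = c) (c + 1)

instance rep_fst (f : Env M Γ → M.N) [Rep f] : Rep fun e => fst (f e) :=
  inferInstanceAs (Rep fun e => find (fun a => ∃ b, b < f e + 1 ∧ pair a b = f e) (f e + 1))

instance rep_snd (f : Env M Γ → M.N) [Rep f] : Rep fun e => snd (f e) :=
  inferInstanceAs (Rep fun e => find (fun b => pair (fst (f e)) b = f e) (f e + 1))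

theorem pair_fst_snd (c : M.N) : pair (fst c) (snd c) = c := by
  obtain ⟨-, b, hb, h⟩ := find_of_exists (fun a => ∃ b, b < c + 1 ∧ pair a b = c) (pair_surj c)
  exact (find_of_exists (fun b => pair (fst c) b = c) ⟨b, hb, h⟩).2

@[simp] theorem fst_pair (a b : M.N) : fst (pair a b) = a := (pair_inj (pair_fst_snd _)).1
@[simp] theorem snd_pair (a b : M.N) : snd (pair a b) = b := (pair_inj (pair_fst_snd _)).2

/-- The integer part of `n / 2`. -/
noncomputable def half (n : M.N) : M.N := find (fun i => n = i + i ∨ n = i + i + 1) (n + 1)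

instance rep_half (f : Env M Γ → M.N) [Rep f] : Rep fun e => half (f e) :=
  inferInstanceAs (Rep fun e => find (fun i => f e = i + i ∨ f e = i + i + 1) (f e + 1))

theorem eq_half (n : M.N) : n = half n + half n ∨ n = half n + half n + 1 := by
  refine (find_of_exists (fun i => n = i + i ∨ n = i + i + 1) ?_).2
  refine Dec.induction (P := fun n => ∃ i, i < n + 1 ∧ (n = i + i ∨ n = i + i + 1))
    ⟨0, by simp, by simp⟩ ?_ n
  rintro n ⟨i, hi, h | h⟩
  · exact ⟨i, lt_succ.2 (.inl hi), .inr (by rw [← h])⟩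
  · exact ⟨i + 1, by simpa using hi, .inl (by rw [h]; ring)⟩

theorem add_self_inj {a b : M.N} (h : a + a = b + b) : a = b := by
  rcases lt_trichotomy a b with h' | h' | h'
  · exact absurd h (add_lt_add h' h').ne
  · exact h'
  · exact absurd h (add_lt_add h' h').ne'

theorem add_self_ne {a b : M.N} : a + a ≠ b + b + 1 := by
  intro h
  rcases lt_or_ge b a with h' | h'
  · obtain ⟨c, rfl⟩ := exists_of_lt h'
    rw [show b + c + 1 + (b + c + 1) = b + b + 1 + (c + c) + 1 by ring] at h
    exact absurd h (lt_add_succ _ _).ne'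
  · exact absurd h (lt_succ.2 (le_iff_lt_or_eq.1 (add_le_add h' h'))).ne

end Model
end HigherOrderArith

namespace HigherOrderArith
open FinType

/-! ## The field of fractions of the numbers of a model -/

namespace Diff

variable {N : Type*} [CommSemiring N] [LinearOrder N] [IsStrictOrderedRing N]

/-- The embedding of `N` into its ring of differences. -/
def ofSemiring : N →+* Diff N where
  toFun a := mk a 0
  map_one' := rfl
  map_mul' a b := by simp [mk_mul_mk]
  map_zero' := rfl
  map_add' a b := by simp [mk_add_mk]

theorem mk_eq_sub (a b : N) : mk a b = ofSemiring a - ofSemiring b := by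
  change _ = mk a 0 - mk b 0
  rw [sub_eq_add_neg, neg_mk, mk_add_mk, add_zero, zero_add]

theorem exists_fraction [CanonicallyOrderedAdd N] (x : FractionRing (Diff N)) :
    ∃ a b c : N, c ≠ 0 ∧ x = (algebraMap (Diff N) (FractionRing (Diff N)) (ofSemiring a) -
      algebraMap (Diff N) (FractionRing (Diff N)) (ofSemiring b)) /
      algebraMap (Diff N) (FractionRing (Diff N)) (ofSemiring c) := by
  have key : ∀ z : Diff N, ∃ a b : N, z = ofSemiring a - ofSemiring b :=
    Diff.ind fun a b => ⟨a, b, mk_eq_sub a b⟩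
  obtain ⟨z, w, hw, rfl⟩ := IsFractionRing.div_surjective (A := Diff N) x
  obtain ⟨c, hc⟩ := exists_eq w
  have hc0 : c ≠ 0 := by
    rintro rfl
    refine nonZeroDivisors.ne_zero hw ?_
    rcases hc with rfl | rfl <;> simp [← zero_def]
  rcases hc with rfl | rfl
  · obtain ⟨a, b, hab⟩ := key z
    refine ⟨a, b, c, hc0, ?_⟩
    rw [← map_sub, ← hab]
    rfl
  · obtain ⟨a, b, hab⟩ := key (-z)
    refine ⟨a, b, c, hc0, ?_⟩
    rw [← map_sub, ← hab, map_neg, map_neg, ← neg_div_neg_eq, neg_neg, neg_div]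
    exact (neg_div _ _).symm

end Diff

/-- The fractions of a model. -/
def Model.K (M : Model) : Type := FractionRing (Diff M.N)

namespace Model

variable {M : Model} {Γ : List FinType} {σ τ : FinType}

noncomputable instance : Field M.K := inferInstanceAs (Field (FractionRing (Diff M.N)))
noncomputable instance : LinearOrder M.K := inferInstanceAs (LinearOrder (FractionRing (Diff M.N)))
instance : IsStrictOrderedRing M.K :=
  inferInstanceAs (IsStrictOrderedRing (FractionRing (Diff M.N)))

noncomputable def castHom : M.N →+* M.K :=
  (algebraMap (Diff M.N) (FractionRing (Diff M.N))).comp Diff.ofSemiring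

@[coe] noncomputable def cast (n : M.N) : M.K := castHom n

noncomputable instance : Coe M.N M.K := ⟨cast⟩

@[simp, norm_cast] theorem cast_zero : ((0 : M.N) : M.K) = 0 := map_zero castHom
@[simp, norm_cast] theorem cast_one : ((1 : M.N) : M.K) = 1 := map_one castHom
@[simp, norm_cast] theorem cast_add (a b : M.N) : ((a + b : M.N) : M.K) = a + b :=
  map_add castHom a b
@[simp, norm_cast] theorem cast_mul (a b : M.N) : ((a * b : M.N) : M.K) = a * b :=
  map_mul castHom a b

@[simp, norm_cast] theorem cast_le {a b : M.N} : (a : M.K) ≤ b ↔ a ≤ b := by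
  change algebraMap (Diff M.N) (FractionRing (Diff M.N)) (Diff.mk a 0) ≤
    algebraMap (Diff M.N) (FractionRing (Diff M.N)) (Diff.mk b 0) ↔ _
  rw [algebraMap_fraction_le, Diff.mk_le_mk, add_zero, add_zero]

@[simp, norm_cast] theorem cast_lt {a b : M.N} : (a : M.K) < b ↔ a < b := by
  rw [← not_le, cast_le, not_le]

@[simp, norm_cast] theorem cast_inj {a b : M.N} : (a : M.K) = b ↔ a = b := by
  simp only [le_antisymm_iff, cast_le]

theorem cast_nonneg (a : M.N) : (0 : M.K) ≤ a := by
  rw [← cast_zero, cast_le]; exact zero_le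

theorem cast_add_one_pos (a : M.N) : (0 : M.K) < a + 1 := by
  have := cast_nonneg a
  linarith

theorem cast_sub {a b : M.N} (h : b ≤ a) : ((a - b : M.N) : M.K) = a - b := by
  rw [eq_sub_iff_add_eq, ← cast_add, tsub_add_cancel_of_le h]

theorem exists_fraction (x : M.K) : ∃ a b c : M.N, x = ((a : M.K) - b) / (c + 1) := by
  obtain ⟨a, b, c, hc, h⟩ := Diff.exists_fraction (N := M.N) x
  obtain ⟨d, rfl⟩ := (zero_or_succ c).resolve_left hc
  refine ⟨a, b, d, ?_⟩
  rw [← cast_one, ← cast_add]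
  exact h

theorem exists_cast_gt (x : M.K) : ∃ n : M.N, x < n := by
  obtain ⟨a, b, c, rfl⟩ := exists_fraction x
  refine ⟨a + 1, ?_⟩
  rw [div_lt_iff₀ (cast_add_one_pos c), cast_add, cast_one]
  nlinarith [cast_nonneg a, cast_nonneg b, cast_nonneg c, mul_nonneg (cast_nonneg a) (cast_nonneg c)]

/-! ### Powers of two -/

noncomputable def pow2 (n : M.N) : M.N := prec (fun _ m => m + m) 1 n

instance rep_pow2 (f : Env M Γ → M.N) [Rep f] : Rep fun e => pow2 (f e) :=
  inferInstanceAs (Rep fun e => prec (fun _ m => m + m) 1 (f e))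

@[simp] theorem pow2_zero : pow2 (0 : M.N) = 1 := prec_zero _ _
theorem pow2_succ (n : M.N) : pow2 (n + 1) = pow2 n + pow2 n := prec_succ (fun _ m => m + m) _ _

theorem lt_pow2 (n : M.N) : n < pow2 n := by
  refine Dec.induction (P := fun n => n < pow2 n) (by simp) (fun n h => ?_) n
  rw [pow2_succ]
  calc n + 1 ≤ pow2 n := succ_le_iff.2 h
    _ < pow2 n + pow2 n := lt_add_of_pos_left _ (lt_of_le_of_lt zero_le h)

theorem pow2_add (m n : M.N) : pow2 (m + n) = pow2 m * pow2 n :=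
  induction_eq (fun n => pow2 (m + n)) (fun n => pow2 m * pow2 n) (by simp)
    (fun n h => by
      rw [← add_assoc, pow2_succ, pow2_succ, h, mul_add]) n

/-- `2 ^ (-n)`. -/
noncomputable def tw (n : M.N) : M.K := ((pow2 n : M.N) : M.K)⁻¹

theorem pow2_pos (n : M.N) : (0 : M.K) < (pow2 n : M.N) := by
  rw [← cast_zero, cast_lt]; exact lt_of_le_of_lt zero_le (lt_pow2 n)

theorem tw_pos (n : M.N) : 0 < tw n := inv_pos.2 (pow2_pos n)
theorem pow2_mul_tw (n : M.N) : ((pow2 n : M.N) : M.K) * tw n = 1 := mul_inv_cancel₀ (pow2_pos n).ne'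
@[simp] theorem tw_zero : tw (0 : M.N) = 1 := by simp [tw]
theorem tw_add (m n : M.N) : tw (m + n) = tw m * tw n := by simp [tw, pow2_add, mul_comm]
theorem tw_one : tw (1 : M.N) = 1 / 2 := by
  have : pow2 (1 : M.N) = 1 + 1 := by simpa using pow2_succ (0 : M.N)
  rw [tw, this, cast_add, cast_one]; norm_num
theorem tw_succ (n : M.N) : tw (n + 1) = tw n / 2 := by rw [tw_add, tw_one]; ring
theorem tw_le_one (n : M.N) : tw n ≤ 1 := by
  refine inv_le_one_of_one_le₀ ?_
  rw [← cast_one, cast_le, ← zero_add (1 : M.N), succ_le_iff]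
  exact lt_of_le_of_lt zero_le (lt_pow2 n)
theorem tw_anti {m n : M.N} (h : m ≤ n) : tw n ≤ tw m := by
  obtain ⟨k, rfl⟩ := h
  rw [tw_add]
  exact mul_le_of_le_one_right (tw_pos m).le (tw_le_one k)

theorem cast_mul_tw_lt_one (n : M.N) : (n : M.K) * tw n < 1 := by
  rw [← pow2_mul_tw n]
  exact mul_lt_mul_of_pos_right (cast_lt.2 (lt_pow2 n)) (tw_pos n)

theorem exists_tw_lt {x : M.K} (hx : 0 < x) : ∃ n, tw n < x := by
  obtain ⟨n, hn⟩ := exists_cast_gt x⁻¹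
  refine ⟨n, ?_⟩
  have h1 := cast_mul_tw_lt_one n
  have h2 := tw_pos n
  rw [inv_lt_iff_one_lt_mul₀ hx] at hn
  nlinarith

/-! ### Codes of fractions -/

open Classical in
noncomputable def codePos (c : M.N) : M.N :=
  if half (fst c) + half (fst c) = fst c then half (fst c) else 0
open Classical in
noncomputable def codeNeg (c : M.N) : M.N :=
  if half (fst c) + half (fst c) = fst c then 0 else half (fst c) + 1

instance rep_codePos (f : Env M Γ → M.N) [Rep f] : Rep fun e => codePos (f e) := by
  simp only [codePos]; infer_instance
instance rep_codeNeg (f : Env M Γ → M.N) [Rep f] : Rep fun e => codeNeg (f e) := by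
  simp only [codeNeg]; infer_instance

/-- The fraction with the code `c`. -/
noncomputable def qv (c : M.N) : M.K := ((codePos c : M.N) - (codeNeg c : M.N)) / ((snd c : M.N) + 1)

theorem code_iff {c u v b : M.N} :
    (∃ a, c + c = (a + b) * (a + b) + (a + a + a) + b ∧
      ((a = u + u ∧ v = 0) ∨ (a + 1 = v + v ∧ u = 0))) ↔
      u = codePos c ∧ v = codeNeg c ∧ b = snd c := by
  have h0 : ∀ a, c + c = (a + b) * (a + b) + (a + a + a) + b ↔ a = fst c ∧ b = snd c := by
    intro a
    rw [← pair_add_pair]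
    constructor
    · intro h
      rw [← pair_fst_snd c] at h
      have := pair_inj (add_self_inj h)
      exact ⟨this.1.symm, this.2.symm⟩
    · rintro ⟨rfl, rfl⟩
      rw [pair_fst_snd]
  simp only [h0, and_assoc, exists_eq_left, codePos, codeNeg]
  have hh := eq_half (fst c)
  generalize fst c = a at hh ⊢
  split_ifs with h
  · constructor
    · rintro ⟨h1, ⟨h2, h3⟩ | ⟨h2, h3⟩⟩
      · exact ⟨add_self_inj (h2.symm.trans h.symm), h3, h1⟩
      · refine absurd h2.symm ?_
        rw [← h]
        exact add_self_ne
    · rintro ⟨rfl, rfl, rfl⟩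
      exact ⟨rfl, .inl ⟨h.symm, rfl⟩⟩
  · have hh := hh.resolve_left (Ne.symm h)
    constructor
    · rintro ⟨h1, ⟨h2, h3⟩ | ⟨h2, h3⟩⟩
      · rw [h2] at hh
        exact (add_self_ne hh).elim
      · refine ⟨h3, add_self_inj ?_, h1⟩
        rw [← h2]
        conv_lhs => rw [hh]
        ring
    · rintro ⟨rfl, rfl, rfl⟩
      refine ⟨rfl, .inr ⟨?_, rfl⟩⟩
      conv_lhs => rw [hh]
      ring

open Classical in
/-- A code of the fraction `(u - v) / (b + 1)`. -/
noncomputable def encode (u v b : M.N) : M.N :=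
  if v ≤ u then pair ((u - v) + (u - v)) b else pair (pred ((v - u) + (v - u))) b

instance rep_encode (u v b : Env M Γ → M.N) [Rep u] [Rep v] [Rep b] :
    Rep fun e => encode (u e) (v e) (b e) := by
  simp only [encode]; infer_instance

theorem qv_encode (u v b : M.N) : qv (encode u v b) = ((u : M.K) - v) / (b + 1) := by
  rw [encode]
  split_ifs with h
  · obtain ⟨h1, h2, h3⟩ := code_iff.1 ⟨_, pair_add_pair ((u - v) + (u - v)) b, .inl ⟨rfl, rfl⟩⟩
    rw [qv, ← h1, ← h2, ← h3, cast_sub h, cast_zero, sub_zero]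
  · rw [not_le] at h
    have hp : pred ((v - u) + (v - u)) + 1 = (v - u) + (v - u) := by
      obtain ⟨d, hd⟩ := (zero_or_succ ((v - u) + (v - u))).resolve_left (by
        rw [add_eq_zero, tsub_eq_zero_iff_le]; exact fun h' => h'.1.not_gt h)
      rw [hd, pred_succ]
    obtain ⟨h1, h2, h3⟩ := code_iff.1 ⟨_, pair_add_pair (pred ((v - u) + (v - u))) b, .inr ⟨hp, rfl⟩⟩
    rw [qv, ← h1, ← h2, ← h3, cast_sub h.le, cast_zero, zero_sub, neg_sub]

end Model

/-- `f` is given by codes. -/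
class RepK {M : Model} {Γ : List FinType} (f : Env M Γ → M.K) : Prop where
  out : ∃ c : Env M Γ → M.N, Rep c ∧ ∀ e, Model.qv (c e) = f e

namespace RepK

open Model

variable {M : Model} {Γ : List FinType} {σ ρ τ : FinType}

theorem of_frac {f : Env M Γ → M.K} (u v b : Env M Γ → M.N) [Rep u] [Rep v] [Rep b]
    (h : ∀ e, f e = ((u e : M.K) - v e) / (b e + 1)) : RepK f :=
  ⟨fun e => encode (u e) (v e) (b e), inferInstance, fun e => by rw [qv_encode, h]⟩

theorem exists_frac (f : Env M Γ → M.K) [hf : RepK f] : ∃ u v b : Env M Γ → M.N,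
    Rep u ∧ Rep v ∧ Rep b ∧ ∀ e, f e = ((u e : M.K) - v e) / (b e + 1) := by
  obtain ⟨c, hc, h⟩ := hf.out
  exact ⟨fun e => codePos (c e), fun e => codeNeg (c e), fun e => snd (c e), inferInstance,
    inferInstance, inferInstance, fun e => (h e).symm⟩

instance const (x : M.K) : RepK fun _ : Env M Γ => x := by
  obtain ⟨a, b, c, rfl⟩ := exists_fraction x
  exact of_frac (fun _ => a) (fun _ => b) (fun _ => c) fun _ => rfl

instance qv (f : Env M Γ → M.N) [Rep f] : RepK fun e => Model.qv (f e) :=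
  ⟨f, inferInstance, fun _ => rfl⟩

instance cast (f : Env M Γ → M.N) [Rep f] : RepK fun e => (f e : M.K) :=
  of_frac f (fun _ => 0) (fun _ => 0) fun _ => by simp

instance neg (f : Env M Γ → M.K) [RepK f] : RepK fun e => -f e := by
  obtain ⟨u, v, b, _, _, _, h⟩ := exists_frac f
  exact of_frac v u b fun e => by rw [h, ← neg_div, neg_sub]

instance add (f g : Env M Γ → M.K) [RepK f] [RepK g] : RepK fun e => f e + g e := by
  obtain ⟨u, v, b, _, _, _, h⟩ := exists_frac f
  obtain ⟨u', v', b', _, _, _, h'⟩ := exists_frac g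
  refine of_frac (fun e => u e * (b' e + 1) + u' e * (b e + 1))
    (fun e => v e * (b' e + 1) + v' e * (b e + 1)) (fun e => b e * b' e + b e + b' e) fun e => ?_
  have h1 := (cast_add_one_pos (b e)).ne'
  have h2 := (cast_add_one_pos (b' e)).ne'
  have h3 : ((b e * b' e + b e + b' e : M.N) : M.K) + 1 = (b e + 1) * (b' e + 1) := by
    push_cast; ring
  rw [h, h', h3, div_add_div _ _ h1 h2]
  push_cast
  congr 1
  ring

instance sub (f g : Env M Γ → M.K) [RepK f] [RepK g] : RepK fun e => f e - g e := by
  simp only [sub_eq_add_neg]; infer_instance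

instance mul (f g : Env M Γ → M.K) [RepK f] [RepK g] : RepK fun e => f e * g e := by
  obtain ⟨u, v, b, _, _, _, h⟩ := exists_frac f
  obtain ⟨u', v', b', _, _, _, h'⟩ := exists_frac g
  refine of_frac (fun e => u e * u' e + v e * v' e)
    (fun e => u e * v' e + v e * u' e) (fun e => b e * b' e + b e + b' e) fun e => ?_
  have h3 : ((b e * b' e + b e + b' e : M.N) : M.K) + 1 = (b e + 1) * (b' e + 1) := by
    push_cast; ring
  rw [h, h', h3, div_mul_div_comm]
  push_cast
  congr 1
  ring

instance ite (P : Env M Γ → Prop) [Dec P] (inst : ∀ e, Decidable (P e))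
    (f g : Env M Γ → M.K) [hf : RepK f] [hg : RepK g] :
    RepK fun e => @ite _ (P e) (inst e) (f e) (g e) := by
  obtain ⟨c, hc, h⟩ := hf.out
  obtain ⟨c', hc', h'⟩ := hg.out
  refine ⟨fun e => @_root_.ite _ (P e) (inst e) (c e) (c' e), inferInstance, fun e => ?_⟩
  dsimp only
  split_ifs <;> simp [h, h']

instance tw (f : Env M Γ → M.N) [Rep f] : RepK fun e => tw (f e) :=
  of_frac (fun _ => 1) (fun _ => 0) (fun e => Model.pow2 (f e) - 1) fun e => by
    have : 1 ≤ Model.pow2 (f e) := by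
      rw [← zero_add (1 : M.N), succ_le_iff]; exact lt_of_le_of_lt zero_le (lt_pow2 _)
    rw [cast_sub this, Model.tw]
    simp

instance (priority := 100) weaken (f : Env M Γ → M.K) [hf : RepK f] :
    RepK (Γ := σ :: Γ) fun e => f e.2 := by
  obtain ⟨c, hc, h⟩ := hf.out
  exact ⟨fun e => c e.2, inferInstance, fun e => h e.2⟩

instance dec_le (f g : Env M Γ → M.K) [RepK f] [RepK g] : Dec fun e => f e ≤ g e := by
  obtain ⟨u, v, b, _, _, _, h⟩ := exists_frac f
  obtain ⟨u', v', b', _, _, _, h'⟩ := exists_frac g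
  have : ∀ e, f e ≤ g e ↔
      u e * (b' e + 1) + v' e * (b e + 1) ≤ u' e * (b e + 1) + v e * (b' e + 1) := by
    intro e
    rw [h, h', div_le_div_iff₀ (cast_add_one_pos _) (cast_add_one_pos _), ← cast_le]
    push_cast
    constructor <;> intro h <;> linarith
  simp only [this]
  infer_instance

instance dec_lt (f g : Env M Γ → M.K) [RepK f] [RepK g] : Dec fun e => f e < g e := by
  simp only [← not_le]; infer_instance

instance dec_eq (f g : Env M Γ → M.K) [RepK f] [RepK g] : Dec fun e => f e = g e := by
  simp only [le_antisymm_iff]; infer_instance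

instance max (f g : Env M Γ → M.K) [RepK f] [RepK g] : RepK fun e => max (f e) (g e) := by
  simp only [max_def]; infer_instance

instance min (f g : Env M Γ → M.K) [RepK f] [RepK g] : RepK fun e => min (f e) (g e) := by
  simp only [min_def]; infer_instance

instance abs (f : Env M Γ → M.K) [RepK f] : RepK fun e => |f e| := by
  simp only [abs_eq_max_neg]; infer_instance

instance (priority := 50) comp (f : M.C σ → M.K) [hf : RepK (Γ := [σ]) fun e : Env M _ => f e.1]
    (g : Env M Γ → M.C σ) [Rep g] : RepK fun e => f (g e) := by
  obtain ⟨c, hc, h⟩ := hf.out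
  exact ⟨fun e => c (g e, ()), Model.rep_comp (fun x => c (x, ())) g, fun e => h (g e, ())⟩

theorem comp₂ (f : M.C ρ → M.C σ → M.K) [hf : RepK (Γ := [σ, ρ]) fun e : Env M _ => f e.2.1 e.1]
    (g : Env M Γ → M.C ρ) (g' : Env M Γ → M.C σ) [Rep g] [Rep g'] : RepK fun e => f (g e) (g' e) := by
  obtain ⟨c, hc, h⟩ := hf.out
  exact ⟨fun e => c (g' e, g e, ()), Model.rep_comp₂ (fun x y => c (y, x, ())) g g',
    fun e => h (g' e, g e, ())⟩

theorem specialize (f : Env M (σ :: Γ) → M.K) [hf : RepK f] (e : Env M Γ) :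
    RepK (Γ := [σ]) fun x : Env M [σ] => f (x.1, e) := by
  obtain ⟨c, hc, h⟩ := hf.out
  exact ⟨fun x => c (x.1, e), Rep.specialize c e, fun x => h _⟩

end RepK

namespace Model

variable {M : Model} {Γ : List FinType} {σ τ : FinType}

/-! ### Recursion with values in the field of fractions -/

open Classical in
/-- The sequence `F` with `F 0 = a` and `F (n + 1) = f n (F n)`. -/
noncomputable def krec (f : M.N → M.K → M.K) (a : M.K) : M.N → M.K :=
  if h : ∃ F : M.N → M.K, RepK (Γ := [.zero]) (fun e : Env M _ => F e.1) ∧ F 0 = a ∧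
    ∀ n, F (n + 1) = f n (F n) then h.choose else 0

theorem krec_eq {f : M.N → M.K → M.K} {a : M.K} {F : M.N → M.K}
    [hF : RepK (Γ := [.zero]) fun e : Env M _ => F e.1] (h0 : F 0 = a)
    (hs : ∀ n, F (n + 1) = f n (F n)) : krec f a = F := by
  have h : ∃ F : M.N → M.K, RepK (Γ := [.zero]) (fun e : Env M _ => F e.1) ∧ F 0 = a ∧
    ∀ n, F (n + 1) = f n (F n) := ⟨F, hF, h0, hs⟩
  rw [krec, dif_pos h]
  obtain ⟨h1, h2, h3⟩ := h.choose_spec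
  funext n
  refine Dec.induction (P := fun n => h.choose n = F n) (h2.trans h0.symm) (fun n ih => ?_) n
  rw [h3, hs, ih]

theorem krec_spec_param (f : Env M Γ → M.N → M.K → M.K) (a : Env M Γ → M.K)
    [hf : RepK (Γ := .zero :: .zero :: Γ) fun e : Env M (_ :: _ :: Γ) => f e.2.2 e.2.1 (qv e.1)]
    [ha : RepK a] : RepK (Γ := .zero :: Γ) (fun e : Env M (_ :: Γ) => krec (f e.2) (a e.2) e.1) ∧
      ∀ e, krec (f e) (a e) 0 = a e ∧
        ∀ n, krec (f e) (a e) (n + 1) = f e n (krec (f e) (a e) n) := by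
  obtain ⟨c, hc, hce⟩ := ha.out
  obtain ⟨g, hg, hge⟩ := hf.out
  obtain ⟨g1, hg1, hg1e⟩ := hg.out
  obtain ⟨G, hG, hGe⟩ := hg1
  have hG : Rep (Γ := Γ) G := ⟨hG⟩
  have hGf : ∀ e n m, qv (G e n m) = f e n (qv m) := by
    intro e n m
    rw [hGe, hg1e, hge]
  let F : Env M (.zero :: Γ) → M.K := fun e => qv (prec (fun n m => G e.2 n m) (c e.2) e.1)
  have hF : RepK F := by infer_instance
  have hF0 : ∀ e, F (0, e) = a e := by
    intro e
    simp only [F, prec_zero, hce]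
  have hFs : ∀ e n, F (n + 1, e) = f e n (F (n, e)) := by
    intro e n
    simp only [F, prec_succ (fun n m => G e n m), hGf]
  have key : ∀ e, krec (f e) (a e) = fun n => F (n, e) := by
    intro e
    have := RepK.specialize F e
    exact krec_eq (F := fun n => F (n, e)) (hF0 e) (hFs e)
  refine ⟨?_, fun e => ?_⟩
  · simp only [key]
    exact hF
  · simp only [key]
    exact ⟨hF0 e, hFs e⟩

instance repK_krec (f : Env M Γ → M.N → M.K → M.K) (a : Env M Γ → M.K) (n : Env M Γ → M.N)
    [RepK (Γ := .zero :: .zero :: Γ) fun e : Env M (_ :: _ :: Γ) => f e.2.2 e.2.1 (qv e.1)]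
    [RepK a] [Rep n] : RepK fun e => krec (f e) (a e) (n e) := by
  obtain ⟨c, hc, h⟩ := (krec_spec_param f a).1.out
  obtain ⟨g, hg, hge⟩ := hc.out
  have hg : Rep g := ⟨hg⟩
  exact ⟨fun e => g e (n e), inferInstance, fun e => by
    beta_reduce; rw [hge, h]⟩

theorem krec_zero (f : M.N → M.K → M.K)
    [RepK (Γ := [.zero, .zero]) fun e : Env M _ => f e.2.1 (qv e.1)] (a : M.K) :
    krec f a 0 = a :=
  ((krec_spec_param (Γ := []) (fun _ => f) (fun _ => a)).2 ()).1

theorem krec_succ (f : M.N → M.K → M.K)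
    [RepK (Γ := [.zero, .zero]) fun e : Env M _ => f e.2.1 (qv e.1)] (a : M.K) (n : M.N) :
    krec f a (n + 1) = f n (krec f a n) :=
  ((krec_spec_param (Γ := []) (fun _ => f) (fun _ => a)).2 ()).2 n

/-- `f 0 + ⋯ + f (n - 1)`. -/
noncomputable def ksum (n : M.N) (f : M.N → M.K) : M.K := krec (fun i s => s + f i) 0 n

instance repK_ksum (f : Env M Γ → M.N → M.K) (n : Env M Γ → M.N)
    [RepK (Γ := .zero :: Γ) fun e : Env M (_ :: Γ) => f e.2 e.1] [Rep n] :
    RepK fun e => ksum (n e) (f e) := by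
  have : RepK (Γ := .zero :: .zero :: Γ) fun e : Env M (_ :: _ :: Γ) => f e.2.2 e.2.1 :=
    RepK.weaken fun e : Env M (.zero :: Γ) => f e.2 e.1
  exact inferInstanceAs (RepK fun e => krec (fun i s => s + f e i) 0 (n e))

section

variable (f g : M.N → M.K) [RepK (Γ := [.zero]) fun e : Env M _ => f e.1]
  [RepK (Γ := [.zero]) fun e : Env M _ => g e.1]

@[simp] theorem ksum_zero : ksum 0 f = 0 := by
  have := RepK.comp (Γ := [.zero, .zero]) f fun e => e.2.1
  exact krec_zero (fun i s => s + f i) 0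

theorem ksum_succ (n : M.N) : ksum (n + 1) f = ksum n f + f n := by
  have := RepK.comp (Γ := [.zero, .zero]) f fun e => e.2.1
  exact krec_succ (fun i s => s + f i) 0 n

variable {f g}

theorem ksum_le_ksum {n : M.N} (h : ∀ i, i < n → f i ≤ g i) : ksum n f ≤ ksum n g := by
  refine Dec.induction (P := fun m => m ≤ n → ksum m f ≤ ksum m g) (fun _ => by simp)
    (fun m ih hm => ?_) n le_rfl
  rw [ksum_succ, ksum_succ]
  exact add_le_add (ih (le_trans le_self_add hm)) (h m (succ_le_iff.1 hm))

theorem ksum_congr {n : M.N} (h : ∀ i, i < n → f i = g i) : ksum n f = ksum n g :=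
  le_antisymm (ksum_le_ksum fun i hi => (h i hi).le) (ksum_le_ksum fun i hi => (h i hi).ge)

theorem ksum_add (n : M.N) : ksum n (fun i => f i + g i) = ksum n f + ksum n g := by
  refine Dec.induction (P := fun n => ksum n (fun i => f i + g i) = ksum n f + ksum n g) (by simp)
    (fun m ih => ?_) n
  rw [ksum_succ, ksum_succ, ksum_succ, ih]
  ring

theorem ksum_sub (n : M.N) : ksum n (fun i => f i - g i) = ksum n f - ksum n g := by
  refine Dec.induction (P := fun n => ksum n (fun i => f i - g i) = ksum n f - ksum n g) (by simp)
    (fun m ih => ?_) n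
  rw [ksum_succ, ksum_succ, ksum_succ, ih]
  ring

theorem ksum_mul (c : M.K) (n : M.N) : ksum n (fun i => c * f i) = c * ksum n f := by
  refine Dec.induction (P := fun n => ksum n (fun i => c * f i) = c * ksum n f) (by simp)
    (fun m ih => ?_) n
  rw [ksum_succ, ksum_succ, ih]
  ring

theorem abs_ksum_le (n : M.N) : |ksum n f| ≤ ksum n fun i => |f i| := by
  refine Dec.induction (P := fun n => |ksum n f| ≤ ksum n fun i => |f i|) (by simp)
    (fun m ih => ?_) n
  rw [ksum_succ, ksum_succ]
  exact (abs_add_le _ _).trans (by gcongr)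

theorem ksum_const (c : M.K) (n : M.N) : ksum n (fun _ => c) = n * c := by
  refine Dec.induction (P := fun n => ksum n (fun _ => c) = n * c) (by simp)
    (fun m ih => ?_) n
  rw [ksum_succ, ih]
  push_cast
  ring

theorem ksum_telescope (n : M.N) : ksum n (fun i => f (i + 1) - f i) = f n - f 0 := by
  have := RepK.comp (Γ := [.zero]) f fun e => e.1 + 1
  refine Dec.induction (P := fun n => ksum n (fun i => f (i + 1) - f i) = f n - f 0) (by simp)
    (fun m ih => ?_) n
  rw [ksum_succ, ih]
  ring

end

end Model
end HigherOrderArith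

namespace HigherOrderArith
open FinType

/-! ## The meaning of formulas with bound variables -/

/-- A number of quantifiers over each type, with values of all variables. -/
structure World (M : Model) where
  d : Depth
  v : M.Val

namespace World

variable {M : Model}

/-- `w'` arises from `w` by adding quantifiers. -/
structure Ext (w w' : World M) : Prop where
  le (σ : FinType) : w.d σ ≤ w'.d σ
  eq (σ : FinType) (n : ℕ) : w'.v σ (n + (w'.d σ - w.d σ)) = w.v σ n

theorem Ext.refl (w : World M) : Ext w w := ⟨fun _ => le_rfl, fun σ n => by simp⟩

theorem Ext.trans {w w' w'' : World M} (h : Ext w w') (h' : Ext w' w'') : Ext w w'' where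
  le σ := (h.le σ).trans (h'.le σ)
  eq σ n := by
    rw [← h.eq, ← h'.eq]
    have := h.le σ
    have := h'.le σ
    congr 1
    omega

/-- Add a quantifier. -/
def push (w : World M) (σ : FinType) (x : M.C σ) : World M := ⟨bump σ w.d, Struc.vcons σ x w.v⟩

theorem ext_push (w : World M) (σ : FinType) (x : M.C σ) : Ext w (w.push σ x) where
  le τ := by simp only [push, bump]; split_ifs <;> omega
  eq τ n := by
    simp only [push, bump]
    by_cases h : σ = τ
    · subst h; simp
    · simp [Ne.symm h, Struc.vcons_ne h]

end World

open World

variable {M : Model} {σ τ : FinType} {w : World M}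

/-- The term `t` denotes `x`. -/
class RT (w : World M) (t : Trm σ) (x : M.C σ) : Prop where
  out : ∀ w', Ext w w' → Struc.eval w'.v (t w'.d) = x

/-- The formula `φ` means `P`. -/
class RF (w : World M) (φ : Fml) (P : Prop) : Prop where
  out : ∀ w', Ext w w' → (Struc.sat w'.v (φ w'.d) ↔ P)

theorem RT.mono {w w' : World M} {t : Trm σ} {x : M.C σ} (h : RT w t x) (hw : Ext w w') :
    RT w' t x :=
  ⟨fun w'' hw' => h.out w'' (hw.trans hw')⟩

/-- A later world with a term `term` that denotes `val` there. -/
structure Binding (w : World M) (σ : FinType) where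
  world : World M
  ext : Ext w world
  term : Trm σ
  val : M.C σ
  rt : RT world term val

instance (b : Binding w σ) : RT b.world b.term b.val := b.rt

instance (priority := 50) RT.step (b : Binding w τ) (t : Trm σ) (x : M.C σ) [h : RT w t x] :
    RT b.world t x :=
  h.mono b.ext

theorem RT.boundVar (x : M.C σ) : RT (w.push σ x) (boundVar σ w.d) x := by
  refine ⟨fun w' h => ?_⟩
  have h1 := h.eq σ 0
  have h2 := h.le σ
  simp only [World.push, bump, if_true, Struc.vcons_zero] at h1 h2
  rw [HigherOrderArith.boundVar, Struc.eval, ← h1]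
  simp

instance RT.app (t : Trm (.arrow σ τ)) (u : Trm σ) (f : M.C (.arrow σ τ)) (x : M.C σ)
    [h : RT w t f] [h' : RT w u x] : RT w (t ⬝ₒ u) (f x) :=
  ⟨fun w' hw => by rw [HigherOrderArith.app, Struc.eval, h.out w' hw, h'.out w' hw]⟩

instance RT.zero : RT w (0 : Trm .zero) (0 : M.N) := ⟨fun _ _ => rfl⟩
instance RT.one : RT w (1 : Trm .zero) (1 : M.N) := ⟨fun _ _ => rfl⟩

instance RT.add (t u : Trm .zero) (a b : M.N) [h : RT w t a] [h' : RT w u b] :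
    RT w (t + u) (a + b) :=
  ⟨fun w' hw => by rw [← h.out w' hw, ← h'.out w' hw]; rfl⟩

instance RT.mul (t u : Trm .zero) (a b : M.N) [h : RT w t a] [h' : RT w u b] :
    RT w (t * u) (a * b) :=
  ⟨fun w' hw => by rw [← h.out w' hw, ← h'.out w' hw]; rfl⟩

instance RT.pow2 (t : Trm .zero) (a : M.N) [h : RT w t a] :
    RT w (pow2 t) (Model.pow2 a : M.N) := by
  refine ⟨fun w' hw => ?_⟩
  rw [← h.out w' hw, Model.pow2, Model.prec]
  have : Model.lam (M := M) (fun _ : M.N => Model.lam fun m : M.N => m + m) =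
      Struc.eval w'.v (.app (.cst (.K t1 .zero)) (.app (.app (.cst (.S .zero .zero .zero))
        (.cst .add)) (.app (.app (.cst (.S .zero t1 .zero)) (.cst (.K .zero t1)))
          (.cst (.K .zero .zero))))) := by
    refine Model.lam_eq fun n => ?_
    simp only [Struc.eval]
    rw [Model.K_app]
    refine (Model.lam_eq fun m => ?_).symm
    rw [Model.S_app, Model.S_app, Model.K_app]
    rfl
  rw [this]
  rfl

namespace RF

instance eq (t u : Trm .zero) (a b : M.N) [h : RT w t a] [h' : RT w u b] : RF w (t =ₒ u) (a = b) :=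
  ⟨fun w' hw => by rw [← h.out w' hw, ← h'.out w' hw]; rfl⟩

instance lt (t u : Trm .zero) (a b : M.N) [h : RT w t a] [h' : RT w u b] : RF w (t <ₒ u) (a < b) :=
  ⟨fun w' hw => by rw [← h.out w' hw, ← h'.out w' hw]; rfl⟩

variable (φ ψ : Fml) (P Q : Prop)

instance neg [h : RF w φ P] : RF w (¬ₒφ) (¬P) :=
  ⟨fun w' hw => by rw [HigherOrderArith.neg, Struc.sat_neg, h.out w' hw]⟩

theorem imp_of (h : RF w φ P) (h' : P → RF w ψ Q) : RF w (φ →ₒ ψ) (P → Q) :=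
  ⟨fun w' hw => by
    rw [HigherOrderArith.imp, Struc.sat_imp, h.out w' hw]
    exact forall_congr' fun hP => (h' hP).out w' hw⟩

instance imp [h : RF w φ P] [h' : RF w ψ Q] : RF w (φ →ₒ ψ) (P → Q) :=
  imp_of φ ψ P Q h fun _ => h'

instance and [h : RF w φ P] [h' : RF w ψ Q] : RF w (φ ∧ₒ ψ) (P ∧ Q) :=
  ⟨fun w' hw => by rw [HigherOrderArith.and, Struc.sat_and, h.out w' hw, h'.out w' hw]⟩

instance or [h : RF w φ P] [h' : RF w ψ Q] : RF w (φ ∨ₒ ψ) (P ∨ Q) :=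
  ⟨fun w' hw => by rw [HigherOrderArith.or, Struc.sat_or, h.out w' hw, h'.out w' hw]⟩

instance le (t u : Trm .zero) (a b : M.N) [h : RT w t a] [h' : RT w u b] : RF w (t ≤ₒ u) (a ≤ b) := by
  rw [← not_lt]
  exact inferInstanceAs (RF w (¬ₒ(u <ₒ t)) _)

instance all (f : Trm σ → Fml) (P : M.C σ → Prop)
    [h : ∀ b : Binding w σ, RF b.world (f b.term) (P b.val)] : RF w (all σ f) (∀ x, P x) := by
  refine ⟨fun w' hw => ?_⟩
  rw [HigherOrderArith.all, Struc.sat_all]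
  exact forall_congr' fun x => (h ⟨w'.push σ x, hw.trans (ext_push w' σ x), HigherOrderArith.boundVar σ w'.d,
    x, RT.boundVar x⟩).out _ (Ext.refl _)

instance ex (f : Trm σ → Fml) (P : M.C σ → Prop)
    [h : ∀ b : Binding w σ, RF b.world (f b.term) (P b.val)] : RF w (ex σ f) (∃ x, P x) := by
  refine ⟨fun w' hw => ?_⟩
  rw [HigherOrderArith.ex, Struc.sat_ex]
  exact exists_congr fun x => (h ⟨w'.push σ x, hw.trans (ext_push w' σ x), HigherOrderArith.boundVar σ w'.d,
    x, RT.boundVar x⟩).out _ (Ext.refl _)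

end RF

/-- The rational number expression `q` denotes `x`. -/
class RQ (w : World M) (q : RatExp) (x : M.K) : Prop where
  out : ∃ a b c : M.N, RT w q.pos a ∧ RT w q.neg b ∧ RT w q.den c ∧ 0 < c ∧
    x = ((a : M.K) - b) / c

/-- A later world with an expression `exp` that denotes `x` there. -/
structure QBinding (w : World M) (x : M.K) where
  world : World M
  ext : Ext w world
  exp : RatExp
  rq : RQ world exp x

instance (x : M.K) (b : QBinding w x) : RQ b.world b.exp x := b.rq

instance (priority := 50) RT.qstep (y : M.K) (b : QBinding w y) (t : Trm σ) (x : M.C σ)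
    [h : RT w t x] : RT b.world t x :=
  h.mono b.ext

namespace RQ

theorem mono {w w' : World M} {q : RatExp} {x : M.K} (h : RQ w q x) (hw : Ext w w') :
    RQ w' q x := by
  obtain ⟨a, b, c, h1, h2, h3, hc, hx⟩ := h.out
  exact ⟨a, b, c, h1.mono hw, h2.mono hw, h3.mono hw, hc, hx⟩

instance (priority := 50) qstep (y : M.K) (b : QBinding w y) (q : RatExp) (x : M.K)
    [h : RQ w q x] : RQ b.world q x :=
  h.mono b.ext

theorem cast_ne {c : M.N} (h : 0 < c) : (c : M.K) ≠ 0 := by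
  rw [← Model.cast_zero, Ne, Model.cast_inj]; exact h.ne'

instance ofNat (t : Trm .zero) (a : M.N) [RT w t a] : RQ w (.ofNat t) (a : M.K) :=
  ⟨a, 0, 1, ‹_›, RT.zero, RT.one, one_pos, by simp⟩

instance invPow2 (t : Trm .zero) (a : M.N) [RT w t a] : RQ w (.invPow2 t) (Model.tw a : M.K) :=
  ⟨1, 0, Model.pow2 a, RT.one, RT.zero, RT.pow2 _ _, lt_of_le_of_lt zero_le (Model.lt_pow2 a), by
    simp [Model.tw]⟩

variable (q r : RatExp) (x y : M.K)

instance add [h : RQ w q x] [h' : RQ w r y] : RQ w (q + r) (x + y) := by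
  obtain ⟨a, b, c, _, _, _, hc, rfl⟩ := h.out
  obtain ⟨a', b', c', _, _, _, hc', rfl⟩ := h'.out
  refine ⟨a * c' + a' * c, b * c' + b' * c, c * c', inferInstanceAs (RT w (_ * _ + _ * _) _),
    inferInstanceAs (RT w (_ * _ + _ * _) _), inferInstanceAs (RT w (_ * _) _), mul_pos hc hc', ?_⟩
  rw [div_add_div _ _ (cast_ne hc) (cast_ne hc')]
  push_cast
  congr 1
  ring

instance neg [h : RQ w q x] : RQ w (-q) (-x) := by
  obtain ⟨a, b, c, h1, h2, h3, hc, rfl⟩ := h.out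
  exact ⟨b, a, c, h2, h1, h3, hc, by rw [← neg_div, neg_sub]⟩

instance sub [h : RQ w q x] [h' : RQ w r y] : RQ w (q - r) (x - y) := by
  rw [sub_eq_add_neg]
  exact inferInstanceAs (RQ w (q + -r) _)

instance mul [h : RQ w q x] [h' : RQ w r y] : RQ w (q * r) (x * y) := by
  obtain ⟨a, b, c, _, _, _, hc, rfl⟩ := h.out
  obtain ⟨a', b', c', _, _, _, hc', rfl⟩ := h'.out
  refine ⟨a * a' + b * b', a * b' + b * a', c * c', inferInstanceAs (RT w (_ * _ + _ * _) _),
    inferInstanceAs (RT w (_ * _ + _ * _) _), inferInstanceAs (RT w (_ * _) _), mul_pos hc hc', ?_⟩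
  rw [div_mul_div_comm]
  push_cast
  congr 1
  ring

instance lt [h : RQ w q x] [h' : RQ w r y] : RF w (q.lt r) (x < y) := by
  obtain ⟨a, b, c, _, _, _, hc, rfl⟩ := h.out
  obtain ⟨a', b', c', _, _, _, hc', rfl⟩ := h'.out
  have h1 := Model.cast_lt.2 hc
  have h2 := Model.cast_lt.2 hc'
  rw [Model.cast_zero] at h1 h2
  have : ((a : M.K) - b) / c < (a' - b') / c' ↔ a * c' + b' * c < a' * c + b * c' := by
    rw [div_lt_div_iff₀ h1 h2, ← Model.cast_lt]
    push_cast
    constructor <;> intro h <;> linarith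
  rw [this]
  exact inferInstanceAs (RF w (_ * _ + _ * _ <ₒ _ * _ + _ * _) _)

instance le [h : RQ w q x] [h' : RQ w r y] : RF w (q.le r) (x ≤ y) := by
  have := RQ.lt r q y x (w := w)
  obtain ⟨a, b, c, _, _, _, hc, rfl⟩ := h.out
  obtain ⟨a', b', c', _, _, _, hc', rfl⟩ := h'.out
  have h1 := Model.cast_lt.2 hc
  have h2 := Model.cast_lt.2 hc'
  rw [Model.cast_zero] at h1 h2
  have : ((a : M.K) - b) / c ≤ (a' - b') / c' ↔ a * c' + b' * c ≤ a' * c + b * c' := by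
    rw [div_le_div_iff₀ h1 h2, ← Model.cast_le]
    push_cast
    constructor <;> intro h <;> linarith
  rw [this]
  exact inferInstanceAs (RF w (_ * _ + _ * _ ≤ₒ _ * _ + _ * _) _)

end RQ

/-- The sequence of fractions coded by `x`. -/
noncomputable def Model.seq (x : M.C t1) (n : M.N) : M.K := Model.qv (x n)

/-- The expression `e` denotes the sequence `s`. -/
class RR (w : World M) (e : RealExp) (s : M.N → M.K) : Prop where
  out : ∀ w' : World M, Ext w w' → ∀ (t : Trm .zero) (n : M.N), RT w' t n →
    ∀ (k : RatExp → Fml) (P : Prop),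
      (∀ b : QBinding w' (s n), RF b.world (k b.exp) P) → RF w' (e t k) P

namespace RR

theorem mono {w w' : World M} {e : RealExp} {s : M.N → M.K} (h : RR w e s) (hw : Ext w w') :
    RR w' e s :=
  ⟨fun w'' hw' t n ht k P hk => h.out w'' (hw.trans hw') t n ht k P hk⟩

instance (priority := 50) step (b : Binding w τ) (e : RealExp) (s : M.N → M.K) [h : RR w e s] :
    RR b.world e s :=
  h.mono b.ext

instance (priority := 50) qstep (y : M.K) (b : QBinding w y) (e : RealExp) (s : M.N → M.K)
    [h : RR w e s] : RR b.world e s :=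
  h.mono b.ext

theorem app (e : RealExp) (s : M.N → M.K) (t : Trm .zero) (n : M.N) (k : RatExp → Fml) (P : Prop)
    [h : RR w e s] [ht : RT w t n] [hk : ∀ b : QBinding w (s n), RF b.world (k b.exp) P] :
    RF w (e t k) P :=
  h.out w (Ext.refl w) t n ht k P hk

instance ofSeq (x : Trm t1) (X : M.C t1) [hx : RT w x X] : RR w (.ofSeq x) (Model.seq X) := by
  refine ⟨fun w' hw t n _ k P hk => ?_⟩
  have := hx.mono hw
  have : P ↔ ∀ u v b : M.N, (∃ a, X n + X n = (a + b) * (a + b) + (a + a + a) + b ∧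
      ((a = u + u ∧ v = 0) ∨ (a + 1 = v + v ∧ u = 0))) → P := by
    refine ⟨fun h _ _ _ _ => h, fun h => ?_⟩
    exact h _ _ _ (Model.code_iff.2 ⟨rfl, rfl, rfl⟩)
  rw [this]
  change RF w' (all .zero fun u => all .zero fun v => all .zero fun b =>
    ratCode (x ⬝ₒ t) u v b →ₒ k ⟨u, v, b + 1⟩) _
  refine @RF.all _ _ _ _ _ fun u => @RF.all _ _ _ _ _ fun v =>
    @RF.all _ _ _ _ _ fun b => RF.imp_of _ _ _ _ ?_ fun h => ?_
  · unfold ratCode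
    infer_instance
  · rw [Model.code_iff] at h
    refine hk ⟨b.world, u.ext.trans (v.ext.trans b.ext), ⟨u.term, v.term, b.term + 1⟩,
      ⟨u.val, v.val, b.val + 1, inferInstance, inferInstance, inferInstance,
        lt_of_le_of_lt zero_le (Model.lt_succ.2 (.inr rfl)), ?_⟩⟩
    rw [Model.seq, Model.qv, h.1, h.2.1, h.2.2]
    simp

set_option synthInstance.checkSynthOrder false in
instance app_ofSeq (x : Trm t1) (X : M.C t1) (t : Trm .zero) (n : M.N) (k : RatExp → Fml) (P : Prop)
    [RT w x X] [ht : RT w t n] [hk : ∀ b : QBinding w (Model.seq X n), RF b.world (k b.exp) P] :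
    RF w (RealExp.ofSeq x t k) P :=
  app (.ofSeq x) (Model.seq X) t n k P

instance ofNat (t : Trm .zero) (a : M.N) [ht : RT w t a] : RR w (.ofNat t) (fun _ => (a : M.K)) :=
  ⟨fun w' hw _ _ _ k P hk => by
    have := ht.mono hw
    exact hk ⟨w', Ext.refl w', .ofNat t, inferInstance⟩⟩

instance zero : RR w 0 (fun _ => (0 : M.K)) := by
  have := ofNat (w := w) 0 0
  rwa [Model.cast_zero] at this

instance one : RR w 1 (fun _ => (1 : M.K)) := by
  have := ofNat (w := w) 1 1
  rwa [Model.cast_one] at this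

variable (e f : RealExp) (s s' : M.N → M.K)

theorem map₂ [h : RR w e s] [h' : RR w f s'] (F : RatExp → RatExp → RatExp) (φ : M.K → M.K → M.K)
    (H : ∀ (w : World M) (q r : RatExp) (x y : M.K) [RQ w q x] [RQ w r y],
      RQ w (F q r) (φ x y)) :
    RR w (fun n k => e n fun q => f n fun r => k (F q r)) (fun n => φ (s n) (s' n)) :=
  ⟨fun w' hw t n _ k P hk => by
    have := h.mono hw
    have := h'.mono hw
    refine @app _ _ e s t n _ P _ _ fun b => @app _ _ f s' t n _ P _ _ fun c => ?_
    have := H c.world b.exp c.exp (s n) (s' n)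
    exact hk ⟨c.world, b.ext.trans c.ext, F b.exp c.exp, this⟩⟩

instance add [RR w e s] [RR w f s'] : RR w (e + f) (fun n => s n + s' n) :=
  map₂ e f s s' (· + ·) (· + ·) fun _ _ _ _ _ _ _ => inferInstance

instance sub [RR w e s] [RR w f s'] : RR w (e - f) (fun n => s n - s' n) :=
  map₂ e f s s' (· - ·) (· - ·) fun _ _ _ _ _ _ _ => inferInstance

instance mul [RR w e s] [RR w f s'] : RR w (e * f) (fun n => s n * s' n) :=
  map₂ e f s s' (· * ·) (· * ·) fun _ _ _ _ _ _ _ => inferInstance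

instance abs [h : RR w e s] : RR w e.abs (fun n => |s n|) :=
  ⟨fun w' hw t n _ k P hk => by
    have := h.mono hw
    refine @app _ _ e s t n _ P _ _ fun b => ?_
    have : P ↔ ((((0 : M.N) : M.K) ≤ s n → P) ∧ (s n < ((0 : M.N) : M.K) → P)) := by
      rcases le_or_gt ((0 : M.N) : M.K) (s n) with h | h
      · exact ⟨fun hp => ⟨fun _ => hp, fun _ => hp⟩, fun hp => hp.1 h⟩
      · exact ⟨fun hp => ⟨fun _ => hp, fun _ => hp⟩, fun hp => hp.2 h⟩
    rw [this]
    refine @RF.and _ _ _ _ _ _ (RF.imp_of _ _ _ _ inferInstance fun h => ?_)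
      (RF.imp_of _ _ _ _ inferInstance fun h => ?_)
    · rw [Model.cast_zero] at h
      exact hk ⟨b.world, b.ext, b.exp, by rw [abs_of_nonneg h]; infer_instance⟩
    · rw [Model.cast_zero] at h
      exact hk ⟨b.world, b.ext, -b.exp, by rw [abs_of_neg h]; infer_instance⟩⟩

end RR

end HigherOrderArith

namespace HigherOrderArith
open FinType World

/-! ## The meaning of the principles -/

namespace Model

variable {M : Model}

def RLt (s s' : M.N → M.K) : Prop := ∃ m N : M.N, ∀ n, N ≤ n → s n + tw m ≤ s' n
def RLe (s s' : M.N → M.K) : Prop := ¬RLt s' s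
def REq (s s' : M.N → M.K) : Prop := RLe s s' ∧ RLe s' s

def IsReal (x : M.C t1) : Prop :=
  ∀ n i : M.N, seq x n < seq x (n + i) + tw n ∧ seq x (n + i) < seq x n + tw n

def EqReal (x y : M.C t1) : Prop :=
  ∀ n : M.N, seq x n ≤ seq y n + tw n + tw n ∧ seq y n ≤ seq x n + tw n + tw n

def InI (x : M.C t1) : Prop :=
  IsReal x ∧ RLe (fun _ => 0) (seq x) ∧ RLe (seq x) (fun _ => 1)

def Pos (x : M.C t1) : Prop := RLt (fun _ => 0) (seq x)

def SumSat (n : M.N) (s : M.N → M.N → M.K) (Φ : (M.N → M.K) → Prop) : Prop :=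
  ∃ S : M.C tseq, (∀ i, i ≤ n → IsReal (S i)) ∧ REq (seq (S 0)) (fun _ => 0) ∧
    (∀ i, i < n → REq (seq (S (i + 1))) (fun k => seq (S i) k + s i k)) ∧ Φ (seq (S n))

def IsFun (f : M.C tfun) : Prop :=
  (∀ x, InI x → IsReal (f x)) ∧ ∀ x, InI x → ∀ y, InI y → EqReal x y → EqReal (f x) (f y)

def IsContinuous (f : M.C tfun) : Prop :=
  ∀ x, InI x → ∀ ε, IsReal ε → Pos ε → ∃ δ, IsReal δ ∧ Pos δ ∧ ∀ y, InI y →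
    RLt (fun n => |seq x n - seq y n|) (seq δ) →
      RLt (fun n => |seq (f x) n - seq (f y) n|) (seq ε)

def IsBounded (f : M.C tfun) : Prop :=
  ∃ N : M.N, ∀ x, InI x → RLe (fun n => |seq (f x) n|) (fun _ => (N : M.K))

def TaggedPartition (n : M.N) (a t : M.C tseq) : Prop :=
  (∀ i, i ≤ n → IsReal (a i)) ∧ REq (seq (a 0)) (fun _ => 0) ∧ REq (seq (a n)) (fun _ => 1) ∧
    ∀ i, i < n → IsReal (t i) ∧ RLe (seq (a i)) (seq (t i)) ∧ RLe (seq (t i)) (seq (a (i + 1)))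

def IsRiemannIntegral (g : M.C t1 → M.N → M.K) (A : M.C t1) : Prop :=
  ∀ ε, IsReal ε → Pos ε → ∃ δ, IsReal δ ∧ Pos δ ∧ ∀ (n : M.N) (a t : M.C tseq),
    TaggedPartition n a t →
    (∀ i, i < n → RLe (fun k => seq (a (i + 1)) k - seq (a i) k) (seq δ)) →
    SumSat n (fun i k => g (t i) k * (seq (a (i + 1)) k - seq (a i) k))
      fun s => RLt (fun k => |s k - seq A k|) (seq ε)

def DirectedBy (D : M.C t2) (R : M.C trel) : Prop :=
  (∀ a, D a ≤ 1) ∧ (∀ a b, R a b ≤ 1) ∧ (∃ a, D a = 1) ∧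
  (∀ a, D a = 1 → ∀ b, D b = 1 → ∀ c, D c = 1 → R a b = 1 ∧ R b c = 1 → R a c = 1) ∧
  (∀ a, D a = 1 → R a a = 1) ∧
  ∀ a, D a = 1 → ∀ b, D b = 1 → ∃ c, D c = 1 ∧ R a c = 1 ∧ R b c = 1

def SubJ (Ψ : M.C tfun) (y : M.C tseq) (i : M.N) (a b : M.C t1) : Prop :=
  (RLe (fun n => seq (y i) n - seq (Ψ (y i)) n) (seq a) ∧
    RLe (seq b) (fun n => seq (y i) n + seq (Ψ (y i)) n)) ∧
  ∀ j, j < i → RLe (seq b) (fun n => seq (y j) n - seq (Ψ (y j)) n) ∨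
    RLe (fun n => seq (y j) n + seq (Ψ (y j)) n) (seq a)

def TotalLengthGe (Ψ : M.C tfun) (y : M.C tseq) (n : M.N) (r : M.N → M.K) : Prop :=
  ∃ (m : M.N) (a b : M.C tseq),
    (∀ k, k < m → InI (a k) ∧ InI (b k) ∧ RLe (seq (a k)) (seq (b k)) ∧
      ∃ i, i ≤ n ∧ SubJ Ψ y i (a k) (b k)) ∧
    (∀ k, k + 1 < m → RLe (seq (b k)) (seq (a (k + 1)))) ∧
    SumSat m (fun k n => seq (b k) n - seq (a k) n) fun s => RLe r s

end Model

open Model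

variable {M : Model} {σ τ : FinType} {w : World M}

namespace RR

variable (e f : RealExp) (s s' : M.N → M.K)

instance lt [h : RR w e s] [h' : RR w f s'] : RF w (e.lt f) (RLt s s') := by
  unfold RealExp.lt RLt
  refine @RF.ex _ _ _ _ _ fun m => @RF.ex _ _ _ _ _ fun N => @RF.all _ _ _ _ _ fun n =>
    @RF.imp _ _ _ _ _ _ inferInstance ?_
  refine @app _ _ e s n.term n.val _ _ inferInstance inferInstance fun b => ?_
  exact @app _ _ f s' n.term n.val _ _ inferInstance inferInstance inferInstance

instance le [RR w e s] [RR w f s'] : RF w (e.le f) (RLe s s') := by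
  unfold RealExp.le RLe
  infer_instance

instance eq [RR w e s] [RR w f s'] : RF w (e.eq f) (REq s s') := by
  unfold RealExp.eq REq
  infer_instance

end RR

namespace RF

instance isReal (x : Trm t1) (X : M.C t1) [RT w x X] : RF w (isReal x) (IsReal X) := by
  unfold HigherOrderArith.isReal IsReal
  infer_instance

instance eqReal (x y : Trm t1) (X Y : M.C t1) [RT w x X] [RT w y Y] :
    RF w (eqReal x y) (EqReal X Y) := by
  unfold HigherOrderArith.eqReal EqReal
  infer_instance

instance inI (x : Trm t1) (X : M.C t1) [RT w x X] : RF w (inI x) (InI X) := by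
  unfold HigherOrderArith.inI InI
  infer_instance

section

variable (f : Trm t1 → Fml) (P : M.C t1 → Prop)
  [h : ∀ b : Binding w t1, RF b.world (f b.term) (P b.val)]

instance allReal : RF w (allReal f) (∀ x, IsReal x → P x) := by
  unfold HigherOrderArith.allReal
  infer_instance

instance allPos : RF w (allPos f) (∀ x, IsReal x → Pos x → P x) := by
  unfold HigherOrderArith.allPos Pos
  infer_instance

instance exPos : RF w (exPos f) (∃ x, IsReal x ∧ Pos x ∧ P x) := by
  unfold HigherOrderArith.exPos Pos
  infer_instance

instance allI : RF w (allI f) (∀ x, InI x → P x) := by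
  unfold HigherOrderArith.allI
  infer_instance

instance allIn (D : Trm t2) (E : M.C t2) [RT w D E] : RF w (allIn D f) (∀ x, E x = 1 → P x) := by
  unfold HigherOrderArith.allIn mem
  infer_instance

instance exIn (D : Trm t2) (E : M.C t2) [RT w D E] : RF w (exIn D f) (∃ x, E x = 1 ∧ P x) := by
  unfold HigherOrderArith.exIn mem
  infer_instance

end

instance sumSat (n : Trm .zero) (n' : M.N) (e : Trm .zero → RealExp) (s : M.N → M.N → M.K)
    (φ : RealExp → Fml) (Φ : (M.N → M.K) → Prop) [hn : RT w n n']
    [he : ∀ b : Binding w .zero, RR b.world (e b.term) (s b.val)]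
    [hφ : ∀ b : Binding w tseq, RF b.world (φ (ℜ(b.term ⬝ₒ n))) (Φ (seq (b.val n')))] :
    RF w (sumSat n e φ) (SumSat n' s Φ) := by
  unfold HigherOrderArith.sumSat SumSat
  refine @RF.ex _ _ _ _ _ fun S => ?_
  have : ∀ b : Binding S.world .zero, RR b.world (e b.term) (s b.val) := fun b =>
    he ⟨b.world, S.ext.trans b.ext, b.term, b.val, b.rt⟩
  infer_instance

instance isFun (f : Trm tfun) (F : M.C tfun) [RT w f F] : RF w (isFun f) (IsFun F) := by
  unfold HigherOrderArith.isFun IsFun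
  infer_instance

instance continuous (f : Trm tfun) (F : M.C tfun) [RT w f F] :
    RF w (continuous f) (IsContinuous F) := by
  unfold HigherOrderArith.continuous IsContinuous
  infer_instance

instance bounded (f : Trm tfun) (F : M.C tfun) [RT w f F] : RF w (bounded f) (IsBounded F) := by
  unfold HigherOrderArith.bounded IsBounded
  infer_instance

instance taggedPartition (n : Trm .zero) (a t : Trm tseq) (n' : M.N) (a' t' : M.C tseq) [RT w n n']
    [RT w a a'] [RT w t t'] : RF w (taggedPartition n a t) (TaggedPartition n' a' t') := by
  unfold HigherOrderArith.taggedPartition TaggedPartition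
  infer_instance

instance isRiemannIntegral (g : Trm t1 → RealExp) (G : M.C t1 → M.N → M.K) (A : Trm t1)
    (A' : M.C t1) [RT w A A'] [hg : ∀ b : Binding w t1, RR b.world (g b.term) (G b.val)] :
    RF w (isRiemannIntegral g A) (IsRiemannIntegral G A') := by
  unfold HigherOrderArith.isRiemannIntegral IsRiemannIntegral
  refine @RF.allPos _ _ _ _ fun ε => @RF.exPos _ _ _ _ fun δ => @RF.all _ _ _ _ _ fun n =>
    @RF.all _ _ _ _ _ fun a => @RF.all _ _ _ _ _ fun t => ?_
  have (b : Binding t.world .zero) : RR b.world (g (t.term ⬝ₒ b.term)) (G (t.val b.val)) :=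
    hg ⟨b.world, ε.ext.trans (δ.ext.trans (n.ext.trans (a.ext.trans (t.ext.trans b.ext)))),
      t.term ⬝ₒ b.term, t.val b.val, inferInstance⟩
  infer_instance

set_option synthInstance.maxSize 2000 in
instance directed (D : Trm t2) (R : Trm trel) (D' : M.C t2) (R' : M.C trel) [RT w D D']
    [RT w R R'] : RF w (directed D R) (DirectedBy D' R') := by
  unfold HigherOrderArith.directed DirectedBy mem rel
  infer_instance

instance subJ (Ψ : Trm tfun) (y : Trm tseq) (i : Trm .zero) (a b : Trm t1) (Ψ' : M.C tfun)
    (y' : M.C tseq) (i' : M.N) (a' b' : M.C t1) [RT w Ψ Ψ'] [RT w y y'] [RT w i i'] [RT w a a']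
    [RT w b b'] : RF w (subJ Ψ y i a b) (SubJ Ψ' y' i' a' b') := by
  unfold HigherOrderArith.subJ SubJ
  infer_instance

set_option synthInstance.maxSize 2000 in
instance totalLengthGe (Ψ : Trm tfun) (y : Trm tseq) (n : Trm .zero) (r : RealExp) (Ψ' : M.C tfun)
    (y' : M.C tseq) (n' : M.N) (r' : M.N → M.K) [RT w Ψ Ψ'] [RT w y y'] [RT w n n'] [RR w r r'] :
    RF w (totalLengthGe Ψ y n r) (TotalLengthGe Ψ' y' n' r') := by
  unfold HigherOrderArith.totalLengthGe TotalLengthGe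
  infer_instance

end RF

set_option synthInstance.maxSize 2000 in
theorem sat_MCTnet (v : M.Val) : Struc.sat v MCTnet ↔
    ∀ (D : M.C t2) (R : M.C trel) (f : M.C tnet) (g : M.C tfun), DirectedBy D R →
      (∀ d, D d = 1 → IsFun (f d) ∧ IsContinuous (f d)) →
      (∀ a, D a = 1 → ∀ b, D b = 1 → R a b = 1 →
        ∀ x, InI x → RLe (seq (f a x)) (seq (f b x))) →
      IsFun g →
      (∀ x, InI x → ∀ ε, IsReal ε → Pos ε → ∃ d, D d = 1 ∧ ∀ e, D e = 1 → R d e = 1 →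
        RLt (fun n => |seq (f e x) n - seq (g x) n|) (seq ε)) →
      IsBounded g → IsContinuous g →
      ∀ ε, IsReal ε → Pos ε → ∃ d, D d = 1 ∧ ∀ e, D e = 1 → R d e = 1 → ∀ A, IsReal A →
        IsRiemannIntegral (fun x n => |seq (g x) n - seq (f e x) n|) A →
          RLt (fun n => |seq A n|) (seq ε) := by
  unfold MCTnet close rel
  refine RF.out (w := ⟨fun _ => 0, v⟩) ⟨fun _ => 0, v⟩ (Ext.refl _) (self := ?_)
  infer_instance

set_option synthInstance.maxSize 2000 in
theorem sat_WHBU0 (v : M.Val) : Struc.sat v WHBU0 ↔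
    ∀ Ψ : M.C tfun, IsFun Ψ → (∀ x, InI x → RLt (fun _ => 0) (seq (Ψ x))) →
      ∀ ε, IsReal ε → Pos ε → ∃ (n : M.N) (y : M.C tseq), (∀ i, i ≤ n → InI (y i)) ∧
        TotalLengthGe Ψ y n (fun k => 1 - seq ε k) := by
  unfold WHBU0 close
  refine RF.out (w := ⟨fun _ => 0, v⟩) ⟨fun _ => 0, v⟩ (Ext.refl _) (self := ?_)
  infer_instance

end HigherOrderArith

namespace HigherOrderArith
open FinType

namespace Model

variable {M : Model} {Γ : List FinType} {σ τ : FinType}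

/-! ## Choice -/

theorem exists_choice (P : M.C t1 → M.N → Prop)
    [hP : Dec (Γ := [.zero, t1]) fun e : Env M _ => P e.2.1 e.1] (h : ∀ x, ∃ y, P x y) :
    ∃ Y : M.C t2, ∀ x, P x (Y x) := by
  obtain ⟨f, hf, h'⟩ := hP.out
  have : Rep (Γ := [.zero, t1]) fun e : Env M _ => f (e.1, e.2.1, ()) := hf
  obtain ⟨F, hF⟩ := Rep.exists_obj₂ fun (x : M.C t1) (y : M.N) => f (y, x, ())
  have key (x : M.C t1) (y : M.N) : P x y ↔ F x y = 0 := by rw [hF]; exact h' (y, x, ())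
  let T : FinType := .arrow t1 t1
  have hne : T ≠ t1 := by simp [T, t1]
  have hne2 : T ≠ t2 := by simp [T, t1, t2]
  let φ : Fm := .eq (.app (.app (.var T 0) (.var t1 0)) (.var .zero 0)) .zero
  let v : M.Val := Struc.vcons T F fun τ _ => M.dflt τ
  have hφ (v' : M.Val) (hv : v' T 0 = F) (x : M.C t1) (y : M.N) :
      Struc.sat (Struc.vcons .zero y (Struc.vcons t1 x v')) φ ↔ P x y := by
    rw [key, ← hv]
    rfl
  obtain ⟨Y, hY⟩ := (Struc.sat_ex _ _ _).1 <| M.sat_of_mem (.qfac φ trivial) v fun x => by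
    rw [Struc.sat_ex]
    obtain ⟨y, hy⟩ := h x
    exact ⟨y, (hφ v rfl x y).2 hy⟩
  refine ⟨Y, fun x => ?_⟩
  have := hY x
  rw [Struc.sat_inst, Fm.shift, Struc.sat_subst] at this
  exact (key x (Y x)).2 this

/-! ## Codes of sequences -/

theorem RepK.exists_seq (f : M.N → M.K) [hf : RepK (Γ := [.zero]) fun e : Env M _ => f e.1] :
    ∃ x : M.C t1, ∀ n, seq x n = f n := by
  obtain ⟨c, hc, h⟩ := hf.out
  have : Rep (Γ := [.zero]) fun e : Env M _ => c (e.1, ()) := hc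
  exact ⟨lam fun n => c (n, ()), fun n => by rw [seq, lam_app]; exact h (n, ())⟩

theorem RepK.exists_seq₂ (f : M.C σ → M.N → M.K)
    [hf : RepK (Γ := [.zero, σ]) fun e : Env M _ => f e.2.1 e.1] :
    ∃ F : M.C (.arrow σ t1), ∀ x n, seq (F x) n = f x n := by
  obtain ⟨c, hc, h⟩ := hf.out
  have : Rep (Γ := [.zero, σ]) fun e : Env M _ => c (e.1, e.2.1, ()) := hc
  obtain ⟨F, hF⟩ := Rep.exists_obj₂ fun (x : M.C σ) (n : M.N) => c (n, x, ())
  exact ⟨F, fun x n => by rw [seq, hF]; exact h (n, x, ())⟩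

instance RepK.seq (x : Env M Γ → M.C t1) (n : Env M Γ → M.N) [Rep x] [Rep n] :
    RepK fun e => seq (x e) (n e) := by
  unfold Model.seq
  infer_instance

/-! ## Real numbers -/

theorem RLe.of_forall {s s' : M.N → M.K} (h : ∀ m, ∃ N, ∀ n, N ≤ n → s n < s' n + tw m) :
    RLe s s' := by
  rintro ⟨m, N, h'⟩
  obtain ⟨N', h⟩ := h m
  have h1 := h _ (le_max_right N N')
  have h2 := h' _ (le_max_left N N')
  linarith

theorem RLe.of_le {s s' : M.N → M.K} (N : M.N) (h : ∀ n, N ≤ n → s n ≤ s' n) : RLe s s' :=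
  .of_forall fun m => ⟨N, fun n hn => by have := h n hn; have := tw_pos m; linarith⟩

/-- Sequences within `c * 2 ^ (-n)` of one another have the same limit. -/
theorem RLe.of_le_tw {s s' : M.N → M.K} (c k : M.N) (h : ∀ n, k ≤ n → s n ≤ s' n + c * tw n) :
    RLe s s' := by
  refine .of_forall fun m => ⟨max k (c + m), fun n hn => ?_⟩
  have h1 := h n ((le_max_left _ _).trans hn)
  have h2 : (c : M.K) * tw n < tw m := by
    calc (c : M.K) * tw n ≤ c * tw (c + m) :=
          mul_le_mul_of_nonneg_left (tw_anti ((le_max_right _ _).trans hn)) (cast_nonneg c)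
      _ = c * tw c * tw m := by rw [tw_add]; ring
      _ < 1 * tw m := mul_lt_mul_of_pos_right (cast_mul_tw_lt_one c) (tw_pos m)
      _ = tw m := one_mul _
  linarith

theorem RLe.le {s s' : M.N → M.K} (h : RLe s s') {k : M.N} {a b : M.K}
    (hs : ∀ n, k ≤ n → |s n - s k| ≤ a) (hs' : ∀ n, k ≤ n → |s' n - s' k| ≤ b) :
    s k ≤ s' k + (a + b) := by
  by_contra! h'
  obtain ⟨m, hm⟩ := exists_tw_lt (sub_pos.2 h')
  refine h ⟨m, k, fun n hn => ?_⟩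
  have h1 := abs_le.1 (hs n hn)
  have h2 := abs_le.1 (hs' n hn)
  linarith

theorem REq.refl (s : M.N → M.K) : REq s s := ⟨.of_le 0 fun _ _ => le_rfl, .of_le 0 fun _ _ => le_rfl⟩

theorem REq.of_abs_le {s s' : M.N → M.K} (c k : M.N) (h : ∀ n, k ≤ n → |s n - s' n| ≤ c * tw n) :
    REq s s' :=
  ⟨.of_le_tw c k fun n hn => by linarith [(abs_le.1 (h n hn)).2],
    .of_le_tw c k fun n hn => by linarith [(abs_le.1 (h n hn)).1]⟩

theorem IsReal.abs_lt {x : M.C t1} (h : IsReal x) {n m : M.N} (hnm : n ≤ m) :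
    |seq x m - seq x n| < tw n := by
  obtain ⟨i, rfl⟩ := exists_add_of_le hnm
  rw [abs_sub_lt_iff]
  constructor <;> linarith [(h n i).1, (h n i).2]

theorem IsReal.of_abs_lt {x : M.C t1} (h : ∀ n m : M.N, n ≤ m → |seq x m - seq x n| < tw n) :
    IsReal x := fun n i => by
  have := _root_.abs_lt.1 (h n (n + i) le_self_add)
  constructor <;> linarith [this.1, this.2]

theorem abs_const_sub_le (c : M.K) (k n : M.N) (_ : k ≤ n) :
    |(fun _ : M.N => c) n - (fun _ : M.N => c) k| ≤ 0 := by
  simp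

theorem IsReal.le_of_rle {x y : M.C t1} (hx : IsReal x) (hy : IsReal y) (h : RLe (seq x) (seq y))
    (k : M.N) : seq x k ≤ seq y k + 2 * tw k := by
  have := h.le (k := k) (fun n hn => (hx.abs_lt hn).le) fun n hn => (hy.abs_lt hn).le
  linarith

theorem IsReal.le_const {x : M.C t1} (hx : IsReal x) {c : M.K} (h : RLe (seq x) fun _ => c)
    (k : M.N) : seq x k ≤ c + tw k := by
  have := h.le (k := k) (fun n hn => (hx.abs_lt hn).le) (abs_const_sub_le c k)
  linarith

theorem IsReal.const_le {x : M.C t1} (hx : IsReal x) {c : M.K} (h : RLe (fun _ => c) (seq x))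
    (k : M.N) : c ≤ seq x k + tw k := by
  have := h.le (k := k) (abs_const_sub_le c k) fun n hn => (hx.abs_lt hn).le
  linarith

theorem InI.nonneg {x : M.C t1} (hx : InI x) (k : M.N) : 0 ≤ seq x k + tw k :=
  hx.1.const_le hx.2.1 k

theorem InI.le_one {x : M.C t1} (hx : InI x) (k : M.N) : seq x k ≤ 1 + tw k :=
  hx.1.le_const hx.2.2 k

theorem InI.of_mem {x : M.C t1} (hx : IsReal x) (h : ∀ n, 0 ≤ seq x n ∧ seq x n ≤ 1) : InI x :=
  ⟨hx, .of_le 0 fun n _ => (h n).1, .of_le 0 fun n _ => (h n).2⟩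

theorem exists_const (c : M.K) : ∃ x : M.C t1, IsReal x ∧ ∀ n, seq x n = c := by
  obtain ⟨x, hx⟩ := RepK.exists_seq fun _ : M.N => c
  exact ⟨x, .of_abs_lt fun n m _ => by rw [hx, hx, sub_self, abs_zero]; exact tw_pos n, hx⟩

theorem Pos.exists_tw_le {x : M.C t1} (h : Pos x) : ∃ m N : M.N, ∀ n, N ≤ n → tw m ≤ seq x n := by
  obtain ⟨m, N, h⟩ := h
  exact ⟨m, N, fun n hn => by linarith [h n hn]⟩

theorem Pos.of_const {x : M.C t1} {c : M.K} (hc : 0 < c) (hx : ∀ n, seq x n = c) : Pos x := by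
  obtain ⟨m, hm⟩ := exists_tw_lt hc
  exact ⟨m, 0, fun n _ => by rw [hx]; linarith⟩

/-! ## Points -/

/-- The point of `[0, 1]` closest to `x`. -/
noncomputable def unitClamp (x : M.K) : M.K := max 0 (min x 1)

theorem unitClamp_nonneg (x : M.K) : 0 ≤ unitClamp x := le_max_left _ _
theorem unitClamp_le_one (x : M.K) : unitClamp x ≤ 1 := max_le zero_le_one (min_le_right _ _)

theorem unitClamp_mono {x y : M.K} (h : x ≤ y) : unitClamp x ≤ unitClamp y :=
  max_le_max le_rfl (min_le_min h le_rfl)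

theorem abs_unitClamp_sub_le (x y : M.K) : |unitClamp x - unitClamp y| ≤ |x - y| := by
  unfold unitClamp
  rcases max_cases 0 (min x 1) with h | h <;> rcases max_cases 0 (min y 1) with h' | h' <;>
  rcases min_cases x 1 with g | g <;> rcases min_cases y 1 with g' | g' <;>
  rw [h.1, h'.1] <;> (try rw [g.1] at h ⊢) <;> (try rw [g'.1] at h' ⊢) <;>
  rcases abs_cases (x - y) with k | k <;> rw [abs_le] <;> constructor <;> linarith

theorem abs_unitClamp_sub_self_le {x r : M.K} (h0 : -r ≤ x) (h1 : x ≤ 1 + r) (hr : 0 ≤ r) :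
    |unitClamp x - x| ≤ r := by
  unfold unitClamp
  rcases max_cases 0 (min x 1) with h | h <;> rcases min_cases x 1 with g | g <;>
  rw [h.1] <;> (try rw [g.1] at h ⊢) <;> rw [abs_le] <;> constructor <;> linarith

instance RepK.unitClamp (f : Env M Γ → M.K) [RepK f] : RepK fun e => unitClamp (f e) := by
  simp only [Model.unitClamp]
  infer_instance

/-- The approximations to the point of `[0, 1]` given by an arbitrary function `p`. -/
noncomputable def approx (p : M.C t1) (n : M.N) : M.K :=
  krec (fun n y => max (y - tw (n + (1 + 1))) (min (unitClamp (seq p (n + (1 + 1 + 1))))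
    (y + tw (n + (1 + 1))))) (unitClamp (seq p (1 + 1))) n

instance RepK.approx (p : Env M Γ → M.C t1) (n : Env M Γ → M.N) [Rep p] [Rep n] :
    RepK fun e => approx (p e) (n e) := by
  simp only [Model.approx]
  infer_instance

theorem approx_zero (p : M.C t1) : approx p 0 = unitClamp (seq p (1 + 1)) := krec_zero _ _
theorem approx_succ (p : M.C t1) (n : M.N) : approx p (n + 1) =
    max (approx p n - tw (n + (1 + 1))) (min (unitClamp (seq p (n + (1 + 1 + 1))))
      (approx p n + tw (n + (1 + 1)))) := krec_succ _ _ _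

theorem approx_mem (p : M.C t1) (n : M.N) : 0 ≤ approx p n ∧ approx p n ≤ 1 := by
  refine Dec.induction (P := fun n => 0 ≤ approx p n ∧ approx p n ≤ 1) ?_ (fun n ih => ?_) n
  · rw [approx_zero]
    exact ⟨unitClamp_nonneg _, unitClamp_le_one _⟩
  · have h1 := unitClamp_nonneg (seq p (n + (1 + 1 + 1)))
    have h2 := unitClamp_le_one (seq p (n + (1 + 1 + 1)))
    have h3 := tw_pos (n + (1 + 1))
    rw [approx_succ]
    exact ⟨le_max_of_le_right (le_min h1 (by linarith)), max_le (by linarith) (min_le_of_left_le h2)⟩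

theorem abs_approx_sub_lt (p : M.C t1) {n m : M.N} (h : n ≤ m) :
    |approx p m - approx p n| < tw (n + 1) := by
  obtain ⟨i, rfl⟩ := exists_add_of_le h
  suffices H : |approx p (n + i) - approx p n| ≤ tw (n + 1) - tw (n + i + 1) by
    have := tw_pos (n + i + 1); linarith
  refine Dec.induction (P := fun i => |approx p (n + i) - approx p n| ≤
    tw (n + 1) - tw (n + i + 1)) (by simp) (fun i ih => ?_) i
  have hs := approx_succ p (n + i)
  have h3 := tw_pos (n + i + (1 + 1))
  have h4 : |approx p (n + i + 1) - approx p (n + i)| ≤ tw (n + i + (1 + 1)) := by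
    rw [hs, abs_le]
    constructor
    · linarith [le_max_left (approx p (n + i) - tw (n + i + (1 + 1)))
        (min (unitClamp (seq p (n + i + (1 + 1 + 1)))) (approx p (n + i) + tw (n + i + (1 + 1))))]
    · rw [sub_le_iff_le_add']
      exact max_le (by linarith) (min_le_right _ _)
  have h5 : tw (n + i + 1) = tw (n + i + (1 + 1)) + tw (n + i + (1 + 1)) := by
    rw [← add_assoc (n + i), tw_succ (n + i + 1)]; ring
  have h6 : tw (n + (i + 1) + 1) = tw (n + i + (1 + 1)) := by congr 1; ring
  rw [h6, ← add_assoc]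
  have := abs_sub_le (approx p (n + i + 1)) (approx p (n + i)) (approx p n)
  linarith

theorem approx_eq {p : M.C t1} (hp : IsReal p) (n : M.N) :
    approx p n = unitClamp (seq p (n + (1 + 1))) := by
  refine Dec.induction (P := fun n => approx p n = unitClamp (seq p (n + (1 + 1)))) ?_
    (fun n ih => ?_) n
  · rw [approx_zero, zero_add]
  · rw [approx_succ, ih]
    have h1 := (abs_unitClamp_sub_le (seq p (n + (1 + 1 + 1))) (seq p (n + (1 + 1)))).trans_lt
      (hp.abs_lt (show n + (1 + 1) ≤ n + (1 + 1 + 1) by rw [← add_assoc n (1 + 1)]; exact le_self_add))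
    rw [abs_sub_lt_iff] at h1
    rw [min_eq_left (by linarith), max_eq_right (by linarith)]
    congr 2
    ring

end Model
end HigherOrderArith

namespace HigherOrderArith
open FinType

namespace Model

variable {M : Model} {Γ : List FinType} {σ τ : FinType}

/-! ## Finite maxima and sums of numbers -/

/-- The maximum of `0` and `f 0, …, f (n - 1)`. -/
noncomputable def kmax (n : M.N) (f : M.N → M.K) : M.K := krec (fun i s => max s (f i)) 0 n

instance repK_kmax (f : Env M Γ → M.N → M.K) (n : Env M Γ → M.N)
    [RepK (Γ := .zero :: Γ) fun e : Env M (_ :: Γ) => f e.2 e.1] [Rep n] :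
    RepK fun e => kmax (n e) (f e) := by
  have : RepK (Γ := .zero :: .zero :: Γ) fun e : Env M (_ :: _ :: Γ) => f e.2.2 e.2.1 :=
    RepK.weaken fun e : Env M (.zero :: Γ) => f e.2 e.1
  exact inferInstanceAs (RepK fun e => krec (fun i s => max s (f e i)) 0 (n e))

section

variable (f : M.N → M.K) [RepK (Γ := [.zero]) fun e : Env M _ => f e.1]

theorem kmax_zero : kmax 0 f = 0 := by
  have := RepK.comp (Γ := [.zero, .zero]) f fun e => e.2.1
  exact krec_zero (fun i s => max s (f i)) 0

theorem kmax_succ (n : M.N) : kmax (n + 1) f = max (kmax n f) (f n) := by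
  have := RepK.comp (Γ := [.zero, .zero]) f fun e => e.2.1
  exact krec_succ (fun i s => max s (f i)) 0 n

variable {f}

theorem kmax_nonneg (n : M.N) : 0 ≤ kmax n f :=
  Dec.induction (P := fun n => 0 ≤ kmax n f) (kmax_zero f).ge
    (fun n ih => by rw [kmax_succ]; exact le_max_of_le_left ih) n

theorem le_kmax {n i : M.N} (h : i < n) : f i ≤ kmax n f := by
  refine Dec.induction (P := fun n => i < n → f i ≤ kmax n f)
    (fun h => (not_lt_zero _ h).elim) (fun n ih h => ?_) n h
  rw [kmax_succ]
  rcases lt_succ.1 h with h | rfl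
  · exact le_max_of_le_left (ih h)
  · exact le_max_right _ _

theorem kmax_le {n : M.N} {B : M.K} (hB : 0 ≤ B) (h : ∀ i, i < n → f i ≤ B) : kmax n f ≤ B := by
  refine Dec.induction (P := fun k => k ≤ n → kmax k f ≤ B) (fun _ => (kmax_zero f).le.trans hB)
    (fun k ih hk => ?_) n le_rfl
  rw [kmax_succ]
  exact max_le (ih (le_self_add.trans hk)) (h k (succ_le_iff.1 hk))

end

/-- `f 0 + ⋯ + f (n - 1)`. -/
noncomputable def nsum (n : M.N) (f : M.N → M.N) : M.N := prec (fun i s => s + f i) 0 n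

instance rep_nsum (f : Env M Γ → M.N → M.N) (n : Env M Γ → M.N)
    [Rep (Γ := .zero :: Γ) fun e : Env M (_ :: Γ) => f e.2 e.1] [Rep n] :
    Rep fun e => nsum (n e) (f e) := by
  have : Rep (Γ := .zero :: .zero :: Γ) fun e : Env M (_ :: _ :: Γ) => f e.2.2 e.2.1 :=
    Rep.weaken fun e : Env M (.zero :: Γ) => f e.2 e.1
  exact inferInstanceAs (Rep fun e => prec (fun i s => s + f e i) 0 (n e))

theorem le_nsum (f : M.N → M.N) [Rep (Γ := [.zero]) fun e : Env M _ => f e.1] {n i : M.N}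
    (h : i < n) : f i ≤ nsum n f := by
  have : Rep (Γ := [.zero, .zero]) fun e : Env M _ => f e.2.1 :=
    rep_comp f fun e : Env M [.zero, .zero] => e.2.1
  refine Dec.induction (P := fun n => i < n → f i ≤ nsum n f)
    (fun h => (not_lt_zero _ h).elim) (fun n ih h => ?_) n h
  have hs : nsum (n + 1) f = nsum n f + f n := prec_succ (fun i s => s + f i) 0 n
  rw [hs]
  rcases lt_succ.1 h with h | rfl
  · exact (ih h).trans le_self_add
  · exact le_add_self

/-! ## Finite sequences of functions coded by a function -/

/-- The member with index `i` of the sequence of length `d 0` coded by `d`. -/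
noncomputable def comp (d : M.C t1) (i : M.N) : M.C t1 := lam fun n => d (pair i n + 1)

instance rep_comp_seq (d : Env M Γ → M.C t1) (i : Env M Γ → M.N) [Rep d] [Rep i] :
    Rep fun e => comp (d e) (i e) := by
  simp only [comp]
  infer_instance

theorem exists_comp_eq (L : M.N) (W : M.N → M.N → M.N)
    [Rep (Γ := [.zero, .zero]) fun e : Env M _ => W e.2.1 e.1] :
    ∃ d : M.C t1, d 0 = L ∧ ∀ i n, comp d i n = W i n := by
  classical
  have h1 : Rep (Γ := [.zero]) fun e : Env M _ => W (fst (pred e.1)) (snd (pred e.1)) :=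
    rep_comp₂ W (fun e : Env M [.zero] => fst (pred e.1)) fun e => snd (pred e.1)
  refine ⟨lam fun z => if z = 0 then L else W (fst (pred z)) (snd (pred z)), ?_, fun i n => ?_⟩
  · rw [lam_app, if_pos rfl]
  · rw [comp, lam_app, lam_app, if_neg, pred_succ, fst_pair, snd_pair]
    exact (lt_of_le_of_lt zero_le (lt_succ.2 (.inr rfl))).ne'

/-! ## The net -/

/-- The function with value `1` near the center `qv (fst k)` and `0` far from it, at the scale
`2 ^ (-snd k)`. -/
noncomputable def tent (k : M.N) (q : M.K) : M.K :=
  unitClamp (2 - (pow2 (snd k) : M.N) * |q - qv (fst k)|)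

instance repK_tent (k : Env M Γ → M.N) (q : Env M Γ → M.K) [Rep k] [RepK q] :
    RepK fun e => tent (k e) (q e) := by
  simp only [tent]
  infer_instance

theorem tent_eq_one {k : M.N} {q : M.K} (h : |q - qv (fst k)| ≤ tw (snd k)) : tent k q = 1 := by
  have h1 := mul_le_mul_of_nonneg_left h (pow2_pos (snd k)).le
  rw [pow2_mul_tw] at h1
  rw [tent, unitClamp, min_eq_right (by linarith), max_eq_right zero_le_one]

theorem lt_of_tent_pos {k : M.N} {q : M.K} (h : 0 < tent k q) :
    |q - qv (fst k)| < 2 * tw (snd k) := by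
  by_contra! h'
  have h1 := mul_le_mul_of_nonneg_left h' (pow2_pos (snd k)).le
  rw [mul_left_comm, pow2_mul_tw] at h1
  rw [tent, unitClamp, max_eq_left ((min_le_left _ _).trans (by linarith))] at h
  exact h.false

theorem tent_le_add (k : M.N) (q q' : M.K) :
    tent k q ≤ tent k q' + (pow2 (snd k) : M.N) * |q - q'| := by
  have h1 := (abs_le.1 (abs_unitClamp_sub_le (2 - ((pow2 (snd k) : M.N) : M.K) * |q - qv (fst k)|)
    (2 - ((pow2 (snd k) : M.N) : M.K) * |q' - qv (fst k)|))).2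
  have h2 : |(2 - (pow2 (snd k) : M.N) * |q - qv (fst k)|) -
      (2 - (pow2 (snd k) : M.N) * |q' - qv (fst k)|)| ≤ (pow2 (snd k) : M.N) * |q - q'| := by
    rw [show (2 - (pow2 (snd k) : M.N) * |q - qv (fst k)|) -
      (2 - (pow2 (snd k) : M.N) * |q' - qv (fst k)|) =
        (pow2 (snd k) : M.N) * (|q' - qv (fst k)| - |q - qv (fst k)|) by ring, abs_mul,
      abs_of_pos (pow2_pos _)]
    refine mul_le_mul_of_nonneg_left ((abs_abs_sub_abs_le _ _).trans ?_) (pow2_pos _).le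
    rw [sub_sub_sub_cancel_right, abs_sub_comm]
  have h3 := h1.trans h2
  rw [tent, tent]
  linarith

variable (κ : M.C t2)

/-- Every key of `d` is a key of `e`. -/
def Refines (d e : M.C t1) : Prop := ∀ i, i < d 0 → ∃ j, j < e 0 ∧ κ (comp d i) = κ (comp e j)

theorem Refines.refl (d : M.C t1) : Refines κ d d := fun i hi => ⟨i, hi, rfl⟩

variable {κ} in
theorem Refines.trans {a b c : M.C t1} (h : Refines κ a b) (h' : Refines κ b c) :
    Refines κ a c := fun i hi => by
  obtain ⟨j, hj, h1⟩ := h i hi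
  obtain ⟨k, hk, h2⟩ := h' j hj
  exact ⟨k, hk, h1.trans h2⟩

theorem Refines.directed (a b : M.C t1) : ∃ c, Refines κ a c ∧ Refines κ b c := by
  classical
  obtain ⟨c, hc, h⟩ := exists_comp_eq (a 0 + b 0)
    (fun i n => if i < a 0 then comp a i n else comp b (i - a 0) n)
  refine ⟨c, fun i hi => ⟨i, ?_, ?_⟩, fun i hi => ⟨a 0 + i, ?_, ?_⟩⟩
  · rw [hc]
    exact hi.trans_le le_self_add
  · congr 1
    exact M.ext _ _ fun n => by rw [h, if_pos hi]
  · rw [hc]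
    exact (add_lt_add_iff_left _).2 hi
  · congr 1
    exact M.ext _ _ fun n => by rw [h, if_neg (not_lt.2 le_self_add), add_tsub_cancel_left]

/-- The member of the net with index `d`, as a function of fractions. -/
noncomputable def netVal (d : M.C t1) (q : M.K) : M.K := kmax (d 0) fun i => tent (κ (comp d i)) q

instance repK_netVal (d : Env M Γ → M.C t1) (q : Env M Γ → M.K) [Rep d] [RepK q] :
    RepK fun e => netVal κ (d e) (q e) := by
  simp only [netVal]
  infer_instance

/-- A bound for the scales of the keys of `d`. -/
noncomputable def scale (d : M.C t1) : M.N := nsum (d 0) fun i => snd (κ (comp d i))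

instance rep_scale (d : Env M Γ → M.C t1) [Rep d] : Rep fun e => scale κ (d e) := by
  simp only [scale]
  infer_instance

theorem snd_le_scale {d : M.C t1} {i : M.N} (h : i < d 0) : snd (κ (comp d i)) ≤ scale κ d :=
  le_nsum (fun i => snd (κ (comp d i))) h

theorem netVal_nonneg (d : M.C t1) (q : M.K) : 0 ≤ netVal κ d q := kmax_nonneg _

theorem netVal_le_one (d : M.C t1) (q : M.K) : netVal κ d q ≤ 1 :=
  kmax_le zero_le_one fun _ _ => unitClamp_le_one _

theorem tent_le_netVal {d : M.C t1} {i : M.N} (h : i < d 0) (q : M.K) :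
    tent (κ (comp d i)) q ≤ netVal κ d q :=
  le_kmax (f := fun i => tent (κ (comp d i)) q) h

theorem exists_of_netVal_pos {d : M.C t1} {q : M.K} (h : 0 < netVal κ d q) :
    ∃ i, i < d 0 ∧ |q - qv (fst (κ (comp d i)))| < 2 * tw (snd (κ (comp d i))) := by
  by_contra! h'
  refine h.not_ge (kmax_le le_rfl fun i hi => ?_)
  by_contra! h2
  exact (lt_of_tent_pos h2).not_ge (h' i hi)

variable {κ} in
theorem Refines.netVal_le {d e : M.C t1} (h : Refines κ d e) (q : M.K) :
    netVal κ d q ≤ netVal κ e q :=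
  kmax_le (netVal_nonneg κ e q) fun i hi => by
    obtain ⟨j, hj, h⟩ := h i hi
    rw [h]
    exact tent_le_netVal κ hj q

theorem pow2_mono {m n : M.N} (h : m ≤ n) : ((pow2 m : M.N) : M.K) ≤ (pow2 n : M.N) := by
  have h1 := tw_anti h
  rwa [tw, tw, inv_le_inv₀ (pow2_pos _) (pow2_pos _)] at h1

theorem abs_netVal_sub_le (d : M.C t1) (q q' : M.K) :
    |netVal κ d q - netVal κ d q'| ≤ (pow2 (scale κ d) : M.N) * |q - q'| := by
  have key (q q' : M.K) : netVal κ d q ≤ netVal κ d q' + (pow2 (scale κ d) : M.N) * |q - q'| := by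
    have h0 := mul_nonneg (pow2_pos (scale κ d)).le (abs_nonneg (q - q'))
    refine kmax_le (add_nonneg (netVal_nonneg κ d q') h0) fun i hi => (tent_le_add _ q q').trans ?_
    exact add_le_add (tent_le_netVal κ hi q')
      (mul_le_mul_of_nonneg_right (pow2_mono (snd_le_scale κ hi)) (abs_nonneg _))
  have h1 := key q q'
  have h2 := key q' q
  rw [abs_sub_comm q' q] at h2
  rw [abs_sub_le_iff]
  constructor <;> linarith

theorem exists_net : ∃ F : M.C tnet, ∀ d x n,
    seq (F d x) n = netVal κ d (seq x (n + (scale κ d + 1))) := by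
  have h0 : RepK (Γ := [.zero, t1, t1]) fun e : Env M _ =>
    netVal κ e.2.2.1 (seq e.2.1 (e.1 + (scale κ e.2.2.1 + 1))) := inferInstance
  obtain ⟨c, hc, h⟩ := h0.out
  have h1 : Rep (Γ := [t1, t1]) fun e : Env M _ => lam fun n : M.N => c (n, e.1, e.2.1, ()) :=
    rep_lam (h := hc)
  have h2 : Rep (Γ := [t1]) fun e : Env M _ => lam fun x => lam fun n : M.N => c (n, x, e.1, ()) :=
    rep_lam (h := h1)
  obtain ⟨F, hF⟩ := Rep.exists_obj fun d : M.C t1 => lam fun x : M.C t1 => lam fun n : M.N =>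
    c (n, x, d, ())
  refine ⟨F, fun d x n => ?_⟩
  have h3 := Rep.specialize (fun e : Env M [t1, t1] => lam fun n : M.N => c (n, e.1, e.2.1, ()))
    (d, ())
  have h4 := Rep.specialize c (x, d, ())
  rw [seq, hF, lam_app (fun x => lam fun n : M.N => c (n, x, d, ())),
    lam_app (fun n : M.N => c (n, x, d, ()))]
  exact h (n, x, d, ())

end Model
end HigherOrderArith

namespace HigherOrderArith
open FinType

namespace Model

variable {M : Model} {Γ : List FinType} {σ τ : FinType}

/-! ## Riemann sums of Lipschitz functions -/

theorem tw_natCast (n : ℕ) : tw (n : M.N) = (1 / 2) ^ n := by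
  induction n with
  | zero => simp
  | succ n ih => rw [Nat.cast_succ, tw_succ, ih, pow_succ]; ring

theorem tw_ofNat (n : ℕ) [n.AtLeastTwo] : tw (OfNat.ofNat n : M.N) = (1 / 2) ^ n :=
  tw_natCast n

/-- A function of fractions that is represented on codes. -/
class RepFun (G : M.K → M.K) : Prop where
  out : RepK (Γ := [.zero]) fun e : Env M _ => G (qv e.1)

instance RepFun.comp (G : M.K → M.K) [hG : RepFun G] (f : Env M Γ → M.K) [hf : RepK f] :
    RepK fun e => G (f e) := by
  obtain ⟨c, hc, h⟩ := hf.out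
  have := hG.out
  have := RepK.comp (fun n => G (qv n)) c
  simpa only [h] using this

/-- The length of the part of the cell `[j / 2 ^ m, (j + 1) / 2 ^ m]` to the left of `x`. -/
noncomputable def cell (m j : M.N) (x : M.K) : M.K := max 0 (min (x - j * tw m) (tw m))

instance repK_cell (m j : Env M Γ → M.N) (x : Env M Γ → M.K) [Rep m] [Rep j] [RepK x] :
    RepK fun e => cell (m e) (j e) (x e) := by
  simp only [cell]
  infer_instance

theorem cell_mono (m j : M.N) {x y : M.K} (h : x ≤ y) : cell m j x ≤ cell m j y :=
  max_le_max le_rfl (min_le_min (sub_le_sub_right h _) le_rfl)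

theorem ksum_cell (m n : M.N) {x : M.K} (h : 0 ≤ x) :
    ksum n (fun j => cell m j x) = min x (n * tw m) := by
  refine Dec.induction (P := fun n => ksum n (fun j => cell m j x) = min x (n * tw m))
    (by rw [ksum_zero, cast_zero, zero_mul, min_eq_right h]) (fun n ih => ?_) n
  have h1 := tw_pos m
  rw [ksum_succ, ih, cell, cast_add, cast_one, add_mul, one_mul]
  rcases le_total x (n * tw m) with h2 | h2
  · rw [min_eq_left h2, min_eq_left (by linarith), min_eq_left (by linarith),
      max_eq_left (by linarith), add_zero]
  · rw [min_eq_right h2]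
    rcases le_total x (n * tw m + tw m) with h3 | h3
    · rw [min_eq_left h3, min_eq_left (by linarith), max_eq_right (by linarith)]
      ring
    · rw [min_eq_right h3, min_eq_right (by linarith), max_eq_right h1.le]

theorem ksum_cell_eq (m : M.N) {x : M.K} (h : 0 ≤ x) (h1 : x ≤ 1) :
    ksum (pow2 m) (fun j => cell m j x) = x := by
  rw [ksum_cell m _ h, pow2_mul_tw, min_eq_left h1]

/-- The integral of the step function on the cells of length `2 ^ (-m)` with the values of `G` at
the left ends, up to `x`. -/
noncomputable def stepInt (G : M.K → M.K) (m : M.N) (x : M.K) : M.K :=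
  ksum (pow2 m) fun j => G (j * tw m) * cell m j x

theorem stepInt_zero (G : M.K → M.K) (m : M.N) : stepInt G m 0 = 0 := by
  have h (j : M.N) : cell m j (0 : M.K) = 0 :=
    max_eq_left ((min_le_left _ _).trans (by
      have := mul_nonneg (cast_nonneg j) (tw_pos m).le; linarith))
  simp only [stepInt, h, mul_zero]
  rw [ksum_const, mul_zero]

section

variable (G : M.K → M.K) [hG : RepFun G]

instance repK_stepInt (m : Env M Γ → M.N) (x : Env M Γ → M.K) [Rep m] [RepK x] :
    RepK fun e => stepInt G (m e) (x e) := by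
  simp only [stepInt]
  infer_instance

theorem stepInt_one (m : M.N) : stepInt G m 1 = ksum (pow2 m) fun j => G (j * tw m) * tw m := by
  refine ksum_congr fun j hj => ?_
  have h1 := mul_le_mul_of_nonneg_right (cast_le.2 (succ_le_iff.2 hj)) (tw_pos m).le
  rw [pow2_mul_tw, cast_add, cast_one] at h1
  rw [cell, min_eq_right (by linarith), max_eq_right (tw_pos m).le]

variable {G}

theorem stepInt_sub (m : M.N) (x y : M.K) : stepInt G m y - stepInt G m x =
    ksum (pow2 m) fun j => G (j * tw m) * (cell m j y - cell m j x) := by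
  rw [stepInt, stepInt, ← ksum_sub]
  simp only [mul_sub]

theorem abs_stepInt_sub_le (h01 : ∀ q, 0 ≤ G q ∧ G q ≤ 1) (m : M.N) {x y : M.K} (hx : 0 ≤ x)
    (hy : y ≤ 1) (hxy : x ≤ y) : |stepInt G m y - stepInt G m x| ≤ y - x := by
  rw [stepInt_sub]
  refine (abs_ksum_le _).trans ?_
  calc ksum (pow2 m) (fun j => |G (j * tw m) * (cell m j y - cell m j x)|)
      ≤ ksum (pow2 m) fun j => cell m j y - cell m j x := by
        refine ksum_le_ksum fun j _ => ?_
        have h1 := sub_nonneg.2 (cell_mono m j hxy)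
        rw [abs_mul, abs_of_nonneg (h01 _).1, abs_of_nonneg h1]
        exact mul_le_of_le_one_left h1 (h01 _).2
    _ = y - x := by
        rw [ksum_sub, ksum_cell_eq m (hx.trans hxy) hy, ksum_cell_eq m hx (hxy.trans hy)]

/-- `G` is a Lipschitz function with constant `L`. -/
abbrev Lipschitz (G : M.K → M.K) (L : M.K) : Prop := ∀ q q', |G q - G q'| ≤ L * |q - q'|

theorem abs_mul_sub_stepInt_le {L : M.K} (hL : 0 ≤ L) (hG : Lipschitz G L) (m : M.N)
    {x y s η : M.K} (hx : 0 ≤ x ∧ x ≤ 1) (hy : 0 ≤ y ∧ y ≤ 1) (hsx : |s - x| ≤ η)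
    (hsy : |s - y| ≤ η) :
    |G s * (y - x) - (stepInt G m y - stepInt G m x)| ≤ L * (η + tw m) * |y - x| := by
  wlog hxy : x ≤ y generalizing x y
  · have := this hy hx hsy hsx (le_of_not_ge hxy)
    rw [abs_sub_comm y x]
    convert this using 1
    rw [← abs_neg]
    congr 1
    ring
  have h1 := tw_pos m
  rw [abs_le] at hsx hsy
  have e1 : G s * (y - x) - (stepInt G m y - stepInt G m x) =
      ksum (pow2 m) fun j => (G s - G (j * tw m)) * (cell m j y - cell m j x) := by
    rw [stepInt_sub]
    nth_rw 1 [← ksum_cell_eq m hx.1 hx.2, ← ksum_cell_eq m hy.1 hy.2]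
    rw [← ksum_sub, ← ksum_mul, ← ksum_sub]
    simp only [sub_mul]
  rw [e1, abs_of_nonneg (sub_nonneg.2 hxy)]
  refine (abs_ksum_le _).trans ?_
  calc ksum (pow2 m) (fun j => |(G s - G (j * tw m)) * (cell m j y - cell m j x)|)
      ≤ ksum (pow2 m) fun j => L * (η + tw m) * (cell m j y - cell m j x) := by
        refine ksum_le_ksum fun j _ => ?_
        have h2 := cell_mono m j hxy
        by_cases h3 : cell m j y = cell m j x
        · rw [h3, sub_self, mul_zero, mul_zero, abs_zero]
        rw [abs_mul, abs_of_nonneg (sub_nonneg.2 h2)]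
        refine mul_le_mul_of_nonneg_right ((hG _ _).trans (mul_le_mul_of_nonneg_left ?_ hL))
          (sub_nonneg.2 h2)
        have h4 : (j : M.K) * tw m ≤ y := by
          by_contra! h4
          refine h3 ?_
          rw [cell, cell, max_eq_left ((min_le_left _ _).trans (by linarith)),
            max_eq_left ((min_le_left _ _).trans (by linarith))]
        have h5 : x ≤ j * tw m + tw m := by
          by_contra! h5
          refine h3 ?_
          rw [cell, cell, min_eq_right (by linarith), min_eq_right (by linarith)]
        rw [abs_le]
        constructor <;> linarith [hsx.1, hsx.2, hsy.1, hsy.2]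
    _ = L * (η + tw m) * (y - x) := by
        rw [ksum_mul, ksum_sub, ksum_cell_eq m hx.1 hx.2, ksum_cell_eq m hy.1 hy.2]

theorem abs_riemannSum_sub_le {L : M.K} (hL : 0 ≤ L) (hG : Lipschitz G L) (m n : M.N)
    (b s : M.N → M.K) [RepK (Γ := [.zero]) fun e : Env M _ => b e.1]
    [RepK (Γ := [.zero]) fun e : Env M _ => s e.1] {η : M.K} (hb : ∀ j, 0 ≤ b j ∧ b j ≤ 1)
    (h : ∀ j, j < n → |s j - b j| ≤ η ∧ |s j - b (j + 1)| ≤ η) :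
    |ksum n (fun j => G (s j) * (b (j + 1) - b j)) - (stepInt G m (b n) - stepInt G m (b 0))| ≤
      L * (η + tw m) * ksum n fun j => |b (j + 1) - b j| := by
  have i1 := RepK.comp (Γ := [.zero]) b fun e => e.1 + 1
  rw [← ksum_telescope (f := fun j => stepInt G m (b j)), ← ksum_sub, ← ksum_mul]
  exact (abs_ksum_le _).trans (ksum_le_ksum fun j hj =>
    abs_mul_sub_stepInt_le hL hG m (hb j) (hb (j + 1)) (h j hj).1 (h j hj).2)

/-- The integrals of the step functions converge. -/
theorem abs_stepInt_one_sub_le {L : M.K} (hL : 0 ≤ L) (hG : Lipschitz G L) {m m' : M.N}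
    (h : m ≤ m') : |stepInt G m' 1 - stepInt G m 1| ≤ 2 * (L * tw m) := by
  have h1 := tw_pos m
  have hb (j : M.N) : 0 ≤ unitClamp ((j : M.K) * tw m) ∧ unitClamp ((j : M.K) * tw m) ≤ 1 :=
    ⟨unitClamp_nonneg _, unitClamp_le_one _⟩
  have hc {j : M.N} (hj : j ≤ pow2 m) : unitClamp ((j : M.K) * tw m) = j * tw m := by
    have h2 : (j : M.K) * tw m ≤ 1 := by
      rw [← pow2_mul_tw m]
      exact mul_le_mul_of_nonneg_right (cast_le.2 hj) h1.le
    rw [unitClamp, min_eq_left h2, max_eq_right (mul_nonneg (cast_nonneg j) h1.le)]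
  have hd {j : M.N} (hj : j < pow2 m) :
      unitClamp (((j + 1 : M.N) : M.K) * tw m) - unitClamp ((j : M.K) * tw m) = tw m := by
    rw [hc hj.le, hc (succ_le_iff.2 hj)]
    push_cast
    ring
  have key := abs_riemannSum_sub_le hL hG m' (pow2 m) (fun j => unitClamp ((j : M.K) * tw m))
    (fun j => unitClamp ((j : M.K) * tw m)) (η := tw m) hb fun j hj => by
      rw [sub_self, abs_zero, abs_sub_comm, hd hj, abs_of_pos h1]
      exact ⟨h1.le, le_rfl⟩
  have e1 : ksum (pow2 m) (fun j => G (unitClamp ((j : M.K) * tw m)) *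
      (unitClamp (((j + 1 : M.N) : M.K) * tw m) - unitClamp ((j : M.K) * tw m))) =
      stepInt G m 1 := by
    rw [stepInt_one]
    exact ksum_congr fun j hj => by rw [hd hj, hc hj.le]
  have e2 : ksum (pow2 m) (fun j =>
      |unitClamp (((j + 1 : M.N) : M.K) * tw m) - unitClamp ((j : M.K) * tw m)|) = 1 := by
    rw [← pow2_mul_tw m, ← ksum_const]
    exact ksum_congr fun j hj => by rw [hd hj, abs_of_pos h1]
  rw [e1, e2, hc le_rfl, pow2_mul_tw, hc zero_le, cast_zero, zero_mul, stepInt_zero, sub_zero,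
    abs_sub_comm, mul_one] at key
  refine key.trans ?_
  have := mul_le_mul_of_nonneg_left (tw_anti h) hL
  linarith

end

/-! ## Tagged partitions -/

end Model
end HigherOrderArith

namespace HigherOrderArith
open FinType

namespace Model

variable {M : Model}

/-! ## Tagged partitions -/

theorem cast_ofNat (n : ℕ) [n.AtLeastTwo] : ((OfNat.ofNat n : M.N) : M.K) = OfNat.ofNat n :=
  map_natCast castHom n

/-- An inequality up to `(c n + 1) 2 ^ (-k)` for all large `k` is an inequality. -/
theorem le_of_forall_tw {x y : M.K} (c N : M.N) (h : ∀ k, N ≤ k → x ≤ y + c * tw k) : x ≤ y := by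
  by_contra! h'
  obtain ⟨m, hm⟩ := exists_tw_lt (sub_pos.2 h')
  have h1 := h (N + (m + c)) le_self_add
  have h2 : (c : M.K) * tw (N + (m + c)) < tw m := by
    calc (c : M.K) * tw (N + (m + c)) = tw N * (c * tw c) * tw m := by rw [tw_add, tw_add]; ring
      _ ≤ 1 * (c * tw c) * tw m := by
        refine mul_le_mul_of_nonneg_right (mul_le_mul_of_nonneg_right (tw_le_one N) ?_) (tw_pos m).le
        exact mul_nonneg (cast_nonneg c) (tw_pos c).le
      _ < 1 * 1 * tw m := by
        rw [one_mul]
        exact mul_lt_mul_of_pos_right (by rw [one_mul]; exact cast_mul_tw_lt_one c) (tw_pos m)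
      _ = tw m := by ring
  linarith

namespace TaggedPartition

variable {n : M.N} {a t : M.C tseq}

theorem le_tag (h : TaggedPartition n a t) {i : M.N} (hi : i < n) (k : M.N) :
    seq (a i) k ≤ seq (t i) k + 2 * tw k :=
  (h.1 i hi.le).le_of_rle (h.2.2.2 i hi).1 (h.2.2.2 i hi).2.1 k

theorem tag_le (h : TaggedPartition n a t) {i : M.N} (hi : i < n) (k : M.N) :
    seq (t i) k ≤ seq (a (i + 1)) k + 2 * tw k :=
  (h.2.2.2 i hi).1.le_of_rle (h.1 (i + 1) (succ_le_iff.2 hi)) (h.2.2.2 i hi).2.2 k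

theorem le_succ (h : TaggedPartition n a t) {i : M.N} (hi : i < n) (k : M.N) :
    seq (a i) k ≤ seq (a (i + 1)) k + 4 * tw k := by
  linarith [h.le_tag hi k, h.tag_le hi k]

theorem abs_first_le (h : TaggedPartition n a t) (k : M.N) : |seq (a 0) k| ≤ tw k := by
  have h1 := (h.1 0 zero_le).le_const h.2.1.1 k
  have h2 := (h.1 0 zero_le).const_le h.2.1.2 k
  rw [abs_le]
  constructor <;> linarith

theorem abs_last_sub_le (h : TaggedPartition n a t) (k : M.N) : |seq (a n) k - 1| ≤ tw k := by
  have h1 := (h.1 n le_rfl).le_const h.2.2.1.1 k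
  have h2 := (h.1 n le_rfl).const_le h.2.2.1.2 k
  rw [abs_le]
  constructor <;> linarith

theorem first_le (h : TaggedPartition n a t) {i : M.N} (hi : i ≤ n) (k : M.N) :
    seq (a 0) k ≤ seq (a i) k + i * (4 * tw k) := by
  refine Dec.induction (P := fun i => i ≤ n → seq (a 0) k ≤ seq (a i) k + i * (4 * tw k))
    (fun _ => by simp) (fun i ih hi => ?_) i hi
  have h1 := ih (le_self_add.trans hi)
  have h2 := h.le_succ (succ_le_iff.1 hi) k
  push_cast
  linarith

theorem le_last (h : TaggedPartition n a t) {i : M.N} (hi : i ≤ n) (k : M.N) :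
    seq (a i) k ≤ seq (a n) k + (n - i : M.K) * (4 * tw k) := by
  suffices H : ∀ j, j ≤ n → seq (a (n - j)) k ≤ seq (a n) k + j * (4 * tw k) by
    have := H (n - i) tsub_le_self
    rwa [tsub_tsub_cancel_of_le hi, cast_sub hi] at this
  intro j
  refine Dec.induction (P := fun j => j ≤ n → seq (a (n - j)) k ≤ seq (a n) k + j * (4 * tw k))
    (fun _ => by simp) (fun j ih hj => ?_) j
  have h1 := ih (le_self_add.trans hj)
  have h2 := h.le_succ (i := n - (j + 1))
    (tsub_lt_self (lt_of_lt_of_le (lt_of_le_of_lt zero_le (succ_le_iff.1 hj)) le_rfl)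
      (lt_of_le_of_lt zero_le (lt_succ.2 (.inr rfl)))) k
  have h3 : n - (j + 1) + 1 = n - j := by
    rw [← tsub_tsub, tsub_add_cancel_of_le]
    exact le_tsub_of_add_le_left hj
  rw [h3] at h2
  push_cast
  linarith

/-- The points of a partition lie in `[0, 1]`. -/
theorem mem (h : TaggedPartition n a t) {i : M.N} (hi : i ≤ n) (k : M.N) :
    -tw k ≤ seq (a i) k ∧ seq (a i) k ≤ 1 + tw k := by
  constructor
  · refine le_of_forall_tw (i * 4 + 1) k fun m hm => ?_
    have h1 := abs_le.1 (h.abs_first_le m)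
    have h2 := h.first_le hi m
    have h3 := abs_lt.1 ((h.1 i hi).abs_lt hm)
    rw [cast_add, cast_mul, cast_ofNat, cast_one]
    linarith
  · refine le_of_forall_tw ((n - i) * 4 + 1) k fun m hm => ?_
    have h1 := abs_le.1 (h.abs_last_sub_le m)
    have h2 := h.le_last hi m
    have h3 := abs_lt.1 ((h.1 i hi).abs_lt hm)
    rw [cast_add, cast_mul, cast_ofNat, cast_one, cast_sub hi]
    linarith

theorem abs_unitClamp_sub_le (h : TaggedPartition n a t) {i : M.N} (hi : i ≤ n) (k : M.N) :
    |unitClamp (seq (a i) k) - seq (a i) k| ≤ tw k :=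
  abs_unitClamp_sub_self_le (h.mem hi k).1 (h.mem hi k).2 (tw_pos k).le

theorem abs_succ_sub_le (h : TaggedPartition n a t) {δ : M.C t1} {p : M.N}
    (hδ : ∀ k, seq δ k = tw p)
    (hm : ∀ i, i < n → RLe (fun k => seq (a (i + 1)) k - seq (a i) k) (seq δ)) {i : M.N}
    (hi : i < n) (k : M.N) : seq (a (i + 1)) k ≤ seq (a i) k + tw p + 2 * tw k := by
  have h1 := (hm i hi).le (k := k) (a := 2 * tw k) (b := 0) (fun m hk => by
      have h1 := abs_lt.1 ((h.1 i hi.le).abs_lt hk)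
      have h2 := abs_lt.1 ((h.1 (i + 1) (succ_le_iff.2 hi)).abs_lt hk)
      rw [abs_le]
      constructor <;> linarith) (fun m _ => by rw [hδ, hδ, sub_self, abs_zero])
  rw [hδ] at h1
  linarith

end TaggedPartition

end Model
end HigherOrderArith

namespace HigherOrderArith
open FinType

namespace Model

variable {M : Model}

/-! ## The Riemann integral of a Lipschitz function -/

theorem pow2_mul_tw_add (Λ k : M.N) : ((pow2 Λ : M.N) : M.K) * tw (k + Λ) = tw k := by
  rw [tw_add, mul_left_comm, pow2_mul_tw, mul_one]

theorem mul_tw_add_le (n k : M.N) : (n : M.K) * tw (k + n) ≤ tw k := by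
  rw [tw_add, mul_left_comm]
  exact mul_le_of_le_one_right (tw_pos k).le (cast_mul_tw_lt_one n).le

section

variable {G : M.K → M.K} {Λ c n : M.N} {a t : M.C tseq}

/-- The `k`-th approximation to the `j`-th summand of a Riemann sum with `n` summands. -/
noncomputable def summand (G : M.K → M.K) (c n : M.N) (a t : M.C tseq) (k j : M.N) : M.K :=
  G (seq (t j) (k + (n + 2) + c)) *
    (unitClamp (seq (a (j + 1)) (k + (n + 2))) - unitClamp (seq (a j) (k + (n + 2))))

instance repK_summand [RepFun G] {Γ : List FinType} (n : M.N) (a t : M.C tseq) (k j : Env M Γ → M.N) [Rep k]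
    [Rep j] : RepK fun e => summand G c n a t (k e) (j e) := by
  simp only [summand]
  infer_instance

theorem abs_mul_sub_mul_le (h01 : ∀ q, 0 ≤ G q ∧ G q ≤ 1) (hG : Lipschitz G (pow2 Λ : M.N))
    (hc : Λ ≤ c) {x : M.C t1} (hx : IsReal x) {u v η : M.K} {k l : M.N} (hkl : k ≤ l)
    (hu : |u| ≤ 1) (huv : |u - v| ≤ η) :
    |G (seq x (l + c)) * u - G (seq x (k + c)) * v| ≤ tw k + η := by
  have h1 : |G (seq x (l + c)) - G (seq x (k + c))| ≤ tw k := by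
    refine (hG _ _).trans ((mul_le_mul_of_nonneg_left (hx.abs_lt (add_le_add_left hkl c)).le
      (pow2_pos Λ).le).trans ?_)
    rw [← pow2_mul_tw_add Λ k]
    exact mul_le_mul_of_nonneg_left (tw_anti (add_le_add_right hc k)) (pow2_pos Λ).le
  have h2 : G (seq x (l + c)) * u - G (seq x (k + c)) * v =
      (G (seq x (l + c)) - G (seq x (k + c))) * u + G (seq x (k + c)) * (u - v) := by ring
  rw [h2]
  refine (abs_add_le _ _).trans (add_le_add ?_ ?_)
  · rw [abs_mul]
    exact (mul_le_of_le_one_right (abs_nonneg _) hu).trans h1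
  · rw [abs_mul, abs_of_nonneg (h01 _).1]
    exact (mul_le_of_le_one_left (abs_nonneg _) (h01 _).2).trans huv

theorem abs_summand_sub_le (h01 : ∀ q, 0 ≤ G q ∧ G q ≤ 1) (hG : Lipschitz G (pow2 Λ : M.N))
    (hc : Λ ≤ c) (h : TaggedPartition n a t) {i k l : M.N} (hi : i < n) (hkl : k ≤ l) :
    |summand G c n a t l i - summand G c n a t k i| ≤ 3 * tw (k + (n + 2)) := by
  have hl : k + (n + 2) ≤ l + (n + 2) := add_le_add_left hkl _
  have h1 := (abs_unitClamp_sub_le _ _).trans ((h.1 i hi.le).abs_lt hl).le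
  have h2 := (abs_unitClamp_sub_le _ _).trans ((h.1 (i + 1) (succ_le_iff.2 hi)).abs_lt hl).le
  have h3 := unitClamp_nonneg (seq (a i) (l + (n + 2)))
  have h4 := unitClamp_le_one (seq (a i) (l + (n + 2)))
  have h5 := unitClamp_nonneg (seq (a (i + 1)) (l + (n + 2)))
  have h6 := unitClamp_le_one (seq (a (i + 1)) (l + (n + 2)))
  rw [abs_le] at h1 h2
  refine (abs_mul_sub_mul_le h01 hG hc (h.2.2.2 i hi).1 hl (η := 2 * tw (k + (n + 2)))
    ?_ ?_).trans (by linarith)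
  · rw [abs_le]
    constructor <;> linarith
  · rw [abs_le]
    constructor <;> linarith

theorem exists_partialSums [RepFun G] (h01 : ∀ q, 0 ≤ G q ∧ G q ≤ 1) (hG : Lipschitz G (pow2 Λ : M.N))
    (hc : Λ ≤ c) (h : TaggedPartition n a t) : ∃ S : M.C tseq,
    (∀ i k, seq (S i) k = ksum i fun j => summand G c n a t k j) ∧ (∀ i, i ≤ n → IsReal (S i)) ∧
    REq (seq (S 0)) (fun _ => 0) ∧ ∀ i, i < n → REq (seq (S (i + 1))) fun k =>
      seq (S i) k + G (seq (t i) (k + c)) * (seq (a (i + 1)) k - seq (a i) k) := by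
  obtain ⟨S, hS⟩ := RepK.exists_seq₂ fun i k : M.N => ksum i fun j => summand G c n a t k j
  refine ⟨S, hS, fun i hi => ?_, ?_, fun i hi => ?_⟩
  · refine .of_abs_lt fun k l hkl => ?_
    rw [hS, hS, ← ksum_sub]
    calc _ ≤ ksum i fun _ => 3 * tw (k + (n + 2)) := (abs_ksum_le _).trans
          (ksum_le_ksum fun j hj => abs_summand_sub_le h01 hG hc h (hj.trans_le hi) hkl)
      _ = (i : M.K) * (3 * tw (k + (n + 2))) := ksum_const _ _
      _ ≤ (n : M.K) * (3 * tw (k + (n + 2))) := mul_le_mul_of_nonneg_right (cast_le.2 hi)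
          (mul_nonneg (by norm_num) (tw_pos _).le)
      _ = 3 / 4 * ((n : M.K) * tw (k + n)) := by rw [← add_assoc, tw_add (k + n), tw_ofNat]; ring
      _ < tw k := by linarith [mul_tw_add_le n k, tw_pos k]
  · rw [show seq (S 0) = fun _ => 0 from funext fun k => by rw [hS, ksum_zero]]
    exact .refl _
  · refine .of_abs_le 7 0 fun k _ => ?_
    have hl : k ≤ k + (n + 2) := le_self_add
    have e1 := abs_le.1 (h.abs_unitClamp_sub_le hi.le (k + (n + 2)))
    have e2 := abs_le.1 (h.abs_unitClamp_sub_le (succ_le_iff.2 hi) (k + (n + 2)))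
    have e3 := abs_lt.1 ((h.1 i hi.le).abs_lt hl)
    have e4 := abs_lt.1 ((h.1 (i + 1) (succ_le_iff.2 hi)).abs_lt hl)
    have e5 := tw_anti hl
    have h3 := unitClamp_nonneg (seq (a i) (k + (n + 2)))
    have h4 := unitClamp_le_one (seq (a i) (k + (n + 2)))
    have h5 := unitClamp_nonneg (seq (a (i + 1)) (k + (n + 2)))
    have h6 := unitClamp_le_one (seq (a (i + 1)) (k + (n + 2)))
    rw [hS, hS, ksum_succ, add_sub_add_left_eq_sub]
    refine (abs_mul_sub_mul_le h01 hG hc (h.2.2.2 i hi).1 hl (η := 4 * tw k) ?_ ?_).trans ?_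
    · rw [abs_le]
      constructor <;> linarith
    · rw [abs_le]
      constructor <;> linarith
    · rw [cast_ofNat]
      linarith [tw_pos k]

theorem abs_ksum_summand_sub_le [RepFun G] (h01 : ∀ q, 0 ≤ G q ∧ G q ≤ 1)
    (hG : Lipschitz G (pow2 Λ : M.N)) (h : TaggedPartition n a t) {δ : M.C t1} {p : M.N} (hδ : ∀ k, seq δ k = tw p)
    (hm : ∀ i, i < n → RLe (fun k => seq (a (i + 1)) k - seq (a i) k) (seq δ)) (k : M.N) :
    |ksum n (fun j => summand G c n a t k j) - stepInt G (k + (Λ + 3)) 1| ≤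
      ((pow2 Λ : M.N) : M.K) * (tw p + 6 * tw k) * 3 + tw k := by
  have hr : 4 * tw (k + (n + 2)) = tw (k + n) := by rw [← add_assoc, tw_add (k + n), tw_ofNat]; ring
  have hr' : tw (k + n) ≤ tw k := tw_anti le_self_add
  have hr0 := tw_pos (k + (n + 2))
  set r := k + (n + 2) with hrd
  have hL := (pow2_pos Λ).le
  have key := abs_riemannSum_sub_le hL hG (k + (Λ + 3)) n (fun j => unitClamp (seq (a j) r))
    (fun j => seq (t j) (r + c)) (η := tw p + 7 * tw r)
    (fun j => ⟨unitClamp_nonneg _, unitClamp_le_one _⟩) fun j hj => by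
      have e1 := abs_le.1 (h.abs_unitClamp_sub_le hj.le r)
      have e2 := abs_le.1 (h.abs_unitClamp_sub_le (succ_le_iff.2 hj) r)
      have e3 := h.le_tag hj r
      have e4 := h.tag_le hj r
      have e5 := h.abs_succ_sub_le hδ hm hj r
      have e6 := abs_lt.1 ((h.2.2.2 j hj).1.abs_lt (le_self_add : r ≤ r + c))
      have e7 := tw_pos p
      rw [abs_le, abs_le]
      refine ⟨⟨?_, ?_⟩, ?_, ?_⟩ <;> linarith
  have hsum : ksum n (fun j => |unitClamp (seq (a (j + 1)) r) - unitClamp (seq (a j) r)|) ≤ 3 := by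
    have e1 : ∀ j, j < n → |unitClamp (seq (a (j + 1)) r) - unitClamp (seq (a j) r)| ≤
        unitClamp (seq (a (j + 1)) r) - unitClamp (seq (a j) r) + 8 * tw r := fun j hj => by
      have e2 := h.le_succ hj r
      rcases le_total (seq (a j) r) (seq (a (j + 1)) r) with e3 | e3
      · rw [abs_of_nonneg (sub_nonneg.2 (unitClamp_mono e3))]
        linarith
      · have e4 := unitClamp_mono e3
        have e5 := abs_le.1 (Model.abs_unitClamp_sub_le (seq (a (j + 1)) r) (seq (a j) r))
        rw [abs_of_nonpos (sub_nonpos.2 e3)] at e5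
        rw [abs_of_nonpos (sub_nonpos.2 e4)]
        linarith [e5.1]
    refine (ksum_le_ksum e1).trans ?_
    rw [ksum_add, ksum_telescope (f := fun j => unitClamp (seq (a j) r)), ksum_const]
    have e6 : (n : M.K) * (8 * tw r) ≤ 2 := by
      have e7 := mul_tw_add_le n k
      rw [show (8 : M.K) * tw r = 2 * (4 * tw r) by ring, hr]
      linarith [tw_le_one k]
    have e8 := unitClamp_le_one (seq (a n) r)
    have e9 := unitClamp_nonneg (seq (a 0) r)
    linarith
  have e1 : tw (k + (Λ + 3)) ≤ tw k := tw_anti le_self_add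
  have e2 : ((pow2 Λ : M.N) : M.K) * (tw p + 7 * tw r + tw (k + (Λ + 3))) *
      ksum n (fun j => |unitClamp (seq (a (j + 1)) r) - unitClamp (seq (a j) r)|) ≤
      ((pow2 Λ : M.N) : M.K) * (tw p + 6 * tw k) * 3 := by
    have e3 := tw_pos p
    have e4 := tw_pos (k + (Λ + 3))
    refine mul_le_mul (mul_le_mul_of_nonneg_left (by linarith) hL) hsum ?_
      (mul_nonneg hL (by linarith [tw_pos k]))
    exact (abs_nonneg _).trans (abs_ksum_le (f := fun j =>
      unitClamp (seq (a (j + 1)) r) - unitClamp (seq (a j) r)) n)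
  have e3 : |stepInt G (k + (Λ + 3)) 1 - stepInt G (k + (Λ + 3)) (unitClamp (seq (a n) r))| ≤
      tw r := by
    have e4 := unitClamp_le_one (seq (a n) r)
    refine (abs_stepInt_sub_le h01 _ (unitClamp_nonneg _) le_rfl e4).trans ?_
    have e5 := Model.abs_unitClamp_sub_le 1 (seq (a n) r)
    have e6 := h.abs_last_sub_le r
    have e7 : unitClamp (1 : M.K) = 1 := by simp [unitClamp]
    rw [abs_sub_comm, abs_sub_comm 1, e7] at e5
    linarith [(abs_le.1 e5).1]
  have e4 : |stepInt G (k + (Λ + 3)) (unitClamp (seq (a 0) r)) - stepInt G (k + (Λ + 3)) 0| ≤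
      tw r := by
    refine (abs_stepInt_sub_le h01 _ le_rfl (unitClamp_le_one _) (unitClamp_nonneg _)).trans ?_
    have e5 := Model.abs_unitClamp_sub_le (seq (a 0) r) 0
    have e6 := h.abs_first_le r
    have e7 : unitClamp (0 : M.K) = 0 := by simp [unitClamp]
    rw [e7, sub_zero, sub_zero] at e5
    linarith [(abs_le.1 e5).2]
  rw [stepInt_zero, sub_zero] at e4
  change |ksum n (fun j => G (seq (t j) (r + c)) * (unitClamp (seq (a (j + 1)) r) -
    unitClamp (seq (a j) r))) - _| ≤ _
  rw [abs_le] at key e3 e4 ⊢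
  constructor <;> linarith [key.1, key.2]

end

theorem exists_riemannIntegral {G : M.K → M.K} [RepFun G] (h01 : ∀ q, 0 ≤ G q ∧ G q ≤ 1)
    {Λ c : M.N} (hG : Lipschitz G (pow2 Λ : M.N)) (hc : Λ ≤ c) : ∃ A : M.C t1, IsReal A ∧
      (∀ k, seq A k = stepInt G (k + (Λ + 3)) 1) ∧ ∀ g : M.C t1 → M.N → M.K,
        (∀ x n, g x n = G (seq x (n + c))) → IsRiemannIntegral g A := by
  obtain ⟨A, hA⟩ := RepK.exists_seq fun k : M.N => stepInt G (k + (Λ + 3)) 1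
  have hL := (pow2_pos Λ).le
  refine ⟨A, .of_abs_lt fun k l hkl => ?_, hA, fun g hg ε hε hε0 => ?_⟩
  · rw [hA, hA]
    refine (abs_stepInt_one_sub_le hL hG (add_le_add_left hkl _)).trans_lt ?_
    rw [show k + (Λ + 3) = k + 3 + Λ by ring, pow2_mul_tw_add, tw_add, tw_ofNat]
    linarith [tw_pos k]
  obtain ⟨m, N, hmN⟩ := hε0.exists_tw_le
  obtain ⟨δ, hδ, hδ'⟩ := exists_const (tw (m + 4 + Λ) : M.K)
  refine ⟨δ, hδ, .of_const (tw_pos _) hδ', fun n a t h hm => ?_⟩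
  obtain ⟨S, hS, h1, h2, h3⟩ := exists_partialSums h01 hG hc h
  refine ⟨S, h1, h2, ?_, m + 1, N + (m + 7 + Λ), fun k hk => ?_⟩
  · simpa only [hg] using h3
  · have h4 := abs_ksum_summand_sub_le (c := c) h01 hG h hδ' hm k
    change |seq (S n) k - seq A k| + _ ≤ _
    rw [hS, hA]
    refine le_trans ?_ (hmN k (le_self_add.trans hk))
    have h5 : tw k ≤ tw (m + 7 + Λ) := tw_anti (le_add_self.trans hk)
    have h6 : ((pow2 Λ : M.N) : M.K) * tw k ≤ tw (m + 7) := by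
      rw [← pow2_mul_tw_add Λ (m + 7)]
      exact mul_le_mul_of_nonneg_left h5 hL
    have h7 : tw k ≤ tw (m + 7) := h5.trans (tw_anti le_self_add)
    rw [mul_add, mul_left_comm, pow2_mul_tw_add] at h4
    rw [tw_add m, tw_ofNat] at h4 h6 h7
    rw [tw_succ]
    linarith [tw_pos m]

end Model
end HigherOrderArith

namespace HigherOrderArith
open FinType

namespace Model

variable {M : Model} {Γ : List FinType}

/-! ## Grid cells in a finite union of intervals -/

theorem ksum_comm (f : M.N → M.N → M.K) [RepK (Γ := [.zero, .zero]) fun e : Env M _ => f e.2.1 e.1]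
    (m n : M.N) : ksum m (fun i => ksum n fun j => f i j) = ksum n fun j => ksum m fun i => f i j := by
  have h1 : RepK (Γ := [.zero]) fun e : Env M _ => ksum n fun j => f e.1 j := by
    have : RepK (Γ := [.zero, .zero]) fun e : Env M _ => f e.2.1 e.1 := inferInstance
    infer_instance
  have h2 : RepK (Γ := [.zero, .zero]) fun e : Env M _ => ksum e.2.1 fun i => f i e.1 := by
    have : RepK (Γ := [.zero, .zero, .zero]) fun e : Env M _ => f e.1 e.2.1 :=
      RepK.comp₂ f (fun e : Env M [.zero, .zero, .zero] => e.1) fun e => e.2.1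
    infer_instance
  have h3 (i : M.N) : RepK (Γ := [.zero]) fun e : Env M _ => f i e.1 :=
    RepK.comp₂ f (fun _ : Env M [.zero] => i) fun e => e.1
  have h4 (j : M.N) : RepK (Γ := [.zero]) fun e : Env M _ => f e.1 j :=
    RepK.comp₂ f (fun e : Env M [.zero] => e.1) fun _ => j
  have h5 (m : M.N) : RepK (Γ := [.zero]) fun e : Env M _ => ksum m fun i => f i e.1 :=
    RepK.comp₂ (fun m j => ksum m fun i => f i j) (fun _ : Env M [.zero] => m) fun e => e.1
  have h6 : RepK (Γ := [.zero]) fun e : Env M _ => ksum e.1 fun i => ksum n fun j => f i j := by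
    have : RepK (Γ := [.zero, .zero]) fun e : Env M _ => ksum n fun j => f e.1 j :=
      RepK.comp (fun i => ksum n fun j => f i j) fun e : Env M [.zero, .zero] => e.1
    infer_instance
  have h7 : RepK (Γ := [.zero]) fun e : Env M _ => ksum n fun j => ksum e.1 fun i => f i j :=
    repK_ksum (Γ := [.zero]) (fun e j => ksum e.1 fun i => f i j) fun _ => n
  refine Dec.induction (P := fun m => ksum m (fun i => ksum n fun j => f i j) =
    ksum n fun j => ksum m fun i => f i j) ?_ (fun m ih => ?_) m
  · simp only [ksum_zero]
    rw [ksum_const, mul_zero]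
  · rw [ksum_succ, ih, ← ksum_add]
    exact ksum_congr fun j _ => (ksum_succ (fun i => f i j) m).symm

section

variable (m L : M.N) (α β : M.N → M.K)

/-- The cell with index `k` lies outside of the `l`-th interval. -/
def Outside (k l : M.N) : Prop := (k + 1) * tw m ≤ α l - tw m ∨ β l + tw m ≤ k * tw m

/-- The cell with index `k` lies inside the `l`-th interval. -/
def Inside (k l : M.N) : Prop := α l + tw m ≤ k * tw m ∧ (k + 1) * tw m ≤ β l - tw m

/-- The cell with index `k` lies in the difference of an interval and the intervals before it. -/
def Good (k : M.N) : Prop := ∃ i, i < L ∧ Inside m α β k i ∧ ∀ l, l < i → Outside m α β k l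

variable [RepK (Γ := [.zero]) fun e : Env M _ => α e.1]
  [RepK (Γ := [.zero]) fun e : Env M _ => β e.1]

instance dec_outside (k l : Env M Γ → M.N) [Rep k] [Rep l] :
    Dec fun e => Outside m α β (k e) (l e) := by
  simp only [Outside]
  infer_instance

instance dec_inside (k l : Env M Γ → M.N) [Rep k] [Rep l] :
    Dec fun e => Inside m α β (k e) (l e) := by
  simp only [Inside]
  infer_instance

instance dec_good (k : Env M Γ → M.N) [Rep k] : Dec fun e => Good m L α β (k e) := by
  simp only [Good]
  infer_instance

/-- The part of the cell with index `k` that is near `z`. -/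
noncomputable def window (z : M.K) (k : M.N) : M.K :=
  cell m k (unitClamp (z + 3 * tw m)) - cell m k (unitClamp (z - 3 * tw m))

instance repK_window (z : Env M Γ → M.K) (k : Env M Γ → M.N) [RepK z] [Rep k] :
    RepK fun e => window m (z e) (k e) := by
  simp only [window]
  infer_instance

theorem window_nonneg (z : M.K) (k : M.N) : 0 ≤ window m z k :=
  sub_nonneg.2 (cell_mono m k (unitClamp_mono (by linarith [tw_pos m])))

theorem window_eq {z : M.K} {k : M.N} (hk : k < pow2 m) (h1 : z - 3 * tw m ≤ k * tw m)
    (h2 : (k : M.K) * tw m ≤ z + 2 * tw m) : window m z k = tw m := by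
  have h3 := tw_pos m
  have h4 := mul_le_mul_of_nonneg_right (cast_le.2 (succ_le_iff.2 hk)) (tw_pos m).le
  rw [pow2_mul_tw, cast_add, cast_one] at h4
  have h5 : ((k : M.K) + 1) * tw m ≤ unitClamp (z + 3 * tw m) :=
    le_max_of_le_right (le_min (by linarith) h4)
  have h6 : unitClamp (z - 3 * tw m) ≤ (k : M.K) * tw m :=
    max_le (mul_nonneg (cast_nonneg k) h3.le) (min_le_of_left_le h1)
  rw [window, cell, cell, min_eq_right (by linarith), max_eq_right h3.le,
    max_eq_left ((min_le_left _ _).trans (by linarith)), sub_zero]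

theorem ksum_window_le (z : M.K) : ksum (pow2 m) (fun k => window m z k) ≤ 6 * tw m := by
  have h := abs_unitClamp_sub_le (z + 3 * tw m) (z - 3 * tw m)
  rw [show z + 3 * tw m - (z - 3 * tw m) = 6 * tw m by ring,
    abs_of_nonneg (mul_nonneg (by norm_num : (0 : M.K) ≤ 6) (tw_pos m).le)] at h
  simp only [window]
  rw [ksum_sub, ksum_cell_eq m (unitClamp_nonneg _) (unitClamp_le_one _),
    ksum_cell_eq m (unitClamp_nonneg _) (unitClamp_le_one _)]
  exact (abs_le.1 h).2

open Classical in
theorem one_le_good_add (G : M.K → M.K) [RepFun G] (h0 : ∀ q, 0 ≤ G q)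
    (hG : ∀ k, k < pow2 m → (∀ l, l < L → Outside m α β k l) → 1 ≤ G (k * tw m)) :
    1 ≤ ksum (pow2 m) (fun k => if Good m L α β k then tw m else 0) + stepInt G m 1 +
      L * (12 * tw m) := by
  have h3 := tw_pos m
  have i1 : RepK (Γ := [.zero, .zero]) fun e : Env M _ =>
    window m (α e.1) e.2.1 + window m (β e.1) e.2.1 := inferInstance
  have i2 : RepK (Γ := [.zero, .zero]) fun e : Env M _ =>
    window m (α e.2.1) e.1 + window m (β e.2.1) e.1 := inferInstance
  have key : ∀ k, k < pow2 m → tw m ≤ (if Good m L α β k then tw m else 0) + G (k * tw m) * tw m +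
      ksum L fun l => window m (α l) k + window m (β l) k := by
    intro k hk
    have g1 : 0 ≤ G (k * tw m) * tw m := mul_nonneg (h0 _) h3.le
    have g3 : ∀ l, 0 ≤ window m (α l) k + window m (β l) k := fun l =>
      add_nonneg (window_nonneg _ _ _) (window_nonneg _ _ _)
    have g2 : 0 ≤ ksum L fun l => window m (α l) k + window m (β l) k := by
      have := ksum_le_ksum (f := fun _ => 0) (g := fun l => window m (α l) k + window m (β l) k)
        (n := L) fun l _ => g3 l
      rwa [ksum_const, mul_zero] at this
    by_cases hgood : Good m L α β k
    · rw [if_pos hgood]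
      linarith
    rw [if_neg hgood]
    by_cases hout : ∀ l, l < L → Outside m α β k l
    · have := mul_le_mul_of_nonneg_right (hG k hk hout) h3.le
      linarith
    push Not at hout
    obtain ⟨l, ⟨hl, hl'⟩, hmin⟩ := exists_least (fun l => l < L ∧ ¬Outside m α β k l) hout
    have hin : ¬Inside m α β k l := fun hin =>
      hgood ⟨l, hl, hin, fun j hj => by
        by_contra hj'
        exact hmin j hj ⟨hj.trans hl, hj'⟩⟩
    have g4 : tw m ≤ window m (α l) k + window m (β l) k := by
      rw [Outside, not_or, not_le, not_le] at hl'
      by_cases hα : (k : M.K) * tw m < α l + tw m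
      · have := window_eq m (z := α l) hk (by linarith) (by linarith)
        linarith [window_nonneg m (β l) k]
      · have hβ : β l - tw m < (k + 1) * tw m := by
          by_contra! hβ
          exact hin ⟨not_lt.1 hα, hβ⟩
        have := window_eq m (z := β l) hk (by linarith) (by linarith)
        linarith [window_nonneg m (α l) k]
    have g5 : window m (α l) k + window m (β l) k ≤
        ksum L fun l => window m (α l) k + window m (β l) k := by
      have : ∀ n, l < n → window m (α l) k + window m (β l) k ≤
          ksum n fun l => window m (α l) k + window m (β l) k := fun n =>
        Dec.induction (P := fun n => l < n → window m (α l) k + window m (β l) k ≤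
            ksum n fun l => window m (α l) k + window m (β l) k)
          (fun h => (not_lt_zero _ h).elim) (fun n ih h => by
            have g6 : 0 ≤ ksum n fun l => window m (α l) k + window m (β l) k := by
              have := ksum_le_ksum (f := fun _ => 0)
                (g := fun l => window m (α l) k + window m (β l) k) (n := n) fun l _ => g3 l
              rwa [ksum_const, mul_zero] at this
            rw [ksum_succ (fun l => window m (α l) k + window m (β l) k)]
            rcases lt_succ.1 h with h | rfl
            · exact (ih h).trans (le_add_of_nonneg_right (g3 n))
            · exact le_add_of_nonneg_left g6) n
      exact this L hl
    linarith
  have h1 := ksum_le_ksum key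
  rw [ksum_const, pow2_mul_tw, ksum_add, ksum_add, ← stepInt_one,
    ksum_comm (fun k l => window m (α l) k + window m (β l) k)] at h1
  have h2 : ksum L (fun l => ksum (pow2 m) fun k => window m (α l) k + window m (β l) k) ≤
      L * (12 * tw m) := by
    rw [← ksum_const]
    refine ksum_le_ksum fun l _ => ?_
    rw [ksum_add]
    linarith [ksum_window_le m (α l), ksum_window_le m (β l)]
  linarith

end

end Model
end HigherOrderArith

namespace HigherOrderArith
open FinType

namespace Model

variable {M : Model}

/-! ## Total length of the good cells -/

section

variable {Ψ : M.C tfun} {y : M.C tseq} {m L N : M.N} {α β : M.N → M.K}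

theorem subJ_of_good (hα : ∀ l n, N ≤ n → |seq (y l) n - seq (Ψ (y l)) n - α l| ≤ tw m)
    (hβ : ∀ l n, N ≤ n → |seq (y l) n + seq (Ψ (y l)) n - β l| ≤ tw m) {k : M.N}
    (h : Good m L α β k) {a b : M.C t1} {u v : M.K} (ha : ∀ n, seq a n = u)
    (hb : ∀ n, seq b n = v) (hu : k * tw m ≤ u) (hv : v ≤ (k + 1) * tw m) :
    ∃ i, i ≤ L ∧ SubJ Ψ y i a b := by
  obtain ⟨i, hi, hin, hout⟩ := h
  refine ⟨i, hi.le, ⟨.of_le N fun n hn => ?_, .of_le N fun n hn => ?_⟩, fun l hl => ?_⟩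
  · rw [ha]
    linarith [(abs_le.1 (hα i n hn)).2, hin.1]
  · rw [hb]
    linarith [(abs_le.1 (hβ i n hn)).1, hin.2]
  · refine (hout l hl).imp (fun h => .of_le N fun n hn => ?_) fun h => .of_le N fun n hn => ?_
    · rw [hb]
      linarith [(abs_le.1 (hα l n hn)).1]
    · rw [ha]
      linarith [(abs_le.1 (hβ l n hn)).2]

theorem TotalLengthGe.of_le_zero {r : M.N → M.K} (h : RLe r fun _ => 0) :
    TotalLengthGe Ψ y L r := by
  obtain ⟨S, hS⟩ := RepK.exists_seq₂ fun _ _ : M.N => (0 : M.K)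
  have h0 : ∀ i, seq (S i) = fun _ => 0 := fun i => funext (hS i)
  refine ⟨0, y, y, fun k hk => (not_lt_zero _ hk).elim, fun k hk => (not_lt_zero _ hk).elim, S,
    fun i _ => .of_abs_lt fun n k _ => ?_, ?_, fun i hi => (not_lt_zero _ hi).elim, ?_⟩
  · rw [hS, hS, sub_self, abs_zero]
    exact tw_pos n
  · rw [h0]
    exact .refl _
  · rwa [h0]

variable [RepK (Γ := [.zero]) fun e : Env M _ => α e.1]
  [RepK (Γ := [.zero]) fun e : Env M _ => β e.1]

open Classical in
theorem TotalLengthGe.of_good (hα : ∀ l n, N ≤ n → |seq (y l) n - seq (Ψ (y l)) n - α l| ≤ tw m)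
    (hβ : ∀ l n, N ≤ n → |seq (y l) n + seq (Ψ (y l)) n - β l| ≤ tw m) {r : M.N → M.K}
    (h : RLe r fun _ => ksum (pow2 m) fun k => if Good m L α β k then tw m else 0) :
    TotalLengthGe Ψ y L r := by
  by_cases hne : ∃ k, k < pow2 m ∧ Good m L α β k
  swap
  · refine .of_le_zero ?_
    have : ksum (pow2 m) (fun k => if Good m L α β k then tw m else 0) = 0 := by
      have h1 := ksum_congr (f := fun k => if Good m L α β k then tw m else 0) (g := fun _ => 0)
        (n := pow2 m) fun k hk => if_neg fun hk' => hne ⟨k, hk, hk'⟩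
      rw [h1, ksum_const, mul_zero]
    rwa [this] at h
  obtain ⟨g, ⟨hg, hgood⟩, hmin⟩ := exists_least _ hne
  have h3 := tw_pos m
  let pos : M.N → M.K := krec (fun k p => if Good m L α β k then (k + 1) * tw m else p) (g * tw m)
  have i1 : RepK (Γ := [.zero]) fun e : Env M _ => pos e.1 := inferInstance
  have pos_zero : pos 0 = g * tw m := krec_zero _ _
  have pos_succ (k : M.N) : pos (k + 1) = if Good m L α β k then (k + 1) * tw m else pos k :=
    krec_succ (fun k p => if Good m L α β k then (k + 1) * tw m else p) _ k
  have mem_pos : ∀ k, k ≤ pow2 m → ∃ j, j < pow2 m ∧ Good m L α β j ∧ j * tw m ≤ pos k ∧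
      pos k ≤ (j + 1) * tw m := by
    intro k
    refine Dec.induction (P := fun k => k ≤ pow2 m → ∃ j, j < pow2 m ∧ Good m L α β j ∧
      j * tw m ≤ pos k ∧ pos k ≤ (j + 1) * tw m) (fun _ => ⟨g, hg, hgood, ?_, ?_⟩)
      (fun k ih hk => ?_) k
    · rw [pos_zero]
    · rw [pos_zero]
      linarith
    · rw [pos_succ]
      split_ifs with hk'
      · exact ⟨k, succ_le_iff.1 hk, hk', by linarith, le_rfl⟩
      · exact ih (le_self_add.trans hk)
  have pos_le : ∀ k, pos k ≤ k * tw m ∨ pos k ≤ g * tw m := by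
    intro k
    refine Dec.induction (P := fun k => pos k ≤ k * tw m ∨ pos k ≤ g * tw m) (.inr pos_zero.le)
      (fun k ih => ?_) k
    rw [pos_succ]
    split_ifs with hk'
    · left
      push_cast
      exact le_rfl
    · refine ih.imp (fun h => ?_) id
      push_cast
      linarith
  have pos_le' : ∀ k, k < pow2 m → Good m L α β k → pos k ≤ k * tw m := fun k hk hk' =>
    (pos_le k).elim id fun h => h.trans (mul_le_mul_of_nonneg_right
      (cast_le.2 (not_lt.1 fun hkg => hmin k hkg ⟨hk, hk'⟩)) h3.le)
  let A : M.N → M.K := fun k => if Good m L α β k then k * tw m else pos k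
  let B : M.N → M.K := fun k => pos (k + 1)
  have i2 : RepK (Γ := [.zero]) fun e : Env M _ => A e.1 := by
    simp only [A]
    infer_instance
  have i3 : RepK (Γ := [.zero]) fun e : Env M _ => B e.1 :=
    RepK.comp (Γ := [.zero]) pos fun e : Env M [.zero] => e.1 + 1
  have i4 : RepK (Γ := [.zero, .zero]) fun e : Env M _ => A e.2.1 := inferInstance
  have i5 : RepK (Γ := [.zero, .zero]) fun e : Env M _ => B e.2.1 := inferInstance
  have hBA (k : M.N) : B k - A k = if Good m L α β k then tw m else 0 := by
    simp only [A, B, pos_succ]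
    split_ifs
    · ring
    · ring
  have hAB (k : M.N) : A k ≤ B k := by
    rw [← sub_nonneg, hBA]
    split_ifs
    · exact h3.le
    · exact le_rfl
  have mem : ∀ k, k < pow2 m → ∃ j, j < pow2 m ∧ Good m L α β j ∧ j * tw m ≤ A k ∧
      B k ≤ (j + 1) * tw m := by
    intro k hk
    by_cases hk' : Good m L α β k
    · refine ⟨k, hk, hk', ?_, ?_⟩
      · simp only [A, if_pos hk', le_refl]
      · simp only [B, pos_succ, if_pos hk', le_refl]
    · obtain ⟨j, hj, hj', h1, h2⟩ := mem_pos k hk.le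
      refine ⟨j, hj, hj', ?_, ?_⟩
      · simpa only [A, if_neg hk'] using h1
      · simpa only [B, pos_succ, if_neg hk'] using h2
  obtain ⟨a, ha⟩ := RepK.exists_seq₂ fun k _ : M.N => A k
  obtain ⟨b, hb⟩ := RepK.exists_seq₂ fun k _ : M.N => B k
  obtain ⟨S, hS⟩ := RepK.exists_seq₂ fun i _ : M.N => ksum i fun k => B k - A k
  have real_of {x : M.C t1} {c : M.K} (hx : ∀ n, seq x n = c) : IsReal x :=
    .of_abs_lt fun n k _ => by
      rw [hx, hx, sub_self, abs_zero]
      exact tw_pos n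
  have mem_I : ∀ k, k < pow2 m → (0 ≤ A k ∧ A k ≤ 1) ∧ 0 ≤ B k ∧ B k ≤ 1 := by
    intro k hk
    obtain ⟨j, hj, -, h1, h2⟩ := mem k hk
    have h4 := mul_le_mul_of_nonneg_right (cast_le.2 (succ_le_iff.2 hj)) h3.le
    rw [pow2_mul_tw, cast_add, cast_one] at h4
    have h5 := mul_nonneg (cast_nonneg j) h3.le
    have h6 := hAB k
    refine ⟨⟨?_, ?_⟩, ?_, ?_⟩ <;> linarith
  refine ⟨pow2 m, a, b, fun k hk => ⟨?_, ?_, ?_, ?_⟩, fun k hk => ?_, S, fun i _ => real_of (hS i),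
    ?_, fun i hi => ?_, ?_⟩
  · exact .of_mem (real_of (ha k)) fun n => by rw [ha]; exact (mem_I k hk).1
  · exact .of_mem (real_of (hb k)) fun n => by rw [hb]; exact (mem_I k hk).2
  · exact .of_le 0 fun n _ => by rw [ha, hb]; exact hAB k
  · obtain ⟨j, hj, hj', h1, h2⟩ := mem k hk
    exact subJ_of_good hα hβ hj' (ha k) (hb k) h1 h2
  · refine .of_le 0 fun n _ => ?_
    rw [ha, hb]
    by_cases hk' : Good m L α β (k + 1)
    · simp only [A, B, if_pos hk']
      exact pos_le' (k + 1) hk hk'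
    · simp only [A, B, if_neg hk', le_refl]
  · rw [show seq (S 0) = fun _ => 0 from funext fun n => by rw [hS, ksum_zero]]
    exact .refl _
  · have e1 : seq (S (i + 1)) = fun n => seq (S i) n + (seq (b i) n - seq (a i) n) :=
      funext fun n => by rw [hS, hS, ha, hb, ksum_succ]
    rw [e1]
    exact .refl _
  · rw [show seq (S (pow2 m)) = fun _ => ksum (pow2 m) fun k => if Good m L α β k then tw m else 0
      from funext fun n => by rw [hS]; simp only [hBA]]
    exact h

end

end Model
end HigherOrderArith

namespace HigherOrderArith
open FinType

namespace Model

variable {M : Model}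

/-! ## The principle for nets implies weak compactness -/

theorem exists_hat : ∃ H : M.C (.arrow t1 t1), (∀ p, InI (H p)) ∧ ∀ p n, seq (H p) n = approx p n := by
  obtain ⟨H, hH⟩ := RepK.exists_seq₂ fun (p : M.C t1) n => approx p n
  refine ⟨H, fun p => .of_mem (.of_abs_lt fun n k hnk => ?_) fun n => ?_, hH⟩
  · rw [hH, hH]
    exact (abs_approx_sub_lt p hnk).trans_le (tw_anti le_self_add)
  · rw [hH]
    exact approx_mem p n

/-- Scales below the values of `Ψ` can be chosen. -/
theorem exists_scale {Ψ : M.C tfun} (hpos : ∀ x, InI x → Pos (Ψ x)) {H : M.C (.arrow t1 t1)}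
    (hH : ∀ p, InI (H p)) : ∃ Y : M.C t2, ∀ p, 9 * tw (Y p) < seq (Ψ (H p)) (Y p) := by
  refine exists_choice (fun p n => 9 * tw n < seq (Ψ (H p)) n) fun p => ?_
  obtain ⟨m, N, h⟩ := (hpos _ (hH p)).exists_tw_le
  refine ⟨N + (m + 4), lt_of_lt_of_le ?_ (h _ le_self_add)⟩
  have h1 : tw (N + (m + 4)) ≤ tw (m + 4) := tw_anti le_add_self
  rw [tw_add m, tw_ofNat] at h1
  linarith [tw_pos m]

theorem exists_key (Y : M.C t2) :
    ∃ κ : M.C t2, ∀ p, qv (fst (κ p)) = approx p (Y p) ∧ snd (κ p) = Y p := by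
  have h0 : RepK (Γ := [t1]) fun e : Env M _ => approx e.1 (Y e.1) := inferInstance
  obtain ⟨c, hc, h⟩ := h0.out
  have : Rep (Γ := [t1]) fun e : Env M _ => c (e.1, ()) := hc
  obtain ⟨κ, hκ⟩ := Rep.exists_obj fun p : M.C t1 => pair (c (p, ())) (Y p)
  exact ⟨κ, fun p => by rw [hκ, fst_pair, snd_pair]; exact ⟨h (p, ()), rfl⟩⟩

theorem exists_refines (κ : M.C t2) : ∃ R : M.C trel, (∀ a b, R a b ≤ 1) ∧
    ∀ a b, R a b = 1 ↔ Refines κ a b := by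
  classical
  have : Dec (Γ := [t1, t1]) fun e : Env M _ => Refines κ e.2.1 e.1 := by
    simp only [Refines]
    infer_instance
  obtain ⟨R, hR⟩ := Rep.exists_obj₂ fun a b : M.C t1 => if Refines κ a b then (1 : M.N) else 0
  refine ⟨R, fun a b => ?_, fun a b => ?_⟩
  · rw [hR]
    split_ifs
    exacts [le_rfl, zero_le]
  · rw [hR]
    split_ifs with h <;> simp [h]

theorem abs_sub_approx_le {x : M.C t1} (hx : InI x) (n : M.N) {k : M.N} (hk : n + (1 + 1) ≤ k) :
    |seq x k - approx x n| ≤ tw n := by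
  rw [approx_eq hx.1]
  have h2 : tw (n + (1 + 1)) = tw n / 4 := by rw [← add_assoc, tw_succ, tw_succ]; ring
  have h4 := abs_le.1 (abs_unitClamp_sub_self_le (x := seq x (n + (1 + 1))) (r := tw (n + (1 + 1)))
    (by linarith [hx.nonneg (n + (1 + 1))]) (by linarith [hx.le_one (n + (1 + 1))]) (tw_pos _).le)
  have h5 := abs_lt.1 (hx.1.abs_lt hk)
  rw [h2] at h4 h5
  have h6 := tw_pos n
  generalize seq x (n + (1 + 1)) = s at *
  rw [abs_le]
  constructor <;> linarith [h4.1, h4.2, h5.1, h5.2]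

section

variable {κ : M.C t2} {F : M.C tnet}

theorem isFun_net (hF : ∀ d x n, seq (F d x) n = netVal κ d (seq x (n + (scale κ d + 1))))
    (d : M.C t1) : IsFun (F d) := by
  have hL := pow2_pos (scale κ d)
  have e (n : M.N) : n + (scale κ d + 1) = n + 1 + scale κ d := by ring
  refine ⟨fun x hx => .of_abs_lt fun n k hnk => ?_, fun x hx y hy hxy n => ?_⟩
  · rw [hF, hF]
    refine (abs_netVal_sub_le κ d _ _).trans_lt ?_
    refine (mul_lt_mul_of_pos_left (hx.1.abs_lt (add_le_add_left hnk _)) hL).trans_le ?_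
    rw [e, pow2_mul_tw_add]
    exact tw_anti le_self_add
  · have h1 := hxy (n + (scale κ d + 1))
    have h2 := abs_le.1 <| (abs_netVal_sub_le κ d _ _).trans <| mul_le_mul_of_nonneg_left
      (show |seq x (n + (scale κ d + 1)) - seq y (n + (scale κ d + 1))| ≤
        2 * tw (n + 1 + scale κ d) by
          rw [← e, abs_le]
          constructor <;> linarith) hL.le
    rw [mul_left_comm, pow2_mul_tw_add, tw_succ] at h2
    rw [hF, hF]
    constructor <;> linarith [tw_pos n]

theorem isContinuous_net (hF : ∀ d x n, seq (F d x) n = netVal κ d (seq x (n + (scale κ d + 1))))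
    (d : M.C t1) : IsContinuous (F d) := by
  intro x hx ε hε hε0
  obtain ⟨m, N, h⟩ := hε0.exists_tw_le
  obtain ⟨δ, hδ, hδ'⟩ := exists_const (tw (m + 1 + scale κ d) : M.K)
  refine ⟨δ, hδ, .of_const (tw_pos _) hδ', fun y hy hxy => ?_⟩
  obtain ⟨m', N', h'⟩ := hxy
  refine ⟨m + 1, N + N', fun n hn => ?_⟩
  have h1 := h n (le_self_add.trans hn)
  have h2 := h' (n + (scale κ d + 1)) ((le_add_self.trans hn).trans le_self_add)
  have h3 := (abs_netVal_sub_le κ d _ _).trans (mul_le_mul_of_nonneg_left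
    (show |seq x (n + (scale κ d + 1)) - seq y (n + (scale κ d + 1))| ≤ tw (m + 1 + scale κ d) by
      rw [hδ'] at h2
      linarith [tw_pos m']) (pow2_pos (scale κ d)).le)
  rw [pow2_mul_tw_add, tw_succ] at h3
  change |seq (F d x) n - seq (F d y) n| + _ ≤ _
  rw [hF, hF, tw_succ]
  linarith

theorem rle_net (hF : ∀ d x n, seq (F d x) n = netVal κ d (seq x (n + (scale κ d + 1))))
    {a b : M.C t1} (h : Refines κ a b) {x : M.C t1} (hx : IsReal x) :
    RLe (seq (F a x)) (seq (F b x)) := by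
  have key (d : M.C t1) (n k : M.N) (hk : n + 1 + scale κ d ≤ k) :
      |netVal κ d (seq x k) - seq (F d x) n| ≤ tw n / 2 := by
    rw [hF, show n + (scale κ d + 1) = n + 1 + scale κ d by ring, ← tw_succ,
      ← pow2_mul_tw_add (scale κ d)]
    exact (abs_netVal_sub_le κ d _ _).trans
      (mul_le_mul_of_nonneg_left (hx.abs_lt hk).le (pow2_pos _).le)
  refine .of_le_tw 1 0 fun n _ => ?_
  have h1 := abs_le.1 (key a n (n + 1 + scale κ a + scale κ b)
    (le_self_add : n + 1 + scale κ a ≤ _))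
  have h2 := abs_le.1 (key b n (n + 1 + scale κ a + scale κ b)
    ((le_self_add : n + 1 + scale κ b ≤ _).trans_eq (add_right_comm _ _ (scale κ a))))
  have h3 := h.netVal_le (seq x (n + 1 + scale κ a + scale κ b))
  rw [cast_one]
  linarith

theorem tendsto_net (hF : ∀ d x n, seq (F d x) n = netVal κ d (seq x (n + (scale κ d + 1))))
    {Y : M.C t2} (hκ : ∀ p, qv (fst (κ p)) = approx p (Y p) ∧ snd (κ p) = Y p) {x : M.C t1}
    (hx : InI x) : ∃ d, ∀ e, Refines κ d e → ∀ n, 1 ≤ n → seq (F e x) n = 1 := by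
  obtain ⟨d, hd, hd'⟩ := exists_comp_eq 1 fun _ n => x n
  refine ⟨d, fun e he n hn => ?_⟩
  obtain ⟨j, hj, h⟩ := he 0 (by rw [hd]; exact zero_lt_one)
  rw [show comp d 0 = x from M.ext _ _ fun n => hd' 0 n] at h
  rw [hF]
  refine le_antisymm (netVal_le_one κ e _) (le_of_eq_of_le ?_ (tent_le_netVal κ hj _))
  rw [← h, tent_eq_one]
  rw [(hκ x).1, (hκ x).2]
  refine abs_sub_approx_le hx _ ?_
  have h1 := snd_le_scale κ hj
  rw [← h, (hκ x).2] at h1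
  calc Y x + (1 + 1) ≤ scale κ e + (1 + 1) := add_le_add_left h1 _
    _ = 1 + (scale κ e + 1) := by ring
    _ ≤ n + (scale κ e + 1) := add_le_add_left hn _

end

instance repFun_net (κ : M.C t2) (d : M.C t1) : RepFun fun q => 1 - netVal κ d q :=
  ⟨inferInstance⟩

/-- The intervals of a finite sequence `d` cover the support of the member of the net. -/
theorem outside_imp_le {Ψ : M.C tfun} {H : M.C (.arrow t1 t1)} {Y κ : M.C t2}
    (hH : ∀ p, InI (H p)) (hH' : ∀ p n, seq (H p) n = approx p n) (hΨ : ∀ x, InI x → IsReal (Ψ x))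
    (hY : ∀ p, 9 * tw (Y p) < seq (Ψ (H p)) (Y p))
    (hκ : ∀ p, qv (fst (κ p)) = approx p (Y p) ∧ snd (κ p) = Y p) (d : M.C t1) {m N k : M.N}
    (hm : scale κ d ≤ m) (hN : m ≤ N)
    (h : ∀ l, l < d 0 → Outside m (fun l => seq (H (comp d l)) N - seq (Ψ (H (comp d l))) N)
      (fun l => seq (H (comp d l)) N + seq (Ψ (H (comp d l))) N) k l) :
    1 ≤ 1 - netVal κ d (k * tw m) := by
  by_contra! h'
  obtain ⟨i, hi, h1⟩ := exists_of_netVal_pos κ (show 0 < netVal κ d (k * tw m) by linarith)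
  have h2 := snd_le_scale κ hi
  rw [(hκ _).2] at h1 h2
  rw [(hκ _).1] at h1
  have h3 := abs_approx_sub_lt (comp d i) ((h2.trans hm).trans hN)
  have h4 := (hΨ _ (hH (comp d i))).abs_lt ((h2.trans hm).trans hN)
  have h5 := hY (comp d i)
  have h6 := tw_anti (h2.trans hm)
  have h7 := tw_pos m
  rw [tw_succ, ← hH' _ N] at h3
  rw [abs_lt] at h1 h3 h4
  rcases h i hi with h8 | h8
  · linarith
  · linarith

/-- Increasing nets with the limit `1` give finite coverings of almost all of `[0, 1]`. -/
theorem totalLengthGe_of_integral {Ψ : M.C tfun} {H : M.C (.arrow t1 t1)} {Y κ : M.C t2}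
    (hH : ∀ p, InI (H p)) (hH' : ∀ p n, seq (H p) n = approx p n) (hΨ : ∀ x, InI x → IsReal (Ψ x))
    (hY : ∀ p, 9 * tw (Y p) < seq (Ψ (H p)) (Y p))
    (hκ : ∀ p, qv (fst (κ p)) = approx p (Y p) ∧ snd (κ p) = Y p) (d : M.C t1) {y : M.C tseq}
    (hy : ∀ l, y l = H (comp d l)) {m₀ N : M.N}
    (hA : ∀ k, N ≤ k → stepInt (fun q => 1 - netVal κ d q) (k + (scale κ d + 3)) 1 ≤ tw (m₀ + 1))
    {ε : M.C t1} (hε : ∀ k, N ≤ k → tw m₀ ≤ seq ε k) :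
    TotalLengthGe Ψ y (d 0) fun k => 1 - seq ε k := by
  classical
  let m := N + (d 0 + (m₀ + 5)) + (scale κ d + 3)
  have h1 := hA _ (le_self_add : N ≤ N + (d 0 + (m₀ + 5)))
  have h2 : (d 0 : M.K) * (12 * tw m) ≤ tw (m₀ + 1) := by
    have h3 : tw m ≤ tw (m₀ + 5 + d 0) :=
      tw_anti ((add_comm _ _).le.trans (le_add_self.trans le_self_add))
    have h4 := mul_le_mul_of_nonneg_left h3 (cast_nonneg (d 0))
    have h5 := h4.trans (mul_tw_add_le (d 0) (m₀ + 5))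
    rw [tw_add m₀, tw_ofNat] at h5
    rw [tw_succ]
    linarith [tw_pos m₀]
  let α : M.N → M.K := fun l => seq (H (comp d l)) (m + 1) - seq (Ψ (H (comp d l))) (m + 1)
  let β : M.N → M.K := fun l => seq (H (comp d l)) (m + 1) + seq (Ψ (H (comp d l))) (m + 1)
  have i1 : RepK (Γ := [.zero]) fun e : Env M _ => α e.1 := by
    simp only [α]
    infer_instance
  have i2 : RepK (Γ := [.zero]) fun e : Env M _ => β e.1 := by
    simp only [β]
    infer_instance
  have hm : scale κ d ≤ m := le_self_add.trans le_add_self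
  have h3 := one_le_good_add m (d 0) α β (fun q => 1 - netVal κ d q)
    (fun q => sub_nonneg.2 (netVal_le_one κ d q)) fun k _ h =>
      outside_imp_le hH hH' hΨ hY hκ d hm le_self_add h
  have h4 : tw (m + 1) = tw m / 2 := tw_succ m
  refine TotalLengthGe.of_good (N := m + 1) (m := m) (α := α) (β := β) (fun l n hn => ?_)
    (fun l n hn => ?_) (.of_le N fun k hk => ?_)
  · have h5 := abs_lt.1 ((hH (comp d l)).1.abs_lt hn)
    have h6 := abs_lt.1 ((hΨ _ (hH (comp d l))).abs_lt hn)
    rw [hy, abs_le]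
    constructor <;> linarith
  · have h5 := abs_lt.1 ((hH (comp d l)).1.abs_lt hn)
    have h6 := abs_lt.1 ((hΨ _ (hH (comp d l))).abs_lt hn)
    rw [hy, abs_le]
    constructor <;> linarith
  · have h5 := hε k hk
    rw [tw_succ] at h1 h2
    linarith

theorem sat_WHBU0_of_sat_MCTnet {v : M.Val} (h : Struc.sat v MCTnet) : Struc.sat v WHBU0 := by
  rw [sat_MCTnet] at h
  rw [sat_WHBU0]
  intro Ψ hΨ hpos ε hε hε0
  obtain ⟨H, hH, hH'⟩ := exists_hat (M := M)
  obtain ⟨Y, hY⟩ := exists_scale hpos hH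
  obtain ⟨κ, hκ⟩ := exists_key Y
  obtain ⟨R, hR, hR'⟩ := exists_refines κ
  obtain ⟨F, hF⟩ := exists_net κ
  obtain ⟨D, hD⟩ := Rep.exists_obj fun _ : M.C t1 => (1 : M.N)
  obtain ⟨g, hg⟩ := RepK.exists_seq₂ fun (_ : M.C t1) (_ : M.N) => (1 : M.K)
  obtain ⟨m, N, hm⟩ := hε0.exists_tw_le
  obtain ⟨ε', hε', hε''⟩ := exists_const (tw (m + 1) : M.K)
  have hgr (x : M.C t1) : IsReal (g x) := .of_abs_lt fun n k _ => by
    rw [hg, hg, sub_self, abs_zero]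
    exact tw_pos n
  obtain ⟨d, -, hd⟩ := h D R F g
    ⟨fun a => (hD a).le, hR, ⟨M.dflt _, hD _⟩,
      fun a _ b _ c _ => by simp only [hR']; exact fun h => h.1.trans h.2,
      fun a _ => (hR' a a).2 (.refl κ a), fun a _ b _ => by
        obtain ⟨c, hc⟩ := Refines.directed κ a b
        exact ⟨c, hD c, (hR' _ _).2 hc.1, (hR' _ _).2 hc.2⟩⟩
    (fun d _ => ⟨isFun_net hF d, isContinuous_net hF d⟩)
    (fun a _ b _ hab x hx => rle_net hF ((hR' _ _).1 hab) hx.1)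
    ⟨fun x _ => hgr x, fun x _ y _ _ n => by
      rw [hg, hg]
      constructor <;> linarith [tw_pos n]⟩
    (fun x hx η hη hη0 => by
      obtain ⟨d, hd⟩ := tendsto_net hF hκ hx
      obtain ⟨m, N, hm⟩ := hη0.exists_tw_le
      refine ⟨d, hD d, fun e _ he => ⟨m, N + 1, fun n hn => ?_⟩⟩
      change |seq (F e x) n - seq (g x) n| + _ ≤ _
      rw [hd e ((hR' _ _).1 he) n (le_add_self.trans hn), hg, sub_self, abs_zero, zero_add]
      exact hm n (le_self_add.trans hn))
    ⟨1, fun x _ => .of_le 0 fun n _ => by rw [hg, abs_one, cast_one]⟩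
    (fun x _ η hη hη0 => by
      obtain ⟨m, N, hm⟩ := hη0.exists_tw_le
      obtain ⟨δ, hδ, hδ'⟩ := exists_const (1 : M.K)
      refine ⟨δ, hδ, .of_const one_pos hδ', fun y _ _ => ⟨m, N, fun n hn => ?_⟩⟩
      change |seq (g x) n - seq (g y) n| + _ ≤ _
      rw [hg, hg, sub_self, abs_zero, zero_add]
      exact hm n hn)
    ε' hε' (.of_const (tw_pos _) hε'')
  obtain ⟨A, hA, hA', hint⟩ := exists_riemannIntegral (G := fun q => 1 - netVal κ d q)
    (Λ := scale κ d) (c := scale κ d + 1)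
    (fun q => ⟨sub_nonneg.2 (netVal_le_one κ d q), sub_le_self _ (netVal_nonneg κ d q)⟩)
    (fun q q' => by
      rw [sub_sub_sub_cancel_left, abs_sub_comm q]
      exact abs_netVal_sub_le κ d q' q) le_self_add
  obtain ⟨m', N', hlt⟩ := hd d (hD d) ((hR' _ _).2 (.refl κ d)) A hA (hint _ fun x n => by
    rw [hg, hF, abs_of_nonneg (sub_nonneg.2 (netVal_le_one κ d _))])
  obtain ⟨y, hy⟩ := Rep.exists_obj fun l : M.N => H (comp d l)
  refine ⟨d 0, y, fun i _ => by rw [hy]; exact hH _, ?_⟩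
  refine totalLengthGe_of_integral (N := N + N') hH hH' hΨ.1 hY hκ d hy (fun k hk => ?_)
    fun k hk => hm k (le_self_add.trans hk)
  have h1 := hlt k (le_add_self.trans hk)
  change |seq A k| + _ ≤ _ at h1
  rw [hε'', hA'] at h1
  linarith [le_abs_self (stepInt (fun q => 1 - netVal κ d q) (k + (scale κ d + 3)) 1), tw_pos m']

end Model

end HigherOrderArith

/-- The system `RCA₀^ω + WWKL + MCT_net` proves `WHBU₀`. -/
theorem mainTheorem8 :
    HigherOrderArith.Proves
      (HigherOrderArith.RCA0omega ∪ {HigherOrderArith.WWKL, HigherOrderArith.MCTnet})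
      HigherOrderArith.WHBU0 := by
  have h : HigherOrderArith.Proves HigherOrderArith.RCA0omega
      (.imp HigherOrderArith.MCTnet HigherOrderArith.WHBU0) :=
    HigherOrderArith.proves_of_forall_model fun _ _ h =>
      HigherOrderArith.Model.sat_WHBU0_of_sat_MCTnet h
  exact (h.mono Set.subset_union_left).impE (.ax (.inr (.inr rfl)))
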